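/- Let $L>0$, let $U\in C^\infty(\mathbb R)$ be real-valued, even and $L$-periodic, and let $H_\infty=-\frac{d^2}{dy^2}+U(y)$ on $L^2(\mathbb R)$ (complex-valued functions) with domain $H^2(\mathbb R)$. Let $E_*\in\mathbb R$ lie in an open gap of $\mathrm{spec}(H_\infty)$, i.e. $E_*\in(a,b)$ with $a,b\in\mathrm{spec}(H_\infty)$ and $(a,b)\cap\mathrm{spec}(H_\infty)=\varnothing$. Put $Q_\infty=H_\infty-E_*I$ and $$D_\infty=\begin{pmatrix}0&Q_\infty\\Q_\infty&0\end{pmatrix}\quad\text{on } L^2(\mathbb R)\oplus L^2(\mathbb R),\qquad D(D_\infty)=H^2(\mathbb R)\oplus H^2(\mathbb R).$$ For each prime $p$ let $d^\times x_p$ be the Haar measure on $\mathbb Q_p^\times$ with $d^\times x_p(\mathbb Z_p^\times)=1$, and let $\mathcal H_{\mathrm{fin}}=\bigotimes_p' L^2(\mathbb Q_p^\times,d^\times x_p)$ be the restricted Hilbert tensor product over all primes with respect to the vectors $1_{\mathbb Z_p^\times}$, i.e. the completion of the span of the pure tensors $\bigotimes_p\psi_p$ with $\psi_p=1_{\mathbb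 Z_p^\times}$ for all but finitely many $p$, where $\langle\otimes_p\psi_p,\otimes_p\varphi_p\rangle=\prod_p\langle\psi_p,\varphi_p\rangle$. Let $I_{\mathrm{fin}}$ be the identity on $\mathcal H_{\mathrm{fin}}$, and let $D_{\mathrm{glob}}=D_\infty\,\hat\otimes\, I_{\mathrm{fin}}$ on $(L^2(\mathbb R)\oplus L^2(\mathbb R))\,\hat\otimes\,\mathcal H_{\mathrm{fin}}$ be the closure of $D_\infty\otimes I_{\mathrm{fin}}$ on the algebraic tensor product $D(D_\infty)\otimes\mathcal H_{\mathrm{fin}}$. Then: 1. $D_{\mathrm{glob}}$ is self-adjoint. 2. $\mathrm{spec}(D_{\mathrm{glob}})=\mathrm{spec}(D_\infty)=\{\pm(\lambda-E_*):\lambda\in\mathrm{spec}(H_\infty)\}$. 3. Every spectral value $z$ of $D_{\mathrm{glob}}$ has infinite multiplicity: $D_{\mathrm{glob}}$ has infinitely many mutually orthogonal reducing parts, all unitarily equivalent to one self-adjoint operator whose spectrum contains $z$. Moreover the multiplicity is uniformly infinite: $D_{\mathrm{glob}}$ is unitarily equivalent to an orthogonal sum of infinitely many copies of one self-adjoint operator.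 4. $D_{\mathrm{glob}}$ has a band-gap spectrum symmetric about $0$. There are real numbers $\alpha_0\le\beta_0\le\alpha_1\le\beta_1\le\cdots$ with $\alpha_n\to\infty$ such that $\mathrm{spec}(H_\infty)=\bigcup_{n\ge0}[\alpha_n,\beta_n]$, $E_*\in(\beta_m,\alpha_{m+1})$ for some $m$, and $$\mathrm{spec}(D_{\mathrm{glob}})=\bigcup_{n\ge0}\bigl([\alpha_n-E_*,\beta_n-E_*]\cup[-(\beta_n-E_*),-(\alpha_n-E_*)]\bigr).$$ Moreover $\mathrm{spec}(D_{\mathrm{glob}})=-\mathrm{spec}(D_{\mathrm{glob}})$, and there is an open gap around $0$: for some $\delta>0$, $\pm\delta\in\mathrm{spec}(D_{\mathrm{glob}})$ and $(-\delta,\delta)\cap\mathrm{spec}(D_{\mathrm{glob}})=\varnothing$. -/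

import Mathlib

open MeasureTheory TensorProduct Filter
open scoped ENNReal ContDiff SchwartzMap InnerProductSpace ComplexConjugate

noncomputable section

/-! ### Unbounded operators on complex Hilbert spaces -/

namespace UnboundedOp

universe u

variable {H : Type u} [NormedAddCommGroup H] [InnerProductSpace ℂ H]

/-- `z` lies in the resolvent set of `A`: the map `A - z`, defined on the domain of `A`, has an
everywhere defined bounded two-sided inverse `R`. -/
def IsResolventPoint (A : H →ₗ.[ℂ] H) (z : ℂ) : Prop :=
  ∃ R : H →L[ℂ] H,
    (∀ x : H, ∃ h : R x ∈ A.domain, A ⟨R x, h⟩ - z • R x = x) ∧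
      ∀ x : A.domain, R (A x - z • (x : H)) = x

/-- The spectrum of an unbounded operator: the complement of the resolvent set. -/
def spec (A : H →ₗ.[ℂ] H) : Set ℂ := {z | ¬ IsResolventPoint A z}

/-- The operator `A - E` with the same domain as `A`. -/
def shift (A : H →ₗ.[ℂ] H) (E : ℝ) : H →ₗ.[ℂ] H where
  domain := A.domain
  toFun := A.toFun - (E : ℂ) • A.domain.subtype

/-- The chiral doubling `(0 Q; Q 0)` of `Q` on the Hilbert sum `H ⊕ H`, with domain
`D(Q) ⊕ D(Q)`. -/
def chiralDouble (Q : H →ₗ.[ℂ] H) : WithLp 2 (H × H) →ₗ.[ℂ] WithLp 2 (H × H) where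
  domain :=
    { carrier := {v | v.fst ∈ Q.domain ∧ v.snd ∈ Q.domain}
      add_mem' := fun ha hb => ⟨Q.domain.add_mem ha.1 hb.1, Q.domain.add_mem ha.2 hb.2⟩
      zero_mem' := ⟨Q.domain.zero_mem, Q.domain.zero_mem⟩
      smul_mem' := fun c _ ha => ⟨Q.domain.smul_mem c ha.1, Q.domain.smul_mem c ha.2⟩ }
  toFun :=
    { toFun := fun v => WithLp.toLp 2 (Q ⟨v.1.snd, v.2.2⟩, Q ⟨v.1.fst, v.2.1⟩)
      map_add' := fun v w => by
        rw [← WithLp.toLp_add, Prod.mk_add_mk, ← LinearPMap.map_add, ← LinearPMap.map_add]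
        rfl
      map_smul' := fun c v => by
        rw [RingHom.id_apply, ← WithLp.toLp_smul, Prod.smul_mk, ← LinearPMap.map_smul,
          ← LinearPMap.map_smul]
        rfl }

section Tensor

variable (K : Type*) [NormedAddCommGroup K] [InnerProductSpace ℂ K]

/-- The Hilbert space tensor product: the completion of the algebraic tensor product. -/
abbrev HilbertTensor (H : Type*) [NormedAddCommGroup H] [InnerProductSpace ℂ H]
    (K : Type*) [NormedAddCommGroup K] [InnerProductSpace ℂ K] : Type _ :=
  UniformSpace.Completion (H ⊗[ℂ] K)

/-- The inclusion of `D ⊗ K` (algebraic tensor product) into the Hilbert tensor product of `H`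
and `K`, for a linear subspace `D` of `H`. -/
def tensorIncl (D : Submodule ℂ H) : D ⊗[ℂ] K →ₗ[ℂ] HilbertTensor H K :=
  (UniformSpace.Completion.toComplL (𝕜 := ℂ) (E := H ⊗[ℂ] K)).toLinearMap ∘ₗ
    LinearMap.rTensor K D.subtype

theorem tensorIncl_injective (D : Submodule ℂ H) : Function.Injective (tensorIncl K D) := by
  intro x y h
  have h1 : ((LinearMap.rTensor K D.subtype x : H ⊗[ℂ] K) : HilbertTensor H K) =
      ((LinearMap.rTensor K D.subtype y : H ⊗[ℂ] K) : HilbertTensor H K) := h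
  exact Module.Flat.rTensor_preserves_injective_linearMap (M := K) D.subtype
    D.subtype_injective (UniformSpace.Completion.coe_injective _ h1)

/-- The operator `A ⊗ I_K` on the algebraic tensor product `D(A) ⊗ K`. -/
def algTensorId (A : H →ₗ.[ℂ] H) : HilbertTensor H K →ₗ.[ℂ] HilbertTensor H K where
  domain := LinearMap.range (tensorIncl K A.domain)
  toFun := (UniformSpace.Completion.toComplL (𝕜 := ℂ) (E := H ⊗[ℂ] K)).toLinearMap ∘ₗ
    LinearMap.rTensor K A.toFun ∘ₗ
      (LinearEquiv.ofInjective _ (tensorIncl_injective K A.domain)).symm.toLinearMap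

/-- The operator `A ⊗ I_K` on the Hilbert tensor product: the closure of `A ⊗ I_K` on the
algebraic tensor product `D(A) ⊗ K`. -/
def tensorId (A : H →ₗ.[ℂ] H) : HilbertTensor H K →ₗ.[ℂ] HilbertTensor H K :=
  (algTensorId K A).closure

end Tensor

/-- The isometries `V i` embed copies of the operator `B` into `A`, with mutually orthogonal
ranges: `V i B ⊆ A V i`. For self-adjoint `A` and `B` the ranges are then reducing subspaces, and
the part of `A` in each of them is unitarily equivalent to `B`. -/
structure IsOrthogonalCopies {ι : Type} {K : Type u} [NormedAddCommGroup K]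
    [InnerProductSpace ℂ K] (A : H →ₗ.[ℂ] H) (B : K →ₗ.[ℂ] K) (V : ι → K →ₗᵢ[ℂ] H) : Prop where
  orthogonal : ∀ i j, i ≠ j → ∀ x y : K, ⟪V i x, V j y⟫_ℂ = 0
  intertwines : ∀ i, ∀ x : B.domain, ∃ h : V i x ∈ A.domain, A ⟨V i x, h⟩ = V i (B x)

/-- The spectral value `z` of `A` has infinite multiplicity: `A` has infinitely many mutually
orthogonal reducing parts which are all unitarily equivalent to one self-adjoint operator whose
spectrum contains `z`. -/
def HasInfiniteMultiplicityAt (A : H →ₗ.[ℂ] H) (z : ℂ) : Prop :=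
  ∃ (ι : Type) (_ : Infinite ι) (K : Type u) (_ : NormedAddCommGroup K)
    (_ : InnerProductSpace ℂ K) (_ : CompleteSpace K) (B : K →ₗ.[ℂ] K) (V : ι → K →ₗᵢ[ℂ] H),
    IsSelfAdjoint B ∧ z ∈ spec B ∧ IsOrthogonalCopies A B V

/-- `A` has uniformly infinite multiplicity: `A` is unitarily equivalent to an orthogonal sum of
infinitely many copies of one self-adjoint operator. -/
def HasUniformInfiniteMultiplicity (A : H →ₗ.[ℂ] H) : Prop :=
  ∃ (ι : Type) (_ : Infinite ι) (K : Type u) (_ : NormedAddCommGroup K)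
    (_ : InnerProductSpace ℂ K) (_ : CompleteSpace K) (B : K →ₗ.[ℂ] K) (V : ι → K →ₗᵢ[ℂ] H),
    IsSelfAdjoint B ∧ IsOrthogonalCopies A B V ∧
      (⨆ i, LinearMap.range (V i).toLinearMap).topologicalClosure = ⊤

end UnboundedOp

/-! ### The real place -/

namespace RealPlace

/-- `L²(ℝ, dy)`. -/
abbrev L2R : Type := Lp ℂ 2 (volume : Measure ℝ)

/-- The Sobolev space `H²(ℝ)` as a subspace of `L²(ℝ)`. -/
def sobolevH2 : Submodule ℂ L2R where
  carrier := {f | TemperedDistribution.MemSobolev 2 2 (f : 𝓢'(ℝ, ℂ))}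
  add_mem' {f g} hf hg := by
    have := TemperedDistribution.MemSobolev.add hf hg
    simp only [Set.mem_ofPred_eq] at *
    rw [← Lp.toTemperedDistributionCLM_apply, map_add]
    simpa using this
  zero_mem' := by
    simp only [Set.mem_ofPred_eq]
    rw [← Lp.toTemperedDistributionCLM_apply, map_zero]
    exact TemperedDistribution.memSobolev_fun_zero ℝ ℂ 2 2
  smul_mem' c f hf := by
    have := TemperedDistribution.MemSobolev.smul c hf
    simp only [Set.mem_ofPred_eq] at *
    rw [← Lp.toTemperedDistributionCLM_apply, map_smul]
    simpa using this

/-- `g` is the second distributional derivative of `f`. -/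
def IsSecondDeriv (f g : L2R) : Prop :=
  TemperedDistribution.derivCLM ℂ (TemperedDistribution.derivCLM ℂ (f : 𝓢'(ℝ, ℂ))) =
    (g : 𝓢'(ℝ, ℂ))

theorem derivCLM_eq_lineDerivOp (f : 𝓢'(ℝ, ℂ)) :
    TemperedDistribution.derivCLM ℂ f = LineDeriv.lineDerivOp (1 : ℝ) f := by
  ext g
  rw [TemperedDistribution.derivCLM_apply_apply, TemperedDistribution.lineDerivOp_apply_apply]
  congr 2

theorem exists_isSecondDeriv (f : sobolevH2) : ∃ g : L2R, IsSecondDeriv f g := by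
  have hf : TemperedDistribution.MemSobolev 2 2 ((f : L2R) : 𝓢'(ℝ, ℂ)) := f.2
  have h := (hf.lineDerivOp (m := (1 : ℝ))).lineDerivOp (m := (1 : ℝ))
  rw [show (2 : ℝ) - 1 - 1 = 0 by norm_num, TemperedDistribution.memSobolev_zero_iff] at h
  obtain ⟨g, hg⟩ := h
  refine ⟨g, ?_⟩
  rw [IsSecondDeriv, derivCLM_eq_lineDerivOp, derivCLM_eq_lineDerivOp]
  exact hg

theorem toTemperedDistribution_injective {f g : L2R} (h : (f : 𝓢'(ℝ, ℂ)) = (g : 𝓢'(ℝ, ℂ))) :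
    f = g := by
  have hk := Lp.ker_toTemperedDistributionCLM_eq_bot (F := ℂ) (μ := (volume : Measure ℝ)) (p := 2)
  exact LinearMap.ker_eq_bot.mp hk h

theorem IsSecondDeriv.unique {f g g' : L2R} (h : IsSecondDeriv f g) (h' : IsSecondDeriv f g') :
    g = g' :=
  toTemperedDistribution_injective (h.symm.trans h')

theorem IsSecondDeriv.add {f g f' g' : L2R} (h : IsSecondDeriv f g) (h' : IsSecondDeriv f' g') :
    IsSecondDeriv (f + f') (g + g') := by
  unfold IsSecondDeriv at *
  simp only [← Lp.toTemperedDistributionCLM_apply] at *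
  simp only [map_add, h, h']

theorem IsSecondDeriv.smul {f g : L2R} (c : ℂ) (h : IsSecondDeriv f g) :
    IsSecondDeriv (c • f) (c • g) := by
  unfold IsSecondDeriv at *
  simp only [← Lp.toTemperedDistributionCLM_apply] at *
  simp only [map_smul, h]

/-- The second derivative `H²(ℝ) → L²(ℝ)`. -/
def secondDeriv : sobolevH2 →ₗ[ℂ] L2R where
  toFun f := (exists_isSecondDeriv f).choose
  map_add' f g :=
    (exists_isSecondDeriv (f + g)).choose_spec.unique
      ((exists_isSecondDeriv f).choose_spec.add (exists_isSecondDeriv g).choose_spec)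
  map_smul' c f :=
    (exists_isSecondDeriv (c • f)).choose_spec.unique
      ((exists_isSecondDeriv f).choose_spec.smul c)

/-- A smooth, real-valued, even potential on `ℝ` of period `L > 0`. -/
structure EvenPeriodicPotential (L : ℝ) where
  toFun : ℝ → ℝ
  period_pos : 0 < L
  smooth : ContDiff ℝ ∞ toFun
  even : ∀ y, toFun (-y) = toFun y
  periodic : Function.Periodic toFun L

theorem EvenPeriodicPotential.memLp_top {L : ℝ} (U : EvenPeriodicPotential L) :
    MemLp (fun y => (U.toFun y : ℂ)) ∞ (volume : Measure ℝ) := by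
  have hb := U.periodic.isBounded_of_continuous U.period_pos.ne' U.smooth.continuous
  obtain ⟨C, hC⟩ := hb.exists_norm_le
  refine memLp_top_of_bound
    (Complex.continuous_ofReal.comp U.smooth.continuous).aestronglyMeasurable C
    (Eventually.of_forall fun y => ?_)
  rw [Complex.norm_real]
  exact hC _ ⟨y, rfl⟩

/-- Multiplication by the potential, `f ↦ U f`, on `L²(ℝ)`. -/
def EvenPeriodicPotential.mul {L : ℝ} (U : EvenPeriodicPotential L) : L2R →L[ℂ] L2R :=
  (ContinuousLinearMap.mul ℂ ℂ).holderL volume ∞ 2 2 (U.memLp_top.toLp _)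

theorem EvenPeriodicPotential.coeFn_mul {L : ℝ} (U : EvenPeriodicPotential L) (f : L2R) :
    U.mul f =ᵐ[volume] fun y => (U.toFun y : ℂ) * f y := by
  have h : U.mul f =ᵐ[volume] fun y => (U.memLp_top.toLp _ : Lp ℂ ∞ (volume : Measure ℝ)) y * f y :=
    (ContinuousLinearMap.mul ℂ ℂ).coeFn_holder (r := 2) (U.memLp_top.toLp _) f
  filter_upwards [h, U.memLp_top.coeFn_toLp] with y h1 h2
  rw [h1, h2]

/-- The Hill operator `-d²/dy² + U` on `L²(ℝ)` with domain `H²(ℝ)`. -/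
def hill {L : ℝ} (U : EvenPeriodicPotential L) : L2R →ₗ.[ℂ] L2R where
  domain := sobolevH2
  toFun := -secondDeriv + U.mul.toLinearMap ∘ₗ sobolevH2.subtype

/-- The real-place Dirac operator `(0 Q; Q 0)` on `L²(ℝ) ⊕ L²(ℝ)`, where `Q = -d²/dy² + U - E`. -/
def dirac {L : ℝ} (U : EvenPeriodicPotential L) (E : ℝ) :
    WithLp 2 (L2R × L2R) →ₗ.[ℂ] WithLp 2 (L2R × L2R) :=
  UnboundedOp.chiralDouble (UnboundedOp.shift (hill U) E)

/-- `E` lies in an open gap of `S`: a bounded open interval with endpoints in `S`, disjoint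
from `S`. -/
def InOpenGap (S : Set ℂ) (E : ℝ) : Prop :=
  ∃ a b : ℝ, (a : ℂ) ∈ S ∧ (b : ℂ) ∈ S ∧ E ∈ Set.Ioo a b ∧ ∀ x ∈ Set.Ioo a b, (x : ℂ) ∉ S

end RealPlace

/-! ### The finite places -/

namespace FinitePlaces

instance factPrimes (p : Nat.Primes) : Fact (p : ℕ).Prime := ⟨p.2⟩

section Local

variable (p : ℕ) [Fact p.Prime]

instance padicUnitsMeasurableSpace : MeasurableSpace (ℚ_[p])ˣ := borel _

instance padicUnitsBorelSpace : BorelSpace (ℚ_[p])ˣ := ⟨rfl⟩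

/-- `ℤ_p^×` as a subset of `ℚ_p^×`. -/
def integralUnits : Set (ℚ_[p])ˣ := {x | ‖(x : ℚ_[p])‖ = 1}

theorem isOpen_integralUnits : IsOpen (integralUnits p) :=
  (IsUltrametricDist.isOpen_sphere (0 : ℚ_[p]) one_ne_zero).preimage Units.continuous_val
    |> fun h => by simpa [integralUnits, Set.preimage] using h

theorem isCompact_integralUnits : IsCompact (integralUnits p) := by
  have hK : IsCompact ((Metric.closedBall (0 : ℚ_[p]) 1) ×ˢ
      (MulOpposite.op '' (Metric.closedBall (0 : ℚ_[p]) 1))) :=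
    (isCompact_closedBall _ _).prod ((isCompact_closedBall _ _).image MulOpposite.continuous_op)
  refine (Units.isClosedEmbedding_embedProduct.isCompact_preimage hK).of_isClosed_subset ?_ ?_
  · exact isClosed_eq (by fun_prop) continuous_const
  · intro x hx
    have hx' : ‖(x : ℚ_[p])‖ = 1 := hx
    exact ⟨by simp [hx'], ⟨((x⁻¹ : (ℚ_[p])ˣ) : ℚ_[p]), by simp [hx'], rfl⟩⟩

/-- `ℤ_p^×` as a compact set with nonempty interior. -/
def integralUnitsCompacts : TopologicalSpace.PositiveCompacts (ℚ_[p])ˣ where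
  carrier := integralUnits p
  isCompact' := isCompact_integralUnits p
  interior_nonempty' := by
    rw [(isOpen_integralUnits p).interior_eq]
    exact ⟨1, by simp [integralUnits]⟩

/-- The Haar measure `d^×x_p` on `ℚ_p^×` which gives `ℤ_p^×` measure one. -/
def unitsHaar : Measure (ℚ_[p])ˣ := Measure.haarMeasure (integralUnitsCompacts p)

theorem unitsHaar_integralUnits : unitsHaar p (integralUnits p) = 1 :=
  Measure.haarMeasure_self (K₀ := integralUnitsCompacts p)

/-- `L²(ℚ_p^×, d^×x_p)`. -/
abbrev L2Padic : Type := Lp ℂ 2 (unitsHaar p)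

/-- The spherical vector: the indicator function of `ℤ_p^×`. -/
def spherical : L2Padic p :=
  indicatorConstLp 2 (isOpen_integralUnits p).measurableSet
    (by rw [unitsHaar_integralUnits]; exact ENNReal.one_ne_top) (1 : ℂ)

theorem norm_spherical : ‖spherical p‖ = 1 := by
  rw [spherical, norm_indicatorConstLp two_ne_zero ENNReal.ofNat_ne_top]
  simp [Measure.real, unitsHaar_integralUnits]

end Local

/-- Families of local vectors which equal the spherical vector at all but finitely many primes;
they index the pure tensors of the restricted tensor product. -/
def RestrictedFamily : Type :=
  {ψ : ∀ p : Nat.Primes, L2Padic p // ∀ᶠ p in cofinite, ψ p = spherical p}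

/-- The inner product of two pure tensors, `∏_p ⟨ψ_p, φ_p⟩`; all but finitely many factors are
equal to `1`. -/
def pureInner (ψ φ : RestrictedFamily) : ℂ := ∏ᶠ p : Nat.Primes, ⟪ψ.1 p, φ.1 p⟫_ℂ

theorem finite_mulSupport_inner (ψ φ : RestrictedFamily) :
    (Function.mulSupport fun p : Nat.Primes => ⟪ψ.1 p, φ.1 p⟫_ℂ).Finite := by
  refine (ψ.2.and φ.2).mono (fun p hp => ?_)
  simp [hp.1, hp.2, norm_spherical]

/-- Formal finite linear combinations of pure tensors. -/
def FormalTensors : Type := RestrictedFamily →₀ ℂ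

instance : AddCommGroup FormalTensors := inferInstanceAs (AddCommGroup (RestrictedFamily →₀ ℂ))

instance : Module ℂ FormalTensors := inferInstanceAs (Module ℂ (RestrictedFamily →₀ ℂ))

theorem conj_pureInner (ψ φ : RestrictedFamily) : conj (pureInner φ ψ) = pureInner ψ φ := by
  have h := MonoidHom.map_finprod (starRingEnd ℂ : ℂ →* ℂ) (finite_mulSupport_inner φ ψ)
  simpa [pureInner] using h

open scoped ComplexOrder in
theorem posSemidef_localGram {ι : Type} [Finite ι] (v : ι → RestrictedFamily)
    (s : Finset Nat.Primes) :
    (Matrix.of fun i j : ι => ∏ p ∈ s, ⟪(v i).1 p, (v j).1 p⟫_ℂ).PosSemidef := by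
  classical
  induction s using Finset.induction_on with
  | empty =>
    have h := Matrix.posSemidef_gram ℂ (fun _ : ι => (1 : ℂ))
    have e : (Matrix.of fun i j : ι => ∏ p ∈ (∅ : Finset Nat.Primes), ⟪(v i).1 p, (v j).1 p⟫_ℂ) =
        Matrix.gram ℂ (fun _ : ι => (1 : ℂ)) := by
      ext i j
      simp [Matrix.gram]
    rw [e]
    exact h
  | insert p s hp ih =>
    have h := (Matrix.posSemidef_gram ℂ (fun i : ι => (v i).1 p)).hadamard ih
    have e : (Matrix.of fun i j : ι => ∏ p ∈ insert p s, ⟪(v i).1 p, (v j).1 p⟫_ℂ) =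
        (Matrix.gram ℂ (fun i : ι => (v i).1 p)).hadamard
          (Matrix.of fun i j : ι => ∏ p ∈ s, ⟪(v i).1 p, (v j).1 p⟫_ℂ) := by
      ext i j
      simp [Matrix.gram, Finset.prod_insert hp]
    rw [e]
    exact h

/-- The form `⟨∑ a_ψ ψ, ∑ b_φ φ⟩ = ∑ conj(a_ψ) b_φ ∏_p ⟨ψ_p, φ_p⟩` on formal combinations of pure
tensors. -/
def formalInner (f g : RestrictedFamily →₀ ℂ) : ℂ :=
  f.sum fun ψ a => g.sum fun φ b => conj a * b * pureInner ψ φ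

open scoped ComplexOrder in
theorem formalInner_self_nonneg (f : RestrictedFamily →₀ ℂ) : 0 ≤ (formalInner f f).re := by
  classical
  let s : Finset Nat.Primes := f.support.biUnion fun ψ => f.support.biUnion fun φ =>
    (finite_mulSupport_inner ψ φ).toFinset
  have h := (posSemidef_localGram (fun i : f.support => i.1) s).dotProduct_mulVec_nonneg
    fun i => f i.1
  have e : formalInner f f = star (fun i : f.support => f i.1) ⬝ᵥ
      (Matrix.of fun i j : f.support => ∏ p ∈ s, ⟪i.1.1 p, j.1.1 p⟫_ℂ).mulVec
        fun i => f i.1 := by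
    simp only [formalInner, Finsupp.sum, dotProduct, Matrix.mulVec, Finset.mul_sum]
    rw [← Finset.sum_coe_sort f.support]
    refine Finset.sum_congr rfl fun ψ _ => ?_
    rw [← Finset.sum_coe_sort f.support]
    refine Finset.sum_congr rfl fun φ _ => ?_
    have h2 : pureInner ψ φ = ∏ p ∈ s, ⟪ψ.1.1 p, φ.1.1 p⟫_ℂ := by
      refine finprod_eq_prod_of_mulSupport_subset _ fun p hp => ?_
      simp only [s, Finset.coe_biUnion, Set.mem_iUnion]
      exact ⟨ψ, ψ.2, φ, φ.2, by simpa using hp⟩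
    simp only [h2, Matrix.of_apply, Pi.star_apply, RCLike.star_def]
    ring
  rw [e]
  exact (Complex.le_def.mp h).1

theorem formalInner_conj (f g : RestrictedFamily →₀ ℂ) :
    conj (formalInner g f) = formalInner f g := by
  unfold formalInner
  rw [Finsupp.sum_comm]
  simp only [map_finsuppSum, map_mul, conj_pureInner, Complex.conj_conj]
  refine Finset.sum_congr rfl fun ψ _ => Finset.sum_congr rfl fun φ _ => ?_
  simp only [mul_comm]

theorem formalInner_add (f g h : RestrictedFamily →₀ ℂ) :
    formalInner (f + g) h = formalInner f h + formalInner g h := by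
  unfold formalInner
  refine Finsupp.sum_add_index' (by simp) fun ψ a b => ?_
  rw [← Finsupp.sum_add]
  refine Finset.sum_congr rfl fun φ _ => ?_
  simp only [map_add]
  ring

theorem formalInner_smul (f g : RestrictedFamily →₀ ℂ) (c : ℂ) :
    formalInner (c • f) g = conj c * formalInner f g := by
  unfold formalInner
  rw [Finsupp.sum_smul_index (by simp), Finsupp.mul_sum]
  refine Finset.sum_congr rfl fun ψ _ => ?_
  dsimp only
  rw [Finsupp.mul_sum]
  refine Finset.sum_congr rfl fun φ _ => ?_
  simp only [map_mul]
  ring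

/-- The tensor product (semi-)inner product on formal combinations of pure tensors. -/
instance formalCore : PreInnerProductSpace.Core ℂ FormalTensors where
  inner f g := formalInner f g
  conj_inner_symm f g := formalInner_conj f g
  re_inner_nonneg f := formalInner_self_nonneg f
  add_left f g h := formalInner_add f g h
  smul_left f g c := formalInner_smul f g c

instance : SeminormedAddCommGroup FormalTensors :=
  InnerProductSpace.Core.toSeminormedAddCommGroup (𝕜 := ℂ)

instance : InnerProductSpace ℂ FormalTensors := .ofCore _

/-- The restricted tensor product `⨂'_p L²(ℚ_p^×, d^×x_p)` with respect to the spherical vectors: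
the Hilbert space completion of the span of the pure tensors. Vectors of norm zero are identified
with `0` in the completion. -/
abbrev Hfin : Type := UniformSpace.Completion FormalTensors

end FinitePlaces

/-- The global operator `D_∞ ⊗ I_fin` on the Hilbert tensor product of `L²(ℝ) ⊕ L²(ℝ)` and
`⨂'_p L²(ℚ_p^×)`. -/
def globalDirac {L : ℝ} (U : RealPlace.EvenPeriodicPotential L) (E : ℝ) :
    UnboundedOp.HilbertTensor (WithLp 2 (RealPlace.L2R × RealPlace.L2R)) FinitePlaces.Hfin →ₗ.[ℂ]
      UnboundedOp.HilbertTensor (WithLp 2 (RealPlace.L2R × RealPlace.L2R)) FinitePlaces.Hfin :=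
  UnboundedOp.tensorId FinitePlaces.Hfin (RealPlace.dirac U E)

end

/-! Self-adjointness is built up in layers. On `H²(ℝ)` the map `u ↦ u - (2π)⁻² u''` is onto `L²(ℝ)`,
being the Bessel potential of order `2`, so the symmetric operator `-d²/dy²` is self-adjoint
(`isSelfAdjoint_freeHill`). The bounded symmetric potential does not disturb this, and shifting,
doubling and tensoring with an identity preserve it because `A - z` stays surjective for nonreal `z`
(`isSelfAdjoint_of_surjective`).

For self-adjoint `A` and real `z`, being a resolvent point is equivalent to a lower bound `c ‖x‖ ≤
‖(A - z) x‖`, so spectra are compared by inequalities. In the coordinates `f ± g` the matrix `(0 Q;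
Q 0)` is `Q ⊕ -Q`, whence the symmetric spectrum (`spec_chiralDouble`). If `R` is a resolvent of
`A`, then `R ⊗ I` is one of `A ⊗ I`; conversely a lower bound for `A ⊗ I` restricts along the
isometry `x ↦ x ⊗ k` (`spec_tensorId`). The finite factor is infinite-dimensional because the pure
tensors ramified at a single prime are orthonormal, and a Hilbert basis of it splits `A ⊗ I` into
infinitely many copies of `A`.

The bands come from Floquet theory. The discriminant `Δ`, the trace of the monodromy matrix, is
analytic in the energy, and the spectrum of the Hill operator is `{Δ² ≤ 4}`
(`exists_analytic_mem_spec_hill_iff`). If `Δ² > 4`, two Floquet solutions with distinct real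
multipliers `r, r⁻¹` give a lower bound through their Wronskians with a test function. If `Δ² ≤ 4`,
a multiplier lies on the unit circle and cutoffs of its bounded solution form a Weyl sequence. `Δ² -
4` is not identically zero, since it is positive at the gap energy, so its zeros are isolated. As
the spectrum is bounded below and unbounded above, it is a sequence of closed bands
(`BandStructure.exists_bands`). -/

noncomputable section

/-! ### Resolvent criteria, self-adjointness and chiral doubling. -/

namespace UnboundedOp

section General

variable {H : Type*} [NormedAddCommGroup H] [InnerProductSpace ℂ H] {A : H →ₗ.[ℂ] H}

theorem IsResolventPoint.exists_bound {z : ℂ} (h : IsResolventPoint A z) :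
    ∃ c > 0, ∀ x : A.domain, c * ‖(x : H)‖ ≤ ‖A x - z • (x : H)‖ := by
  obtain ⟨R, -, hR⟩ := h
  refine ⟨(‖R‖ + 1)⁻¹, by positivity, fun x => ?_⟩
  rw [inv_mul_le_iff₀ (by positivity)]
  calc ‖(x : H)‖ = ‖R (A x - z • (x : H))‖ := by rw [hR]
    _ ≤ ‖R‖ * ‖A x - z • (x : H)‖ := R.le_opNorm _
    _ ≤ _ := by gcongr; linarith

theorem IsResolventPoint.surjective {z : ℂ} (h : IsResolventPoint A z) (y : H) :
    ∃ x : A.domain, A x - z • (x : H) = y := by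
  obtain ⟨R, hR, -⟩ := h
  obtain ⟨h, e⟩ := hR y
  exact ⟨⟨R y, h⟩, e⟩

theorem inner_apply_self_im (hA : A.IsFormalAdjoint A) (x : A.domain) :
    (⟪(x : H), A x⟫_ℂ).im = 0 := by
  have h := hA x x
  rw [← inner_conj_symm] at h
  exact Complex.conj_eq_iff_im.mp h

/-- Since `⟪x, A x⟫` is real, `⟪x, (A - z) x⟫` has imaginary part `-(Im z) ‖x‖²`; Cauchy–Schwarz
does the rest. -/
theorem abs_im_mul_norm_le (hA : A.IsFormalAdjoint A) (z : ℂ) (x : A.domain) :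
    |z.im| * ‖(x : H)‖ ≤ ‖A x - z • (x : H)‖ := by
  have h1 : (⟪(x : H), A x - z • (x : H)⟫_ℂ).im = -(z.im * ‖(x : H)‖ ^ 2) := by
    rw [inner_sub_right, inner_smul_right, inner_self_eq_norm_sq_to_K]
    simp only [Complex.sub_im, inner_apply_self_im hA, Complex.coe_algebraMap,
      ← Complex.ofReal_pow, Complex.mul_im, Complex.ofReal_re, Complex.ofReal_im]
    ring
  rcases eq_or_ne ‖(x : H)‖ 0 with h0 | h0
  · simp [h0]
  have h2 : |z.im| * ‖(x : H)‖ ^ 2 ≤ ‖(x : H)‖ * ‖A x - z • (x : H)‖ := by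
    calc |z.im| * ‖(x : H)‖ ^ 2 = |(⟪(x : H), A x - z • (x : H)⟫_ℂ).im| := by
          rw [h1, abs_neg, abs_mul, abs_of_nonneg (sq_nonneg ‖(x : H)‖)]
      _ ≤ _ := (Complex.abs_im_le_norm _).trans (norm_inner_le_norm _ _)
  have h3 : 0 < ‖(x : H)‖ := lt_of_le_of_ne (norm_nonneg _) (Ne.symm h0)
  nlinarith

theorem isResolventPoint_shift_iff {E : ℝ} {z : ℂ} :
    IsResolventPoint (shift A E) z ↔ IsResolventPoint A (z + E) := by
  have key : ∀ x : A.domain, shift A E x - z • (x : H) = A x - (z + E) • (x : H) := fun x => by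
    change A x - (E : ℂ) • (x : H) - z • (x : H) = _
    module
  constructor
  · rintro ⟨R, h1, h2⟩
    refine ⟨R, fun x => ?_, fun x => by rw [← key]; exact h2 x⟩
    obtain ⟨h, e⟩ := h1 x
    exact ⟨h, (key ⟨R x, h⟩).symm.trans e⟩
  · rintro ⟨R, h1, h2⟩
    refine ⟨R, fun x => ?_, fun x => (congrArg R (key x)).trans (h2 x)⟩
    obtain ⟨h, e⟩ := h1 x
    exact ⟨h, (key ⟨R x, h⟩).trans e⟩

theorem chiralDouble_surjective {z : ℂ} (h1 : IsResolventPoint A z)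
    (h2 : IsResolventPoint A (-z)) (y : WithLp 2 (H × H)) :
    -- For `x = (f, g)` the sum and the difference decouple: `(A - z)(f + g) = y.fst + y.snd` and
    -- `(A + z)(f - g) = y.snd - y.fst`.
    ∃ x : (chiralDouble A).domain, chiralDouble A x - z • (x : WithLp 2 (H × H)) = y := by
  obtain ⟨s, hs⟩ := h1.surjective (y.fst + y.snd)
  obtain ⟨d, hd⟩ := h2.surjective (y.snd - y.fst)
  refine ⟨⟨WithLp.toLp 2 (((1 / 2 : ℂ) • (s + d) : A.domain), ((1 / 2 : ℂ) • (s - d) : A.domain)),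
    ((1 / 2 : ℂ) • (s + d)).2, ((1 / 2 : ℂ) • (s - d)).2⟩, ?_⟩
  change WithLp.toLp 2 (A ((1 / 2 : ℂ) • (s - d)), A ((1 / 2 : ℂ) • (s + d))) - _ = y
  refine WithLp.ofLp_injective 2 (Prod.ext ?_ ?_)
  · change A ((1 / 2 : ℂ) • (s - d)) - z • (((1 / 2 : ℂ) • (s + d) : A.domain) : H) = y.fst
    have e : y.fst = (1 / 2 : ℂ) • ((y.fst + y.snd) - (y.snd - y.fst)) := by module
    rw [e, ← hs, ← hd, LinearPMap.map_smul, LinearPMap.map_sub, Submodule.coe_smul,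
      Submodule.coe_add]
    module
  · change A ((1 / 2 : ℂ) • (s + d)) - z • (((1 / 2 : ℂ) • (s - d) : A.domain) : H) = y.snd
    have e : y.snd = (1 / 2 : ℂ) • ((y.fst + y.snd) + (y.snd - y.fst)) := by module
    rw [e, ← hs, ← hd, LinearPMap.map_smul, LinearPMap.map_add, Submodule.coe_smul,
      AddSubgroupClass.coe_sub]
    module

variable [CompleteSpace H]

/-- A densely defined symmetric operator `A` with `A - z` and `A - conj z` surjective is
self-adjoint. -/
theorem isSelfAdjoint_of_surjective (hd : Dense (A.domain : Set H)) (hA : A.IsFormalAdjoint A)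
    (z : ℂ) (h1 : ∀ y : H, ∃ x : A.domain, A x - z • (x : H) = y)
    (h2 : ∀ y : H, ∃ x : A.domain, A x - conj z • (x : H) = y) : IsSelfAdjoint A := by
  have hle : A ≤ A.adjoint := hA.le_adjoint hd
  rw [LinearPMap.isSelfAdjoint_def]
  refine (LinearPMap.eq_of_le_of_domain_eq hle (le_antisymm hle.1 fun y hy => ?_)).symm
  -- With `(A - z) x = (A* - z) y`, the vector `y - x` lies in the kernel of `A* - z`, so it is
  -- orthogonal to the range of `A - conj z`, which is everything. Hence `y = x` is in the domain of
  -- `A`.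
  obtain ⟨x, hx⟩ := h1 (A.adjoint ⟨y, hy⟩ - z • y)
  have hw : y - x = 0 := by
    obtain ⟨u, hu⟩ := h2 (y - x)
    rw [← inner_self_eq_zero (𝕜 := ℂ)]
    nth_rw 2 [← hu]
    have e1 : ⟪y, A u⟫_ℂ = ⟪A.adjoint ⟨y, hy⟩, (u : H)⟫_ℂ :=
      (LinearPMap.adjoint_isFormalAdjoint hd ⟨y, hy⟩ u).symm
    have e2 : ⟪(x : H), A u⟫_ℂ = ⟪A x, (u : H)⟫_ℂ := (hA x u).symm
    have e3 : A x = A.adjoint ⟨y, hy⟩ - z • y + z • (x : H) := by rw [← hx]; abel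
    simp only [inner_sub_left, inner_sub_right, inner_smul_right, e1, e2, e3, inner_add_left,
      inner_smul_left]
    ring
  rw [sub_eq_zero] at hw
  rw [hw]
  exact x.2

theorem _root_.IsSelfAdjoint.isFormalAdjoint (hA : IsSelfAdjoint A) : A.IsFormalAdjoint A := by
  have h := LinearPMap.adjoint_isFormalAdjoint hA.dense_domain
  rwa [LinearPMap.isSelfAdjoint_def.mp hA] at h

/-- The bound makes `A - z` injective with closed range. The orthogonal complement of the range is
the kernel of `A* - conj z = A - conj z`, which `hk` makes trivial. -/
theorem isResolventPoint_of_bound (hA : IsSelfAdjoint A) {z : ℂ} {c : ℝ} (hc : 0 < c)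
    (hb : ∀ x : A.domain, c * ‖(x : H)‖ ≤ ‖A x - z • (x : H)‖)
    (hk : ∀ x : A.domain, A x = conj z • (x : H) → (x : H) = 0) : IsResolventPoint A z := by
  let T : A.domain →ₗ[ℂ] H := A.toFun - z • A.domain.subtype
  have hT : ∀ x : A.domain, T x = A x - z • (x : H) := fun x => rfl
  have hcl : IsClosed (LinearMap.range T : Set H) := by
    have hG : IsClosed (A.graph : Set (H × H)) := hA.isClosed
    have : CompleteSpace A.graph := hG.completeSpace_coe
    let S : A.graph →L[ℂ] H :=
      (ContinuousLinearMap.snd ℂ H H - z • ContinuousLinearMap.fst ℂ H H).comp A.graph.subtypeL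
    -- On the complete graph of `A` the range is that of a bounded map. With `t = ‖(A - z) x‖` one
    -- has `‖x‖ ≤ c⁻¹ t` and `‖A x‖ ≤ t + ‖z‖ c⁻¹ t`, and the constant dominates both.
    have hS : AntilipschitzWith (Real.toNNReal (1 + (‖z‖ + 1) * c⁻¹)) S := by
      refine ContinuousLinearMap.antilipschitz_of_bound _ fun g => ?_
      obtain ⟨⟨x, y⟩, hg⟩ := g
      obtain ⟨u, hu1, hu2⟩ := (LinearPMap.mem_graph_iff _).mp hg
      dsimp only at hu1 hu2
      subst hu1 hu2
      have hb' := hb u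
      have hS' : S ⟨((u : H), A u), hg⟩ = A u - z • (u : H) := rfl
      rw [hS', Real.coe_toNNReal _ (by positivity)]
      set t := ‖A u - z • (u : H)‖
      have h1 : ‖(u : H)‖ ≤ c⁻¹ * t := by
        rw [inv_mul_eq_div, le_div_iff₀ hc]; linarith
      have h2 : ‖A u‖ ≤ t + ‖z‖ * ‖(u : H)‖ := by
        calc ‖A u‖ = ‖(A u - z • (u : H)) + z • (u : H)‖ := by congr 1; abel
          _ ≤ _ := (norm_add_le _ _).trans_eq (by rw [norm_smul])
      have ht : 0 ≤ t := norm_nonneg _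
      have hc' : 0 < c⁻¹ := inv_pos.mpr hc
      have h3 : ‖z‖ * ‖(u : H)‖ ≤ ‖z‖ * (c⁻¹ * t) :=
        mul_le_mul_of_nonneg_left h1 (norm_nonneg _)
      have h4 : 0 ≤ ‖z‖ * (c⁻¹ * t) := by positivity
      have h5 : 0 ≤ c⁻¹ * t := by positivity
      have h6 : ‖((⟨((u : H), A u), hg⟩ : A.graph))‖ = max ‖(u : H)‖ ‖A u‖ := rfl
      rw [h6]
      refine max_le ?_ ?_ <;> nlinarith
    have h := hS.isClosed_range S.uniformContinuous
    convert h using 1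
    ext y
    constructor
    · rintro ⟨x, rfl⟩
      exact ⟨⟨_, A.mem_graph x⟩, rfl⟩
    · rintro ⟨⟨⟨x, y⟩, hg⟩, rfl⟩
      obtain ⟨u, hu1, hu2⟩ := (LinearPMap.mem_graph_iff _).mp hg
      exact ⟨u, by rw [hT, hu1, hu2]; rfl⟩
  have hsurj : LinearMap.range T = ⊤ := by
    have : CompleteSpace (LinearMap.range T) := hcl.completeSpace_coe
    rw [← Submodule.orthogonal_eq_bot_iff, Submodule.eq_bot_iff]
    intro w hw
    rw [Submodule.mem_orthogonal] at hw
    have hw' : ∀ x : A.domain, ⟪conj z • w, (x : H)⟫_ℂ = ⟪w, A x⟫_ℂ := fun x => by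
      have h := hw (T x) ⟨x, rfl⟩
      rw [hT, inner_eq_zero_symm, inner_sub_right, sub_eq_zero] at h
      rw [h, inner_smul_left, inner_smul_right, Complex.conj_conj]
    have hwd : w ∈ A.adjoint.domain := LinearPMap.mem_adjoint_domain_of_exists _ ⟨_, hw'⟩
    have he : A.adjoint ⟨w, hwd⟩ = conj z • w :=
      LinearPMap.adjoint_apply_eq hA.dense_domain ⟨w, hwd⟩ hw'
    obtain ⟨hwd', he'⟩ : ∃ h : w ∈ A.domain, A ⟨w, h⟩ = conj z • w := by
      have := LinearPMap.isSelfAdjoint_def.mp hA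
      revert hwd
      rw [this]
      exact fun h1 h2 => ⟨h1, h2⟩
    exact hk ⟨w, hwd'⟩ he'
  have hinj : Function.Injective T := by
    rw [← LinearMap.ker_eq_bot, LinearMap.ker_eq_bot']
    intro x hx
    have h := hb x
    rw [← hT, hx, norm_zero] at h
    have : ‖(x : H)‖ = 0 := le_antisymm (by nlinarith [norm_nonneg (x : H)]) (norm_nonneg _)
    exact Subtype.ext (norm_eq_zero.mp this)
  let e : A.domain ≃ₗ[ℂ] H := LinearEquiv.ofBijective T ⟨hinj, LinearMap.range_eq_top.mp hsurj⟩
  have he : ∀ x, e x = A x - z • (x : H) := hT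
  refine ⟨(A.domain.subtype ∘ₗ e.symm.toLinearMap).mkContinuous c⁻¹ fun y => ?_,
    fun x => ⟨(e.symm x).2, ?_⟩, fun x => ?_⟩
  · have h := hb (e.symm y)
    rw [← he, e.apply_symm_apply] at h
    rw [inv_mul_eq_div, le_div_iff₀ hc, mul_comm]
    exact h
  · exact (he (e.symm x)).symm.trans (e.apply_symm_apply x)
  · change ((e.symm (A x - z • (x : H)) : A.domain) : H) = x
    rw [← he, e.symm_apply_apply]

theorem isResolventPoint_ofReal_of_bound (hA : IsSelfAdjoint A) {z : ℝ} {c : ℝ} (hc : 0 < c)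
    (hb : ∀ x : A.domain, c * ‖(x : H)‖ ≤ ‖A x - (z : ℂ) • (x : H)‖) :
    IsResolventPoint A z := by
  refine isResolventPoint_of_bound hA hc hb fun x hx => ?_
  have h := hb x
  rw [hx, Complex.conj_ofReal, sub_self, norm_zero] at h
  exact norm_eq_zero.mp (le_antisymm (by nlinarith [norm_nonneg (x : H)]) (norm_nonneg _))

theorem isResolventPoint_of_im_ne_zero (hA : IsSelfAdjoint A) {z : ℂ} (hz : z.im ≠ 0) :
    IsResolventPoint A z := by
  refine isResolventPoint_of_bound hA (abs_pos.mpr hz)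
    (abs_im_mul_norm_le hA.isFormalAdjoint z) fun x hx => ?_
  have h := abs_im_mul_norm_le hA.isFormalAdjoint (conj z) x
  rw [hx, sub_self, norm_zero, Complex.conj_im, abs_neg] at h
  have := abs_pos.mpr hz
  exact norm_eq_zero.mp (le_antisymm (by nlinarith [norm_nonneg (x : H)]) (norm_nonneg _))

theorem eq_ofReal_of_mem_spec (hA : IsSelfAdjoint A) {z : ℂ} (hz : z ∈ spec A) :
    z = (z.re : ℂ) := by
  by_contra h
  refine hz (isResolventPoint_of_im_ne_zero hA fun h0 => h ?_)
  exact Complex.ext rfl (by simpa using h0)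

/-- If the spectrum of a self-adjoint operator `A` has distance at least `r` from `z`, then
`‖(A - z) x‖ ≥ r ‖x‖`. -/
theorem mul_norm_le_of_gap (hA : IsSelfAdjoint A) {z r : ℝ} (hr : 0 < r)
    (hgap : ∀ x : ℝ, |x - z| < r → (x : ℂ) ∉ spec A) (x : A.domain) :
    r * ‖(x : H)‖ ≤ ‖A x - (z : ℂ) • (x : H)‖ := by
  have hres : ∀ w : ℂ, ‖w - z‖ < r → IsResolventPoint A w := fun w hw => by
    by_cases h : w.im = 0
    · have e : w = (w.re : ℂ) := Complex.ext rfl (by simpa using h)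
      rw [e]
      refine not_not.mp (hgap _ ?_)
      rw [e, ← Complex.ofReal_sub, Complex.norm_real, Real.norm_eq_abs] at hw
      exact hw
    · exact isResolventPoint_of_im_ne_zero hA h
  obtain ⟨R, hR1, hR2⟩ := hres z (by simpa using hr)
  have hRs : IsSelfAdjoint R := by
    rw [ContinuousLinearMap.isSelfAdjoint_iff_isSymmetric]
    intro x y
    obtain ⟨hx, ex⟩ := hR1 x
    obtain ⟨hy, ey⟩ := hR1 y
    change ⟪R x, y⟫_ℂ = ⟪x, R y⟫_ℂ
    nth_rw 1 [← ey]
    nth_rw 2 [← ex]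
    have := hA.isFormalAdjoint ⟨R x, hx⟩ ⟨R y, hy⟩
    simp only [inner_sub_left, inner_sub_right, inner_smul_left, inner_smul_right, this,
      Complex.conj_ofReal]
  -- If `‖w‖ > r⁻¹`, then `z + w⁻¹` is within `r` of `z` and has a resolvent `S`; by the resolvent
  -- identities, `w⁻¹ (1 + w⁻¹ S)` inverts `w - R`.
  have hspec : ∀ w ∈ spectrum ℂ R, ‖w‖ ≤ r⁻¹ := by
    intro w hw
    by_contra hlt
    push Not at hlt
    have hw0 : w ≠ 0 := by
      rintro rfl
      rw [norm_zero] at hlt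
      exact absurd hlt (not_lt.mpr (inv_pos.mpr hr).le)
    obtain ⟨S, hS1, hS2⟩ := hres (z + w⁻¹) (by
      rw [add_sub_cancel_left, norm_inv]
      exact inv_lt_of_inv_lt₀ hr hlt)
    have e1 : ∀ x, S x - R x = w⁻¹ • R (S x) := fun x => by
      obtain ⟨h, e⟩ := hS1 x
      have h2 := hR2 ⟨S x, h⟩
      have e3 : A ⟨S x, h⟩ - (z : ℂ) • S x = x + w⁻¹ • S x := by
        nth_rw 3 [← e]
        rw [add_smul]
        abel
      dsimp only at h2
      rw [e3, map_add, map_smul] at h2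
      nth_rw 1 [← h2]
      abel
    have e2 : ∀ x, S x - R x = w⁻¹ • S (R x) := fun x => by
      obtain ⟨h, e⟩ := hR1 x
      have h2 := hS2 ⟨R x, h⟩
      have e3 : A ⟨R x, h⟩ - ((z : ℂ) + w⁻¹) • R x = x - w⁻¹ • R x := by
        nth_rw 3 [← e]
        rw [add_smul]
        abel
      dsimp only at h2
      rw [e3, map_sub, map_smul] at h2
      nth_rw 1 [← h2]
      abel
    refine hw ⟨⟨algebraMap ℂ (H →L[ℂ] H) w - R, w⁻¹ • (1 + w⁻¹ • S), ?_, ?_⟩, rfl⟩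
    · ext x
      have h : R (S x) = w • (S x - R x) := by rw [e1, smul_smul, mul_inv_cancel₀ hw0, one_smul]
      change w • (w⁻¹ • (x + w⁻¹ • S x)) - R (w⁻¹ • (x + w⁻¹ • S x)) = x
      simp only [map_smul, map_add, h]
      match_scalars <;> field_simp <;> ring
    · ext x
      have h : S (R x) = w • (S x - R x) := by rw [e2, smul_smul, mul_inv_cancel₀ hw0, one_smul]
      change w⁻¹ • ((w • x - R x) + w⁻¹ • S (w • x - R x)) = x
      simp only [map_smul, map_sub, h]
      match_scalars <;> field_simp <;> ring
  -- The bounded operator `R` is self-adjoint, so its norm equals its spectral radius.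
  have hnorm : ‖R‖ ≤ r⁻¹ := by
    have h1 := hRs.spectralRadius_eq_nnnorm
    have h2 : spectralRadius ℂ R ≤ (Real.toNNReal r⁻¹ : ℝ≥0∞) := by
      refine iSup₂_le fun w hw => ?_
      rw [ENNReal.coe_le_coe, ← NNReal.coe_le_coe, Real.coe_toNNReal _ (inv_pos.mpr hr).le]
      exact hspec w hw
    rw [h1, ENNReal.coe_le_coe, ← NNReal.coe_le_coe, Real.coe_toNNReal _ (inv_pos.mpr hr).le] at h2
    exact h2
  calc r * ‖(x : H)‖ = r * ‖R (A x - (z : ℂ) • (x : H))‖ := by rw [hR2]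
    _ ≤ r * (r⁻¹ * ‖A x - (z : ℂ) • (x : H)‖) := by
        gcongr
        exact R.le_of_opNorm_le hnorm _
    _ = _ := mul_inv_cancel_left₀ hr.ne' _

theorem _root_.IsSelfAdjoint.shift (hA : IsSelfAdjoint A) (E : ℝ) :
    IsSelfAdjoint (shift A E) := by
  have h : ∀ z : ℂ, z.im ≠ 0 → IsResolventPoint (UnboundedOp.shift A E) z := fun z hz =>
    isResolventPoint_shift_iff.mpr (isResolventPoint_of_im_ne_zero hA (by simpa using hz))
  refine isSelfAdjoint_of_surjective hA.dense_domain (fun x y => ?_) Complex.I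
    (h _ (by simp)).surjective (h _ (by simp)).surjective
  change ⟪A x - (E : ℂ) • (x : H), (y : H)⟫_ℂ = ⟪(x : H), A y - (E : ℂ) • (y : H)⟫_ℂ
  simp only [inner_sub_left, inner_sub_right, inner_smul_left, inner_smul_right,
    hA.isFormalAdjoint x y, Complex.conj_ofReal]

theorem _root_.IsSelfAdjoint.chiralDouble (hA : IsSelfAdjoint A) :
    IsSelfAdjoint (chiralDouble A) := by
  have hr : ∀ z : ℂ, z.im ≠ 0 → IsResolventPoint A z := fun z hz =>
    isResolventPoint_of_im_ne_zero hA hz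
  refine isSelfAdjoint_of_surjective ?_ (fun x y => ?_) Complex.I
    (chiralDouble_surjective (hr _ (by simp)) (hr _ (by simp)))
    (chiralDouble_surjective (hr _ (by simp)) (hr _ (by simp)))
  · have h := (hA.dense_domain.prod hA.dense_domain).preimage
      (WithLp.homeomorphProd 2 H H).isOpenMap
    exact h
  · change ⟪WithLp.toLp 2 (A ⟨x.1.snd, x.2.2⟩, A ⟨x.1.fst, x.2.1⟩), y.1⟫_ℂ =
      ⟪x.1, WithLp.toLp 2 (A ⟨y.1.snd, y.2.2⟩, A ⟨y.1.fst, y.2.1⟩)⟫_ℂ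
    rw [WithLp.prod_inner_apply, WithLp.prod_inner_apply]
    have h1 := hA.isFormalAdjoint ⟨x.1.snd, x.2.2⟩ ⟨y.1.fst, y.2.1⟩
    have h2 := hA.isFormalAdjoint ⟨x.1.fst, x.2.1⟩ ⟨y.1.snd, y.2.2⟩
    exact (congrArg₂ (· + ·) h1 h2).trans (add_comm _ _)

/-- The doubled operator acts as `A` on vectors `(x, x)` and as `-A` on vectors `(x, -x)`. Both
directions transfer lower bounds through this splitting. -/
theorem isResolventPoint_chiralDouble_ofReal (hA : IsSelfAdjoint A) {z : ℝ} :
    IsResolventPoint (chiralDouble A) z ↔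
      IsResolventPoint A z ∧ IsResolventPoint A (-(z : ℂ)) := by
  have hn : ∀ v : WithLp 2 (H × H), ‖v.fst‖ ≤ ‖v‖ ∧ ‖v.snd‖ ≤ ‖v‖ := fun v => by
    have := WithLp.prod_norm_sq_eq_of_L2 v
    constructor <;> refine le_of_sq_le_sq ?_ (norm_nonneg _) <;> nlinarith [sq_nonneg ‖v.fst‖,
      sq_nonneg ‖v.snd‖]
  have hp : ∀ a b : H, ‖a‖ ≤ ‖WithLp.toLp 2 (a, b)‖ ∧ ‖WithLp.toLp 2 (a, b)‖ ≤ ‖a‖ + ‖b‖ :=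
    fun a b => by
      refine ⟨(hn (WithLp.toLp 2 (a, b))).1, le_of_sq_le_sq ?_ (by positivity)⟩
      have h : ‖WithLp.toLp 2 (a, b)‖ ^ 2 = ‖a‖ ^ 2 + ‖b‖ ^ 2 := WithLp.prod_norm_sq_eq_of_L2 _
      nlinarith [norm_nonneg a, norm_nonneg b]
  constructor
  · intro h
    obtain ⟨c, hc, hb⟩ := h.exists_bound
    constructor
    -- The factor `1/2` pays for the crude estimate `‖(a, a)‖ ≤ 2 ‖a‖`.
    · refine isResolventPoint_ofReal_of_bound hA (half_pos hc) fun x => ?_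
      have h1 : c * ‖WithLp.toLp 2 ((x : H), (x : H))‖ ≤
          ‖WithLp.toLp 2 (A x - (z : ℂ) • (x : H), A x - (z : ℂ) • (x : H))‖ :=
        hb ⟨WithLp.toLp 2 ((x : H), (x : H)), x.2, x.2⟩
      have h2 := mul_le_mul_of_nonneg_left (hp x x).1 hc.le
      linarith [(hp (A x - (z : ℂ) • (x : H)) (A x - (z : ℂ) • (x : H))).2]
    · rw [← Complex.ofReal_neg]
      refine isResolventPoint_ofReal_of_bound hA (half_pos hc) fun x => ?_
      have h1 : c * ‖WithLp.toLp 2 ((x : H), -(x : H))‖ ≤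
          ‖WithLp.toLp 2 (A (-x) - (z : ℂ) • (x : H), A x - (z : ℂ) • -(x : H))‖ :=
        hb ⟨WithLp.toLp 2 ((x : H), -(x : H)), x.2, A.domain.neg_mem x.2⟩
      have h6 : A (-x) - (z : ℂ) • (x : H) = -(A x - ((-z : ℝ) : ℂ) • (x : H)) := by
        rw [LinearPMap.map_neg]
        push_cast
        module
      have h7 : A x - (z : ℂ) • -(x : H) = A x - ((-z : ℝ) : ℂ) • (x : H) := by
        push_cast
        module
      have h2 := mul_le_mul_of_nonneg_left (hp x (-x)).1 hc.le
      have h3 := (hp (A (-x) - (z : ℂ) • (x : H)) (A x - (z : ℂ) • -(x : H))).2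
      rw [h6, h7] at h1 h3
      rw [norm_neg] at h3
      linarith
  · rintro ⟨h1, h2⟩
    obtain ⟨c1, hc1, hb1⟩ := h1.exists_bound
    obtain ⟨c2, hc2, hb2⟩ := h2.exists_bound
    -- With `v` the image of `x = (f, g)`, `‖f + g‖ ≤ (2 / c1) ‖v‖` and `‖g - f‖ ≤ (2 / c2) ‖v‖`,
    -- while `‖f‖` and `‖g‖` are each at most half the sum of these two norms.
    refine isResolventPoint_ofReal_of_bound hA.chiralDouble
      (c := (2 / c1 + 2 / c2)⁻¹) (by positivity) fun x => ?_
    rw [inv_mul_le_iff₀ (by positivity)]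
    let f : A.domain := ⟨x.1.fst, x.2.1⟩
    let g : A.domain := ⟨x.1.snd, x.2.2⟩
    let v := chiralDouble A x - (z : ℂ) • (x : WithLp 2 (H × H))
    have hv1 : v.fst = A g - (z : ℂ) • (f : H) := rfl
    have hv2 : v.snd = A f - (z : ℂ) • (g : H) := rfl
    have hv := hn v
    have hs := hb1 (f + g)
    have hd := hb2 (g - f)
    have es : A (f + g) - (z : ℂ) • ((f + g : A.domain) : H) = v.fst + v.snd := by
      rw [hv1, hv2, LinearPMap.map_add, Submodule.coe_add]
      module
    have ed : A (g - f) - (-(z : ℂ)) • ((g - f : A.domain) : H) = v.fst - v.snd := by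
      rw [hv1, hv2, LinearPMap.map_sub, AddSubgroupClass.coe_sub]
      module
    rw [es] at hs
    rw [ed] at hd
    have hs' : ‖((f + g : A.domain) : H)‖ ≤ 2 / c1 * ‖v‖ := by
      rw [div_mul_eq_mul_div, le_div_iff₀ hc1]
      linarith [norm_add_le v.fst v.snd, hv.1, hv.2]
    have hd' : ‖((g - f : A.domain) : H)‖ ≤ 2 / c2 * ‖v‖ := by
      rw [div_mul_eq_mul_div, le_div_iff₀ hc2]
      linarith [norm_sub_le v.fst v.snd, hv.1, hv.2]
    have hf : ‖(f : H)‖ ≤ (‖((f + g : A.domain) : H)‖ + ‖((g - f : A.domain) : H)‖) / 2 := by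
      have e : (2 : ℂ) • (f : H) = ((f + g : A.domain) : H) - ((g - f : A.domain) : H) := by
        rw [Submodule.coe_add, AddSubgroupClass.coe_sub]
        module
      have h := congrArg norm e
      rw [norm_smul, Complex.norm_ofNat] at h
      linarith [norm_sub_le ((f + g : A.domain) : H) ((g - f : A.domain) : H)]
    have hg : ‖(g : H)‖ ≤ (‖((f + g : A.domain) : H)‖ + ‖((g - f : A.domain) : H)‖) / 2 := by
      have e : (2 : ℂ) • (g : H) = ((f + g : A.domain) : H) + ((g - f : A.domain) : H) := by
        rw [Submodule.coe_add, AddSubgroupClass.coe_sub]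
        module
      have h := congrArg norm e
      rw [norm_smul, Complex.norm_ofNat] at h
      linarith [norm_add_le ((f + g : A.domain) : H) ((g - f : A.domain) : H)]
    have hx : ‖(x : WithLp 2 (H × H))‖ ≤ ‖(f : H)‖ + ‖(g : H)‖ := by
      refine le_of_sq_le_sq ?_ (by positivity)
      rw [WithLp.prod_norm_sq_eq_of_L2]
      change ‖(f : H)‖ ^ 2 + ‖(g : H)‖ ^ 2 ≤ _
      nlinarith [norm_nonneg (f : H), norm_nonneg (g : H)]
    change _ ≤ (2 / c1 + 2 / c2) * ‖v‖
    linarith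

theorem spec_chiralDouble (hA : IsSelfAdjoint A) :
    spec (chiralDouble A) = {z : ℂ | z ∈ spec A ∨ -z ∈ spec A} := by
  ext z
  by_cases hz : z.im = 0
  · have e : z = (z.re : ℂ) := Complex.ext rfl (by simpa using hz)
    rw [e]
    simp only [spec, Set.mem_ofPred_eq, isResolventPoint_chiralDouble_ofReal hA]
    tauto
  · have h1 := isResolventPoint_of_im_ne_zero hA.chiralDouble hz
    have h2 := isResolventPoint_of_im_ne_zero hA hz
    have h3 : IsResolventPoint A (-z) := isResolventPoint_of_im_ne_zero hA (by simpa using hz)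
    simp [spec, h1, h2, h3]

end General

end UnboundedOp

/-! ### The operator `A ⊗ I`: closure, resolvent, spectrum, multiplicity. -/

namespace UnboundedOp

section TensorOperator

variable {H : Type*} [NormedAddCommGroup H] [InnerProductSpace ℂ H] {A : H →ₗ.[ℂ] H}
  {K : Type*} [NormedAddCommGroup K] [InnerProductSpace ℂ K]

/-- The algebraic tensor product inside the Hilbert tensor product. -/
def tensorCoe (H K : Type*) [NormedAddCommGroup H] [InnerProductSpace ℂ H]
    [NormedAddCommGroup K] [InnerProductSpace ℂ K] : H ⊗[ℂ] K →L[ℂ] HilbertTensor H K :=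
  UniformSpace.Completion.toComplL

theorem inner_tensorCoe (x y : H ⊗[ℂ] K) :
    ⟪tensorCoe H K x, tensorCoe H K y⟫_ℂ = ⟪x, y⟫_ℂ :=
  UniformSpace.Completion.inner_coe x y

theorem tensor_induction {P : HilbertTensor H K → Prop} (hc : IsClosed {x | P x})
    (h : ∀ t, P (tensorCoe H K t)) (x : HilbertTensor H K) : P x :=
  UniformSpace.Completion.induction_on x hc h

/-- `A ⊗ I` on the algebraic tensor product, with values in the algebraic tensor product. -/
theorem mem_graph_algTensorId_iff {p : HilbertTensor H K × HilbertTensor H K} :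
    p ∈ (algTensorId K A).graph ↔ ∃ t : A.domain ⊗[ℂ] K,
      tensorCoe H K (LinearMap.rTensor K A.domain.subtype t) = p.1 ∧
        tensorCoe H K (LinearMap.rTensor K A.toFun t) = p.2 := by
  rw [LinearPMap.mem_graph_iff]
  have key : ∀ t : A.domain ⊗[ℂ] K, algTensorId K A ⟨tensorIncl K A.domain t, ⟨t, rfl⟩⟩ =
      tensorCoe H K (LinearMap.rTensor K A.toFun t) := fun t => by
    have e : (LinearEquiv.ofInjective _ (tensorIncl_injective K A.domain)).symm
        ⟨tensorIncl K A.domain t, ⟨t, rfl⟩⟩ = t := by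
      rw [LinearEquiv.symm_apply_eq]
      rfl
    exact congrArg (fun s => tensorCoe H K (LinearMap.rTensor K A.toFun s)) e
  constructor
  · rintro ⟨⟨_, t, rfl⟩, h1, h2⟩
    exact ⟨t, h1, (key t).symm.trans h2⟩
  · rintro ⟨t, h1, h2⟩
    exact ⟨⟨tensorIncl K A.domain t, ⟨t, rfl⟩⟩, h1, (key t).trans h2⟩

theorem inner_rTensor (hA : A.IsFormalAdjoint A) (s t : A.domain ⊗[ℂ] K) :
    ⟪LinearMap.rTensor K A.toFun s, LinearMap.rTensor K A.domain.subtype t⟫_ℂ =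
      ⟪LinearMap.rTensor K A.domain.subtype s, LinearMap.rTensor K A.toFun t⟫_ℂ := by
  induction s with
  | zero => simp
  | add s s' hs hs' => simp only [map_add, inner_add_left, hs, hs']
  | tmul x k =>
    induction t with
    | zero => simp
    | add t t' ht ht' => simp only [map_add, inner_add_right, ht, ht']
    | tmul y l =>
      simp only [LinearMap.rTensor_tmul, TensorProduct.inner_tmul]
      exact congrArg (· * ⟪k, l⟫_ℂ) (hA x y)

theorem isFormalAdjoint_algTensorId (hA : A.IsFormalAdjoint A) :
    (algTensorId K A).IsFormalAdjoint (algTensorId K A) := by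
  intro x y
  obtain ⟨s, hs1, hs2⟩ := mem_graph_algTensorId_iff.mp ((algTensorId K A).mem_graph x)
  obtain ⟨t, ht1, ht2⟩ := mem_graph_algTensorId_iff.mp ((algTensorId K A).mem_graph y)
  dsimp only at hs1 hs2 ht1 ht2
  rw [← hs1, ← hs2, ← ht1, ← ht2, inner_tensorCoe, inner_tensorCoe, inner_rTensor hA]

theorem dense_domain_algTensorId (hA : Dense (A.domain : Set H)) :
    Dense ((algTensorId K A).domain : Set (HilbertTensor H K)) := by
  have hd : ∀ t : H ⊗[ℂ] K, tensorCoe H K t ∈ (algTensorId K A).domain.topologicalClosure := by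
    intro t
    induction t with
    | zero => rw [map_zero]; exact Submodule.zero_mem _
    | add s t hs ht => rw [map_add]; exact Submodule.add_mem _ hs ht
    | tmul x k =>
      refine hA.induction (P := fun x => tensorCoe H K (x ⊗ₜ[ℂ] k) ∈
        (algTensorId K A).domain.topologicalClosure) (fun x hx => ?_) ?_ x
      · refine Submodule.le_topologicalClosure _ ?_
        refine ⟨(⟨x, hx⟩ : A.domain) ⊗ₜ[ℂ] k, ?_⟩
        rfl
      · refine (Submodule.isClosed_topologicalClosure _).preimage ?_
        exact (tensorCoe H K).continuous.comp
          (TensorProduct.continuous_tmul.comp (by fun_prop : Continuous fun x : H => (x, k)))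
  intro x
  exact tensor_induction (P := fun x => x ∈ (algTensorId K A).domain.topologicalClosure)
    (Submodule.isClosed_topologicalClosure _) hd x

/-- A densely defined symmetric operator is contained in its adjoint, which is closed. -/
theorem isClosable_algTensorId (hd : Dense (A.domain : Set H)) (hA : A.IsFormalAdjoint A) :
    (algTensorId K A).IsClosable :=
  (LinearPMap.adjoint_isClosed (dense_domain_algTensorId hd)).isClosable.leIsClosable
    ((isFormalAdjoint_algTensorId hA).le_adjoint (dense_domain_algTensorId hd))

theorem graph_tensorId (hd : Dense (A.domain : Set H)) (hA : A.IsFormalAdjoint A) :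
    (tensorId K A).graph = (algTensorId K A).graph.topologicalClosure :=
  (isClosable_algTensorId hd hA).graph_closure_eq_closure_graph.symm

/-- Closed conditions on the graph of `A ⊗ I` need only be checked on algebraic tensors. -/
theorem graph_tensorId_induction (hd : Dense (A.domain : Set H)) (hA : A.IsFormalAdjoint A)
    {P : HilbertTensor H K → HilbertTensor H K → Prop} (hc : IsClosed {p : _ × _ | P p.1 p.2})
    (h : ∀ t : A.domain ⊗[ℂ] K, P (tensorCoe H K (LinearMap.rTensor K A.domain.subtype t))
      (tensorCoe H K (LinearMap.rTensor K A.toFun t))) (x : (tensorId K A).domain) :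
    P x (tensorId K A x) := by
  have hx := (tensorId K A).mem_graph x
  rw [graph_tensorId hd hA] at hx
  refine closure_minimal (t := {p : _ × _ | P p.1 p.2}) (fun p hp => ?_) hc hx
  obtain ⟨t, h1, h2⟩ := mem_graph_algTensorId_iff.mp hp
  have := h t
  rwa [h1, h2] at this

theorem isFormalAdjoint_tensorId (hd : Dense (A.domain : Set H)) (hA : A.IsFormalAdjoint A) :
    (tensorId K A).IsFormalAdjoint (tensorId K A) := by
  intro x y
  refine graph_tensorId_induction hd hA
    (P := fun u v => ⟪v, (y : HilbertTensor H K)⟫_ℂ = ⟪u, tensorId K A y⟫_ℂ)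
    (isClosed_eq (by fun_prop) (by fun_prop)) (fun s => ?_) x
  refine graph_tensorId_induction hd hA
    (P := fun u v => ⟪tensorCoe H K (LinearMap.rTensor K A.toFun s), u⟫_ℂ =
      ⟪tensorCoe H K (LinearMap.rTensor K A.domain.subtype s), v⟫_ℂ)
    (isClosed_eq (by fun_prop) (by fun_prop)) (fun t => ?_) y
  rw [inner_tensorCoe, inner_tensorCoe, inner_rTensor hA]

theorem tensorCoe_tmul_mem_graph (x : A.domain) (k : K) :
    (tensorCoe H K ((x : H) ⊗ₜ[ℂ] k), tensorCoe H K (A x ⊗ₜ[ℂ] k)) ∈ (tensorId K A).graph := by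
  refine LinearPMap.le_graph_of_le (LinearPMap.le_closure _) ?_
  exact mem_graph_algTensorId_iff.mpr ⟨x ⊗ₜ[ℂ] k, rfl, rfl⟩

/-- The resolvent is the continuous extension of `R ⊗ I`. Both inverse relations are closed
conditions, so they reduce to algebraic tensors and, by linearity, to elementary ones. -/
theorem IsResolventPoint.tensorId (hd : Dense (A.domain : Set H)) (hA : A.IsFormalAdjoint A)
    {z : ℂ} (h : IsResolventPoint A z) : IsResolventPoint (tensorId K A) z := by
  obtain ⟨R, hR1, hR2⟩ := h
  let S : HilbertTensor H K →L[ℂ] HilbertTensor H K := (R.rTensor K).completion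
  have hS : ∀ t, S (tensorCoe H K t) = tensorCoe H K (R.rTensor K t) := fun t =>
    ContinuousLinearMap.completion_apply_coe (R.rTensor K) t
  have hcl : IsClosed ((UnboundedOp.tensorId K A).graph :
      Set (HilbertTensor H K × HilbertTensor H K)) := by
    rw [graph_tensorId hd hA]
    exact Submodule.isClosed_topologicalClosure _
  have h1 : ∀ x, (S x, x + z • S x) ∈ (UnboundedOp.tensorId K A).graph := by
    have hc : Continuous fun x : HilbertTensor H K => (S x, x + z • S x) :=
      S.continuous.prodMk (continuous_id.add (S.continuous.const_smul z))
    refine tensor_induction (P := fun x => (S x, x + z • S x) ∈ (UnboundedOp.tensorId K A).graph)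
      (hcl.preimage hc) fun t => ?_
    induction t with
    | zero =>
      rw [map_zero, map_zero, smul_zero, add_zero]
      exact Submodule.zero_mem _
    | add s t hs ht =>
      have := Submodule.add_mem _ hs ht
      convert this using 1
      refine Prod.ext ?_ ?_
      · simp only [map_add, Prod.fst_add]
      · simp only [map_add, Prod.snd_add, smul_add]
        abel
    | tmul x k =>
      obtain ⟨hx, ex⟩ := hR1 x
      have := tensorCoe_tmul_mem_graph (K := K) ⟨R x, hx⟩ k
      have e : A ⟨R x, hx⟩ = x + z • R x := sub_eq_iff_eq_add.mp ex
      rw [e] at this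
      rw [hS, ContinuousLinearMap.rTensor_tmul, ← map_smul, ← map_add]
      rwa [TensorProduct.add_tmul, ← TensorProduct.smul_tmul'] at this
  refine ⟨S, fun x => ?_, ?_⟩
  · obtain ⟨u, hu1, hu2⟩ := (LinearPMap.mem_graph_iff _).mp (h1 x)
    dsimp only at hu1 hu2
    refine ⟨hu1 ▸ u.2, ?_⟩
    have e : (⟨S x, hu1 ▸ u.2⟩ : (UnboundedOp.tensorId K A).domain) = u := Subtype.ext hu1.symm
    rw [e, hu2]
    abel
  · refine graph_tensorId_induction hd hA (P := fun u v => S (v - z • u) = u)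
      (isClosed_eq (S.continuous.comp (continuous_snd.sub (continuous_fst.const_smul z)))
        continuous_fst) fun t => ?_
    rw [← map_smul, ← map_sub, hS]
    congr 1
    induction t with
    | zero => simp
    | add s t hs ht =>
      rw [map_add, map_add, smul_add, add_sub_add_comm, map_add, hs, ht]
    | tmul x k =>
      simp only [LinearMap.rTensor_tmul]
      rw [TensorProduct.smul_tmul', ← TensorProduct.sub_tmul, ContinuousLinearMap.rTensor_tmul]
      exact congrArg (· ⊗ₜ[ℂ] k) (hR2 x)

/-- The isometry `x ↦ x ⊗ k` for a unit vector `k`. -/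
def tmulIsometry (H : Type*) [NormedAddCommGroup H] [InnerProductSpace ℂ H] {k : K}
    (hk : ‖k‖ = 1) : H →ₗᵢ[ℂ] HilbertTensor H K where
  toLinearMap := (tensorCoe H K).toLinearMap ∘ₗ (TensorProduct.mk ℂ H K).flip k
  norm_map' x := by
    have h : ‖tensorCoe H K (x ⊗ₜ[ℂ] k)‖ = ‖x ⊗ₜ[ℂ] k‖ := UniformSpace.Completion.norm_coe _
    exact h.trans (by rw [TensorProduct.norm_tmul, hk, mul_one])

theorem tmulIsometry_apply {k : K} (hk : ‖k‖ = 1) (x : H) :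
    tmulIsometry H hk x = tensorCoe H K (x ⊗ₜ[ℂ] k) := rfl

theorem tmulIsometry_intertwines {k : K} (hk : ‖k‖ = 1) (x : A.domain) :
    ∃ h : tmulIsometry H hk x ∈ (tensorId K A).domain,
      tensorId K A ⟨tmulIsometry H hk x, h⟩ = tmulIsometry H hk (A x) := by
  obtain ⟨u, hu1, hu2⟩ := (LinearPMap.mem_graph_iff _).mp (tensorCoe_tmul_mem_graph x k)
  dsimp only at hu1 hu2
  have hx : tmulIsometry H hk (x : H) = u := hu1.symm
  refine ⟨hx ▸ u.2, ?_⟩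
  have e : (⟨tmulIsometry H hk x, hx ▸ u.2⟩ : (tensorId K A).domain) = u := Subtype.ext hx
  rw [e, hu2]
  rfl

variable [CompleteSpace H]

theorem _root_.IsSelfAdjoint.tensorId (hA : IsSelfAdjoint A) :
    IsSelfAdjoint (tensorId K A) := by
  have hr : ∀ z : ℂ, z.im ≠ 0 → IsResolventPoint (UnboundedOp.tensorId K A) z := fun z hz =>
    (isResolventPoint_of_im_ne_zero hA hz).tensorId hA.dense_domain hA.isFormalAdjoint
  refine isSelfAdjoint_of_surjective ?_
    (isFormalAdjoint_tensorId hA.dense_domain hA.isFormalAdjoint) Complex.I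
    (hr _ (by simp)).surjective (hr _ (by simp)).surjective
  exact (dense_domain_algTensorId hA.dense_domain).mono (LinearPMap.le_closure _).1

/-- For a unit vector `k`, the map `x ↦ x ⊗ k` is isometric and intertwines `A` with `A ⊗ I`, so a
lower bound for `A ⊗ I - z` passes to `A - z`. This is where `K` must be nonzero. -/
theorem spec_tensorId (hA : IsSelfAdjoint A) [Nontrivial K] : spec (tensorId K A) = spec A := by
  obtain ⟨k, hk⟩ := exists_norm_eq K zero_le_one
  ext z
  refine not_congr ⟨fun h => ?_, fun h => h.tensorId hA.dense_domain hA.isFormalAdjoint⟩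
  by_cases hz : z.im = 0
  · have e : z = (z.re : ℂ) := Complex.ext rfl (by simpa using hz)
    obtain ⟨c, hc, hb⟩ := h.exists_bound
    rw [e] at hb ⊢
    refine isResolventPoint_ofReal_of_bound hA hc fun x => ?_
    obtain ⟨hx, ex⟩ := tmulIsometry_intertwines hk x
    have h := hb ⟨_, hx⟩
    rw [ex] at h
    dsimp only at h
    rwa [← map_smul, ← map_sub, LinearIsometry.norm_map, LinearIsometry.norm_map] at h
  · exact isResolventPoint_of_im_ne_zero hA hz

end TensorOperator

section Multiplicity

variable {H : Type} [NormedAddCommGroup H] [InnerProductSpace ℂ H] {A : H →ₗ.[ℂ] H}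
  {K : Type} [NormedAddCommGroup K] [InnerProductSpace ℂ K]

theorem isOrthogonalCopies_tmulIsometry {ι : Type} {b : ι → K} (hb : Orthonormal ℂ b) :
    IsOrthogonalCopies (tensorId K A) A fun i => tmulIsometry H (hb.1 i) where
  orthogonal i j hij x y := by
    rw [tmulIsometry_apply, tmulIsometry_apply, inner_tensorCoe, TensorProduct.inner_tmul,
      hb.2 hij, mul_zero]
  intertwines i x := tmulIsometry_intertwines (hb.1 i) x

variable [CompleteSpace K]

theorem exists_infinite_hilbertBasis (hK : ¬ FiniteDimensional ℂ K) :
    ∃ (w : Set K) (_ : HilbertBasis w ℂ K), Infinite w := by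
  obtain ⟨w, b, -⟩ := exists_hilbertBasis ℂ K
  refine ⟨w, b, ?_⟩
  by_contra h
  rw [not_infinite_iff_finite] at h
  have := Fintype.ofFinite w
  exact hK (Module.Basis.finiteDimensional_of_finite b.toOrthonormalBasis.toBasis)

variable [CompleteSpace H]

theorem hasUniformInfiniteMultiplicity_tensorId (hA : IsSelfAdjoint A)
    (hK : ¬ FiniteDimensional ℂ K) : HasUniformInfiniteMultiplicity (tensorId K A) := by
  obtain ⟨w, b, hw⟩ := exists_infinite_hilbertBasis hK
  refine ⟨w, hw, H, _, _, ‹_›, A, fun i => tmulIsometry H (b.orthonormal.1 i), hA,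
    isOrthogonalCopies_tmulIsometry b.orthonormal, ?_⟩
  set V := (⨆ i, LinearMap.range
    (tmulIsometry H (b.orthonormal.1 i)).toLinearMap).topologicalClosure
  have hcl : IsClosed (V : Set (HilbertTensor H K)) := Submodule.isClosed_topologicalClosure _
  -- For fixed `x` the map `k ↦ x ⊗ k` is continuous and sends the basis vectors into `V`; their
  -- span is dense in `K`.
  have h1 : ∀ (x : H) (k : K), tensorCoe H K (x ⊗ₜ[ℂ] k) ∈ V := fun x k => by
    have hk : k ∈ (Submodule.span ℂ (Set.range b)).topologicalClosure := by
      rw [b.dense_span]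
      trivial
    let T : K →L[ℂ] HilbertTensor H K := (tensorCoe H K).comp (TensorProduct.mkL ℂ H K x)
    have hT : IsClosed ((V.comap T.toLinearMap : Submodule ℂ K) : Set K) :=
      hcl.preimage T.continuous
    refine Submodule.topologicalClosure_minimal _ (Submodule.span_le.mpr ?_) hT hk
    rintro _ ⟨i, rfl⟩
    refine Submodule.le_topologicalClosure _ (Submodule.mem_iSup_of_mem i ⟨x, rfl⟩)
  rw [Submodule.eq_top_iff']
  refine tensor_induction hcl fun t => ?_
  induction t with
  | zero => rw [map_zero]; exact Submodule.zero_mem _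
  | add s t hs ht => rw [map_add]; exact Submodule.add_mem _ hs ht
  | tmul x k => exact h1 x k

theorem hasInfiniteMultiplicityAt_tensorId (hA : IsSelfAdjoint A)
    (hK : ¬ FiniteDimensional ℂ K) [Nontrivial K] {z : ℂ} (hz : z ∈ spec (tensorId K A)) :
    HasInfiniteMultiplicityAt (tensorId K A) z := by
  obtain ⟨w, b, hw⟩ := exists_infinite_hilbertBasis hK
  exact ⟨w, hw, H, _, _, ‹_›, A, fun i => tmulIsometry H (b.orthonormal.1 i), hA,
    spec_tensorId (K := K) hA ▸ hz, isOrthogonalCopies_tmulIsometry b.orthonormal⟩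

end Multiplicity

end UnboundedOp

/-! ### An infinite orthonormal family at the finite places. -/

namespace FinitePlaces

section Local

variable (p : ℕ) [Fact p.Prime]

/-- The uniformizer `p` as an element of `ℚ_p^×`. -/
def uniformizer : (ℚ_[p])ˣ :=
  Units.mk0 (p : ℚ_[p]) (Nat.cast_ne_zero.mpr (Fact.out : p.Prime).ne_zero)

/-- The translate `p⁻¹ ℤ_p^×`. -/
def shiftedUnits : Set (ℚ_[p])ˣ := (fun x => uniformizer p * x) ⁻¹' integralUnits p

theorem isOpen_shiftedUnits : IsOpen (shiftedUnits p) :=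
  (isOpen_integralUnits p).preimage (continuous_const_mul _)

/-- Haar measure is invariant under multiplication by `p`. -/
theorem unitsHaar_shiftedUnits : unitsHaar p (shiftedUnits p) = 1 := by
  have h := measure_preimage_mul (Measure.haarMeasure (integralUnitsCompacts p)) (uniformizer p)
    (integralUnits p)
  exact h.trans (unitsHaar_integralUnits p)

theorem disjoint_shiftedUnits : shiftedUnits p ∩ integralUnits p = ∅ := by
  rw [Set.eq_empty_iff_forall_notMem]
  rintro x ⟨h1, h2⟩
  have h1' : ‖(p : ℚ_[p]) * (x : ℚ_[p])‖ = 1 := h1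
  have h2' : ‖(x : ℚ_[p])‖ = 1 := h2
  rw [norm_mul, h2', mul_one, Padic.norm_p, inv_eq_one] at h1'
  exact (Fact.out : p.Prime).one_lt.ne' (by exact_mod_cast h1')

/-- The indicator function of `p⁻¹ ℤ_p^×`. -/
def shiftedSpherical : L2Padic p :=
  indicatorConstLp 2 (isOpen_shiftedUnits p).measurableSet
    (by rw [unitsHaar_shiftedUnits]; exact ENNReal.one_ne_top) (1 : ℂ)

theorem inner_shiftedSpherical_self : ⟪shiftedSpherical p, shiftedSpherical p⟫_ℂ = 1 := by
  have h : unitsHaar p (shiftedUnits p) ≠ ⊤ := by simp [unitsHaar_shiftedUnits]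
  rw [shiftedSpherical, L2.inner_indicatorConstLp_indicatorConstLp _ _ h h]
  simp [Measure.real, unitsHaar_shiftedUnits]

theorem inner_shiftedSpherical_spherical : ⟪shiftedSpherical p, spherical p⟫_ℂ = 0 := by
  rw [shiftedSpherical, spherical, L2.inner_indicatorConstLp_indicatorConstLp _ _
    (by simp [unitsHaar_shiftedUnits]) (by simp [unitsHaar_integralUnits])]
  simp [Measure.real, disjoint_shiftedUnits]

end Local

open scoped Classical in
/-- The pure tensor which is spherical outside `q` and the indicator of `q⁻¹ ℤ_q^×` at `q`. -/
def ramifiedAt (q : Nat.Primes) : RestrictedFamily :=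
  ⟨Function.update (fun p : Nat.Primes => spherical p) q (shiftedSpherical q), by
    refine (Set.finite_singleton q).subset fun p hp => ?_
    by_contra h
    exact hp (Function.update_of_ne h _ _)⟩

theorem ramifiedAt_self (q : Nat.Primes) : (ramifiedAt q).1 q = shiftedSpherical q := by
  simp [ramifiedAt]

theorem ramifiedAt_of_ne {q p : Nat.Primes} (h : p ≠ q) : (ramifiedAt q).1 p = spherical p := by
  simp [ramifiedAt, h]

theorem pureInner_ramifiedAt_self (q : Nat.Primes) :
    pureInner (ramifiedAt q) (ramifiedAt q) = 1 := by
  refine finprod_eq_one_of_forall_eq_one fun p => ?_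
  rcases eq_or_ne p q with rfl | h
  · rw [ramifiedAt_self, inner_shiftedSpherical_self]
  · rw [ramifiedAt_of_ne h, inner_self_eq_norm_sq_to_K, norm_spherical]
    simp

theorem pureInner_ramifiedAt_of_ne {q r : Nat.Primes} (h : q ≠ r) :
    pureInner (ramifiedAt q) (ramifiedAt r) = 0 := by
  refine finprod_eq_zero _ q ?_ (finite_mulSupport_inner _ _)
  rw [ramifiedAt_self, ramifiedAt_of_ne h, inner_shiftedSpherical_spherical]

/-- A pure tensor as a formal combination of pure tensors. -/
def formalTensor (ψ : RestrictedFamily) : FormalTensors :=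
  (Finsupp.single ψ 1 : RestrictedFamily →₀ ℂ)

/-- A pure tensor as a vector of the restricted tensor product. -/
def pureTensor (ψ : RestrictedFamily) : Hfin := (formalTensor ψ : Hfin)

theorem inner_pureTensor (ψ φ : RestrictedFamily) :
    ⟪pureTensor ψ, pureTensor φ⟫_ℂ = pureInner ψ φ := by
  refine (UniformSpace.Completion.inner_coe _ _).trans ?_
  change formalInner _ _ = _
  simp [formalInner, formalTensor]

/-- For `q ≠ r` the factor at `q` pairs the indicators of the disjoint sets `q⁻¹ ℤ_q^×` and `ℤ_q^×`,
so the whole product vanishes. The infinitude of primes then makes `Hfin` infinite-dimensional. -/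
theorem orthonormal_ramifiedAt : Orthonormal ℂ fun q => pureTensor (ramifiedAt q) := by
  classical
  rw [orthonormal_iff_ite]
  intro q r
  rw [inner_pureTensor]
  split_ifs with h
  · rw [h, pureInner_ramifiedAt_self]
  · exact pureInner_ramifiedAt_of_ne h

theorem not_finiteDimensional_Hfin : ¬ FiniteDimensional ℂ Hfin := fun _ =>
  not_finite_iff_infinite.mpr (inferInstanceAs (Infinite Nat.Primes))
    orthonormal_ramifiedAt.linearIndependent.finite

instance nontrivial_Hfin : Nontrivial Hfin := by
  by_contra h
  rw [not_nontrivial_iff_subsingleton] at h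
  exact not_finiteDimensional_Hfin inferInstance

end FinitePlaces

/-! ### Bounded perturbations and quadratic form bounds. -/

namespace UnboundedOp

variable {H : Type*} [NormedAddCommGroup H] [InnerProductSpace ℂ H] [CompleteSpace H]

/-- A bounded symmetric perturbation of a self-adjoint operator is self-adjoint. -/
theorem isSelfAdjoint_add_bounded {A : H →ₗ.[ℂ] H} (hA : IsSelfAdjoint A) (B : H →L[ℂ] H)
    (hB : ∀ x y, ⟪B x, y⟫_ℂ = ⟪x, B y⟫_ℂ) :
    IsSelfAdjoint (⟨A.domain, A.toFun + B.toLinearMap ∘ₗ A.domain.subtype⟩ : H →ₗ.[ℂ] H) := by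
  set T : H →ₗ.[ℂ] H := ⟨A.domain, A.toFun + B.toLinearMap ∘ₗ A.domain.subtype⟩
  have hT : ∀ x : A.domain, T x = A x + B x := fun x => rfl
  have hd : Dense (T.domain : Set H) := hA.dense_domain
  have hs : T.IsFormalAdjoint T := fun x y => by
    have h := hA.isFormalAdjoint x y
    have h1 := hT x
    have h2 := hT y
    rw [h1, h2, inner_add_left, inner_add_right, hB, h]
  rw [LinearPMap.isSelfAdjoint_def]
  refine (LinearPMap.eq_of_le_of_domain_eq (hs.le_adjoint hd)
    (le_antisymm (hs.le_adjoint hd).1 fun y hy => ?_)).symm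
  have h : y ∈ A.adjoint.domain := by
    refine LinearPMap.mem_adjoint_domain_of_exists _ ⟨T.adjoint ⟨y, hy⟩ - B y, fun x => ?_⟩
    have h := LinearPMap.adjoint_isFormalAdjoint hd ⟨y, hy⟩ x
    rw [inner_sub_left, h, hT, inner_add_right, hB]
    exact add_sub_cancel_right _ _
  rw [LinearPMap.isSelfAdjoint_def.mp hA] at h
  exact h

/-- If the spectrum of a self-adjoint operator lies below `M`, so do its quadratic form values. -/
theorem re_inner_le_of_spec_le {A : H →ₗ.[ℂ] H} (hA : IsSelfAdjoint A) {M : ℝ}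
    (hM : ∀ x : ℝ, (x : ℂ) ∈ spec A → x ≤ M) (x : A.domain) :
    (⟪(x : H), A x⟫_ℂ).re ≤ M * ‖(x : H)‖ ^ 2 := by
  -- Square `(z - M) ‖x‖ ≤ ‖A x - z x‖`: the `z²` terms cancel, leaving a bound linear in `z`.
  -- Letting `z` grow forces the coefficient to be nonpositive.
  have key : ∀ z > M, 2 * z * ((⟪(x : H), A x⟫_ℂ).re - M * ‖(x : H)‖ ^ 2) ≤ ‖A x‖ ^ 2 := by
    intro z hz
    have h := mul_norm_le_of_gap hA (sub_pos.mpr hz) (fun y hy hy' => by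
      have := hM y hy'
      rw [abs_lt] at hy
      linarith) x
    have h2 := pow_le_pow_left₀ (by nlinarith [norm_nonneg (x : H)]) h 2
    have h3 := norm_sub_sq (𝕜 := ℂ) (A x) ((z : ℂ) • (x : H))
    rw [inner_smul_right, norm_smul, Complex.norm_real, Real.norm_eq_abs, mul_pow, sq_abs,
      ← inner_conj_symm] at h3
    have h4 : ∀ w : ℂ, RCLike.re ((z : ℂ) * conj w) = z * w.re := fun w => by simp
    rw [h4] at h3
    rw [h3] at h2
    nlinarith [sq_nonneg (M * ‖(x : H)‖)]
  by_contra hlt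
  push Not at hlt
  set d := (⟪(x : H), A x⟫_ℂ).re - M * ‖(x : H)‖ ^ 2 with hd
  have hd0 : 0 < d := sub_pos.mpr hlt
  have h := key (max (M + 1) ((‖A x‖ ^ 2 + 1) / d)) (lt_max_of_lt_left (by linarith))
  have h1 : (‖A x‖ ^ 2 + 1) / d ≤ max (M + 1) ((‖A x‖ ^ 2 + 1) / d) := le_max_right _ _
  rw [div_le_iff₀ hd0] at h1
  nlinarith [sq_nonneg ‖A x‖]

theorem isResolventPoint_of_form_bound {A : H →ₗ.[ℂ] H} (hA : IsSelfAdjoint A) {M z : ℝ}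
    (hM : ∀ x : A.domain, M * ‖(x : H)‖ ^ 2 ≤ (⟪(x : H), A x⟫_ℂ).re) (hz : z < M) :
    IsResolventPoint A z := by
  refine isResolventPoint_ofReal_of_bound hA (sub_pos.mpr hz) fun x => ?_
  rcases eq_or_ne ‖(x : H)‖ 0 with h0 | h0
  · simp [h0]
  have h1 : (⟪(x : H), A x - (z : ℂ) • (x : H)⟫_ℂ).re =
      (⟪(x : H), A x⟫_ℂ).re - z * ‖(x : H)‖ ^ 2 := by
    rw [inner_sub_right, inner_smul_right, inner_self_eq_norm_sq_to_K, Complex.sub_re]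
    simp [← Complex.ofReal_pow]
  have h2 : (⟪(x : H), A x - (z : ℂ) • (x : H)⟫_ℂ).re ≤
      ‖(x : H)‖ * ‖A x - (z : ℂ) • (x : H)‖ :=
    (Complex.re_le_norm _).trans (norm_inner_le_norm _ _)
  have h3 : 0 < ‖(x : H)‖ := lt_of_le_of_ne (norm_nonneg _) (Ne.symm h0)
  nlinarith [hM x]

end UnboundedOp

/-! ### The Sobolev space `H²(ℝ)` and its Schwartz core. -/

namespace RealPlace

open TemperedDistribution Laplacian

/-- A Schwartz function as an element of `L²(ℝ)`. -/
def toL2 (φ : 𝓢(ℝ, ℂ)) : L2R := φ.toLp 2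

theorem coeFn_toL2 (φ : 𝓢(ℝ, ℂ)) : toL2 φ =ᵐ[volume] φ := φ.coeFn_toLp 2

/-- The second derivative of a Schwartz function. -/
def schwartzDeriv2 (φ : 𝓢(ℝ, ℂ)) : 𝓢(ℝ, ℂ) :=
  SchwartzMap.derivCLM ℂ ℂ (SchwartzMap.derivCLM ℂ ℂ φ)

theorem toL2_mem (φ : 𝓢(ℝ, ℂ)) : toL2 φ ∈ sobolevH2 := by
  change MemSobolev 2 2 ((toL2 φ : L2R) : 𝓢'(ℝ, ℂ))
  rw [toL2, Lp.toTemperedDistribution_toLp_eq]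
  exact φ.memSobolev

theorem isSecondDeriv_secondDeriv (u : sobolevH2) : IsSecondDeriv u (secondDeriv u) :=
  (exists_isSecondDeriv u).choose_spec

theorem isSecondDeriv_toL2 (φ : 𝓢(ℝ, ℂ)) : IsSecondDeriv (toL2 φ) (toL2 (schwartzDeriv2 φ)) := by
  unfold IsSecondDeriv toL2 schwartzDeriv2
  rw [Lp.toTemperedDistribution_toLp_eq, Lp.toTemperedDistribution_toLp_eq]
  rw [derivCLM_toTemperedDistributionCLM_eq (𝕜 := ℂ), derivCLM_toTemperedDistributionCLM_eq (𝕜 := ℂ)]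

theorem secondDeriv_toL2 (φ : 𝓢(ℝ, ℂ)) :
    secondDeriv ⟨toL2 φ, toL2_mem φ⟩ = toL2 (schwartzDeriv2 φ) :=
  (isSecondDeriv_secondDeriv _).unique (isSecondDeriv_toL2 φ)

/-- `(2π)⁻²`. -/
def besselConst : ℝ := ((2 * Real.pi) ^ 2)⁻¹

theorem besselConst_pos : 0 < besselConst := by
  unfold besselConst
  positivity

/-- In the normalisation `exp(-2πixξ)` the operator `-d²/dx²` has symbol `(2π)² ξ²`, so the
multiplier `1 + ξ²` is `1 - (2π)⁻² d²/dx²`. -/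
theorem besselPotential_two_eq (f : 𝓢'(ℝ, ℂ)) :
    besselPotential ℝ ℂ 2 f =
      f - (besselConst : ℂ) • TemperedDistribution.derivCLM ℂ (TemperedDistribution.derivCLM ℂ f) := by
  have h1 : TemperedDistribution.derivCLM ℂ (TemperedDistribution.derivCLM ℂ f) = Δ f := by
    rw [derivCLM_eq_lineDerivOp, derivCLM_eq_lineDerivOp,
      TemperedDistribution.laplacian_eq_sum (OrthonormalBasis.singleton (Fin 1) ℝ)]
    simp
  have h2 : besselPotential ℝ ℂ 2 f = f +
      TemperedDistribution.fourierMultiplierCLM ℂ (fun x : ℝ => Complex.ofReal (‖x‖ ^ 2)) f := by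
    have h := TemperedDistribution.fourierMultiplierCLM_sum ℂ (s := Finset.univ)
      (g := fun b : Bool => cond b (fun _ : ℝ => (1 : ℂ)) fun x : ℝ => Complex.ofReal (‖x‖ ^ 2))
      (by
        rintro (_ | _) -
        · exact (by fun_prop : Function.HasTemperateGrowth fun x : ℝ => Complex.ofReal (‖x‖ ^ 2))
        · exact Function.HasTemperateGrowth.const 1)
    rw [Fintype.sum_bool] at h
    have h' := congrArg (fun T => T f) h
    simp only [cond_true, cond_false, add_apply, Fintype.sum_bool,
      TemperedDistribution.fourierMultiplierCLM_const, one_smul, ContinuousLinearMap.id_apply] at h'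
    rw [← h', besselPotential]
    congr 2
    ext x
    norm_num
  rw [h1, h2, TemperedDistribution.laplacian_eq_fourierMultiplierCLM]
  have h3 : besselConst * -(2 * Real.pi) ^ 2 = -1 := by
    rw [besselConst, mul_neg, inv_mul_cancel₀ (by positivity)]
  ext u
  change f u + _ = f u - (besselConst : ℂ) • ((-(2 * Real.pi) ^ 2 : ℝ) •
    TemperedDistribution.fourierMultiplierCLM ℂ (fun x : ℝ => Complex.ofReal (‖x‖ ^ 2)) f u)
  rw [Complex.coe_smul, smul_smul, h3, neg_one_smul, sub_neg_eq_add]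
  rfl

theorem besselPotential_two_coe (u : sobolevH2) :
    besselPotential ℝ ℂ 2 ((u : L2R) : 𝓢'(ℝ, ℂ)) =
      (((u : L2R) - (besselConst : ℂ) • secondDeriv u : L2R) : 𝓢'(ℝ, ℂ)) := by
  rw [besselPotential_two_eq, isSecondDeriv_secondDeriv u]
  simp only [← Lp.toTemperedDistributionCLM_apply]
  rw [map_sub, map_smul]

/-- The preimage of `g` is its Bessel potential of order `-2`. This surjectivity is the source of
self-adjointness of the free operator. -/
theorem exists_sub_smul_secondDeriv_eq (g : L2R) :
    ∃ u : sobolevH2, (u : L2R) - (besselConst : ℂ) • secondDeriv u = g := by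
  have h : MemSobolev 2 2 (besselPotential ℝ ℂ (-2) (g : 𝓢'(ℝ, ℂ))) := by
    rw [memSobolev_besselPotential_iff, neg_add_cancel, memSobolev_zero_iff]
    exact ⟨g, rfl⟩
  obtain ⟨u, hu⟩ := memSobolev_zero_iff.mp (h.mono (show (0 : ℝ) ≤ 2 by norm_num))
  rw [hu] at h
  refine ⟨⟨u, h⟩, toTemperedDistribution_injective ?_⟩
  rw [← besselPotential_two_coe, ← hu]
  simp

/-- The inverse multiplier `(1 + ξ²)⁻¹` has temperate growth, hence preserves Schwartz functions. -/
theorem exists_schwartz_sub_smul_eq (ψ : 𝓢(ℝ, ℂ)) :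
    ∃ φ : 𝓢(ℝ, ℂ), toL2 φ - (besselConst : ℂ) • toL2 (schwartzDeriv2 φ) = toL2 ψ := by
  let g : ℝ → ℂ := fun x => ((1 + ‖x‖ ^ 2) ^ ((-2 : ℝ) / 2) : ℝ)
  have hg : g.HasTemperateGrowth := by
    unfold g
    fun_prop
  refine ⟨SchwartzMap.fourierMultiplierCLM ℂ g ψ, ?_⟩
  set φ := SchwartzMap.fourierMultiplierCLM ℂ g ψ with hφ
  have h := besselPotential_two_coe ⟨toL2 φ, toL2_mem φ⟩
  rw [secondDeriv_toL2] at h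
  refine toTemperedDistribution_injective (h.symm.trans ?_)
  have h2 : ((toL2 φ : L2R) : 𝓢'(ℝ, ℂ)) = besselPotential ℝ ℂ (-2) ((toL2 ψ : L2R) : 𝓢'(ℝ, ℂ)) := by
    unfold toL2
    rw [Lp.toTemperedDistribution_toLp_eq, Lp.toTemperedDistribution_toLp_eq, besselPotential,
      fourierMultiplierCLM_toTemperedDistributionCLM_eq hg]
  rw [h2]
  simp

/-- `conj a * b` as a real bilinear map. -/
def conjMul : ℂ →L[ℝ] ℂ →L[ℝ] ℂ :=
  (ContinuousLinearMap.mul ℝ ℂ) ∘L (Complex.conjCLE : ℂ →L[ℝ] ℂ)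

theorem inner_toL2 (φ ψ : 𝓢(ℝ, ℂ)) : ⟪toL2 φ, toL2 ψ⟫_ℂ = ∫ x, conjMul (φ x) (ψ x) := by
  refine (SchwartzMap.inner_toL2_toL2_eq φ ψ volume).trans ?_
  refine integral_congr_ae (Eventually.of_forall fun x => ?_)
  simp [conjMul, mul_comm]

theorem inner_toL2_deriv (φ ψ : 𝓢(ℝ, ℂ)) :
    ⟪toL2 φ, toL2 (SchwartzMap.derivCLM ℂ ℂ ψ)⟫_ℂ =
      -⟪toL2 (SchwartzMap.derivCLM ℂ ℂ φ), toL2 ψ⟫_ℂ := by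
  rw [inner_toL2, inner_toL2]
  exact SchwartzMap.integral_bilinear_deriv_right_eq_neg_left φ ψ conjMul

theorem inner_schwartzDeriv2 (φ ψ : 𝓢(ℝ, ℂ)) :
    ⟪toL2 φ, toL2 (schwartzDeriv2 ψ)⟫_ℂ =
      -⟪toL2 (SchwartzMap.derivCLM ℂ ℂ φ), toL2 (SchwartzMap.derivCLM ℂ ℂ ψ)⟫_ℂ :=
  inner_toL2_deriv _ _

theorem re_inner_schwartzDeriv2_self (φ : 𝓢(ℝ, ℂ)) :
    (⟪toL2 φ, toL2 (schwartzDeriv2 φ)⟫_ℂ).re = -‖toL2 (SchwartzMap.derivCLM ℂ ℂ φ)‖ ^ 2 := by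
  rw [inner_schwartzDeriv2, Complex.neg_re, inner_self_eq_norm_sq_to_K]
  simp [← Complex.ofReal_pow]

/-- Integrating by parts, with `c = besselConst`, `Re ⟪φ, φ - c φ''⟫ = ‖φ‖² + c ‖φ'‖²`. Thus
inverting `1 - c d²/dx²` does not increase norms. -/
theorem norm_toL2_le_norm_sub (φ : 𝓢(ℝ, ℂ)) :
    ‖toL2 φ‖ ≤ ‖toL2 φ - (besselConst : ℂ) • toL2 (schwartzDeriv2 φ)‖ := by
  have h1 : (⟪toL2 φ, toL2 φ - (besselConst : ℂ) • toL2 (schwartzDeriv2 φ)⟫_ℂ).re =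
      ‖toL2 φ‖ ^ 2 + besselConst * ‖toL2 (SchwartzMap.derivCLM ℂ ℂ φ)‖ ^ 2 := by
    rw [inner_sub_right, inner_smul_right, Complex.sub_re, Complex.re_ofReal_mul,
      re_inner_schwartzDeriv2_self, inner_self_eq_norm_sq_to_K]
    simp [← Complex.ofReal_pow]
  have h2 := (Complex.re_le_norm _).trans (norm_inner_le_norm (𝕜 := ℂ) (toL2 φ)
    (toL2 φ - (besselConst : ℂ) • toL2 (schwartzDeriv2 φ)))
  rw [h1] at h2
  have h3 := mul_nonneg besselConst_pos.le
    (sq_nonneg ‖toL2 (SchwartzMap.derivCLM ℂ ℂ φ)‖)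
  rcases eq_or_ne ‖toL2 φ‖ 0 with h0 | h0
  · rw [h0]
    exact norm_nonneg _
  · have h4 : 0 < ‖toL2 φ‖ := lt_of_le_of_ne (norm_nonneg _) (Ne.symm h0)
    nlinarith

theorem denseRange_toL2 : DenseRange toL2 :=
  SchwartzMap.denseRange_toLpCLM (F := ℂ) (μ := (volume : Measure ℝ)) (p := 2) (by norm_num)

theorem toL2_sub (φ ψ : 𝓢(ℝ, ℂ)) : toL2 (φ - ψ) = toL2 φ - toL2 ψ :=
  map_sub (SchwartzMap.toLpCLM ℂ ℂ 2 (volume : Measure ℝ)) φ ψ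

theorem schwartzDeriv2_sub (φ ψ : 𝓢(ℝ, ℂ)) :
    schwartzDeriv2 (φ - ψ) = schwartzDeriv2 φ - schwartzDeriv2 ψ := by
  simp only [schwartzDeriv2, map_sub]

/-- Schwartz functions are dense in `H²(ℝ)` for the graph norm of the second derivative. -/
theorem exists_schwartz_tendsto (u : sobolevH2) : ∃ φ : ℕ → 𝓢(ℝ, ℂ),
    Tendsto (fun n => toL2 (φ n)) atTop (nhds (u : L2R)) ∧
      Tendsto (fun n => toL2 (schwartzDeriv2 (φ n))) atTop (nhds (secondDeriv u)) := by
  set g : L2R := (u : L2R) - (besselConst : ℂ) • secondDeriv u with hg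
  have hψ : ∀ n : ℕ, ∃ ψ : 𝓢(ℝ, ℂ), dist g (toL2 ψ) < 1 / ((n : ℝ) + 1) := fun n =>
    denseRange_toL2.exists_dist_lt g (by positivity)
  choose ψ hψ using hψ
  choose φ hφ using fun n => exists_schwartz_sub_smul_eq (ψ n)
  have hψt : Tendsto (fun n => toL2 (ψ n)) atTop (nhds g) := by
    rw [tendsto_iff_dist_tendsto_zero]
    refine squeeze_zero (fun _ => dist_nonneg) (fun n => ?_) tendsto_one_div_add_atTop_nhds_zero_nat
    rw [dist_comm]
    exact (hψ n).le
  have hd : ∀ m n, dist (toL2 (φ m)) (toL2 (φ n)) ≤ dist (toL2 (ψ m)) (toL2 (ψ n)) := by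
    intro m n
    have h := norm_toL2_le_norm_sub (φ m - φ n)
    rw [schwartzDeriv2_sub, toL2_sub, toL2_sub] at h
    rw [dist_eq_norm, dist_eq_norm, ← hφ m, ← hφ n]
    refine h.trans_eq (congrArg norm ?_)
    module
  have hc : CauchySeq fun n => toL2 (φ n) := by
    have h := hψt.cauchySeq
    rw [Metric.cauchySeq_iff] at h ⊢
    intro ε hε
    obtain ⟨N, hN⟩ := h ε hε
    exact ⟨N, fun m hm n hn => (hd m n).trans_lt (hN m hm n hn)⟩
  obtain ⟨v, hv⟩ := cauchySeq_tendsto_of_complete hc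
  have hcont : Continuous fun f : L2R => (f : 𝓢'(ℝ, ℂ)) :=
    (Lp.toTemperedDistributionCLM ℂ (volume : Measure ℝ) 2).continuous
  -- The limit is identified among tempered distributions, where the Bessel potential of order `2`
  -- is continuous and invertible.
  have huv : v = u := by
    refine toTemperedDistribution_injective ?_
    have h1 : Tendsto (fun n => besselPotential ℝ ℂ 2 ((toL2 (φ n) : L2R) : 𝓢'(ℝ, ℂ))) atTop
        (nhds (besselPotential ℝ ℂ 2 (v : 𝓢'(ℝ, ℂ)))) :=
      (((besselPotential ℝ ℂ 2).continuous.comp hcont).tendsto v).comp hv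
    have h2 : ∀ n, besselPotential ℝ ℂ 2 ((toL2 (φ n) : L2R) : 𝓢'(ℝ, ℂ)) =
        ((toL2 (ψ n) : L2R) : 𝓢'(ℝ, ℂ)) := fun n => by
      have h := besselPotential_two_coe ⟨toL2 (φ n), toL2_mem (φ n)⟩
      rw [secondDeriv_toL2] at h
      rw [h, hφ n]
    simp only [h2] at h1
    have h3 := tendsto_nhds_unique h1 ((hcont.tendsto g).comp hψt)
    rw [hg, ← besselPotential_two_coe u] at h3
    have h4 := congrArg (besselPotential ℝ ℂ (-2)) h3
    simpa using h4
  rw [huv] at hv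
  refine ⟨φ, hv, ?_⟩
  have h := ((hv.sub hψt).const_smul ((besselConst : ℂ)⁻¹))
  have hc0 : (besselConst : ℂ) ≠ 0 := by exact_mod_cast besselConst_pos.ne'
  -- The second derivatives are a fixed combination of the convergent sequences `toL2 (φ n)` and
  -- `toL2 (ψ n)`, so they converge too.
  have e1 : ∀ n, (besselConst : ℂ)⁻¹ • (toL2 (φ n) - toL2 (ψ n)) = toL2 (schwartzDeriv2 (φ n)) := by
    intro n
    rw [← hφ n, sub_sub_cancel, inv_smul_smul₀ hc0]
  rw [hg, sub_sub_cancel, inv_smul_smul₀ hc0] at h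
  simpa only [e1] using h

theorem secondDeriv_induction {P : L2R → L2R → Prop} (hc : IsClosed {p : L2R × L2R | P p.1 p.2})
    (h : ∀ φ : 𝓢(ℝ, ℂ), P (toL2 φ) (toL2 (schwartzDeriv2 φ))) (u : sobolevH2) :
    P u (secondDeriv u) := by
  obtain ⟨φ, h1, h2⟩ := exists_schwartz_tendsto u
  exact hc.mem_of_tendsto (h1.prodMk_nhds h2) (Eventually.of_forall fun n => h (φ n))

end RealPlace

/-! ### Self-adjointness of the Hill operator and the extent of its spectrum. -/

namespace RealPlace

open UnboundedOp

theorem re_inner_secondDeriv_nonpos (u : sobolevH2) :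
    (⟪(u : L2R), secondDeriv u⟫_ℂ).re ≤ 0 := by
  refine secondDeriv_induction (P := fun f g => (⟪f, g⟫_ℂ).re ≤ 0) ?_ (fun φ => ?_) u
  · exact isClosed_le (Complex.continuous_re.comp (continuous_fst.inner continuous_snd))
      continuous_const
  · rw [re_inner_schwartzDeriv2_self]
    exact neg_nonpos.mpr (sq_nonneg _)

theorem inner_secondDeriv_left (u v : sobolevH2) :
    ⟪secondDeriv u, (v : L2R)⟫_ℂ = ⟪(u : L2R), secondDeriv v⟫_ℂ := by
  refine secondDeriv_induction (P := fun f g => ⟪g, (v : L2R)⟫_ℂ = ⟪f, secondDeriv v⟫_ℂ)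
    (isClosed_eq (continuous_snd.inner continuous_const)
      (continuous_fst.inner continuous_const)) (fun φ => ?_) u
  refine secondDeriv_induction (P := fun f g => ⟪toL2 (schwartzDeriv2 φ), f⟫_ℂ = ⟪toL2 φ, g⟫_ℂ)
    (isClosed_eq (continuous_const.inner continuous_fst)
      (continuous_const.inner continuous_snd)) (fun ψ => ?_) v
  rw [← inner_conj_symm, inner_schwartzDeriv2, inner_schwartzDeriv2, map_neg, inner_conj_symm]

/-- The free operator `-d²/dy²` on `L²(ℝ)` with domain `H²(ℝ)`. -/
def freeHill : L2R →ₗ.[ℂ] L2R := ⟨sobolevH2, -secondDeriv⟩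

theorem isSelfAdjoint_freeHill : IsSelfAdjoint freeHill := by
  -- The test point is `z = -(2π)²`. Being real, it equals its conjugate, so one surjectivity
  -- statement serves both hypotheses of the criterion.
  have hs : ∀ y : L2R, ∃ x : freeHill.domain,
      freeHill x - ((-besselConst⁻¹ : ℝ) : ℂ) • (x : L2R) = y := by
    intro y
    obtain ⟨u, hu⟩ := exists_sub_smul_secondDeriv_eq ((besselConst : ℂ) • y)
    refine ⟨u, ?_⟩
    change -secondDeriv u - ((-besselConst⁻¹ : ℝ) : ℂ) • (u : L2R) = y
    have hc0 : (besselConst : ℂ) ≠ 0 := by exact_mod_cast besselConst_pos.ne'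
    have e := congrArg (fun v => (besselConst : ℂ)⁻¹ • v) hu
    simp only [smul_sub, inv_smul_smul₀ hc0] at e
    rw [← e]
    push_cast
    module
  refine isSelfAdjoint_of_surjective ?_ (fun u v => ?_) _ hs (by rwa [Complex.conj_ofReal])
  · refine denseRange_toL2.mono ?_
    rintro _ ⟨φ, rfl⟩
    exact toL2_mem φ
  · change ⟪-secondDeriv u, (v : L2R)⟫_ℂ = ⟪(u : L2R), -secondDeriv v⟫_ℂ
    rw [inner_neg_left, inner_neg_right]
    exact congrArg _ (inner_secondDeriv_left u v)

variable {L : ℝ} (U : EvenPeriodicPotential L)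

theorem EvenPeriodicPotential.inner_mul_left (f g : L2R) : ⟪U.mul f, g⟫_ℂ = ⟪f, U.mul g⟫_ℂ := by
  rw [L2.inner_def, L2.inner_def]
  refine integral_congr_ae ?_
  filter_upwards [U.coeFn_mul f, U.coeFn_mul g] with x h1 h2
  rw [h1, h2]
  simp only [RCLike.inner_apply, map_mul, Complex.conj_ofReal]
  ring

theorem isSelfAdjoint_hill : IsSelfAdjoint (hill U) :=
  isSelfAdjoint_add_bounded isSelfAdjoint_freeHill U.mul U.inner_mul_left

theorem hill_apply (u : sobolevH2) : hill U u = -secondDeriv u + U.mul u := rfl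

theorem hill_toL2 (φ : 𝓢(ℝ, ℂ)) :
    hill U ⟨toL2 φ, toL2_mem φ⟩ = -toL2 (schwartzDeriv2 φ) + U.mul (toL2 φ) :=
  (hill_apply U ⟨toL2 φ, toL2_mem φ⟩).trans (by rw [secondDeriv_toL2])

theorem abs_re_inner_mul_le (f : L2R) : |(⟪f, U.mul f⟫_ℂ).re| ≤ ‖U.mul‖ * ‖f‖ ^ 2 :=
  calc |(⟪f, U.mul f⟫_ℂ).re| ≤ ‖f‖ * ‖U.mul f‖ :=
        (Complex.abs_re_le_norm _).trans (norm_inner_le_norm _ _)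
    _ ≤ ‖f‖ * (‖U.mul‖ * ‖f‖) := by gcongr; exact U.mul.le_opNorm f
    _ = _ := by ring

theorem spec_hill_ge {x : ℝ} (hx : (x : ℂ) ∈ spec (hill U)) : -‖U.mul‖ ≤ x := by
  by_contra hlt
  push Not at hlt
  refine hx (isResolventPoint_of_form_bound (isSelfAdjoint_hill U) (M := -‖U.mul‖) ?_ hlt)
  intro u
  have h1 := re_inner_secondDeriv_nonpos u
  have h2 := abs_le.mp (abs_re_inner_mul_le U (u : L2R))
  have h3 := hill_apply U u
  rw [h3, inner_add_right, inner_neg_right, Complex.add_re, Complex.neg_re]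
  linarith

theorem norm_toL2_le {φ ψ : 𝓢(ℝ, ℂ)} {c : ℝ} (h : ∀ x, ‖φ x‖ ≤ c * ‖ψ x‖) :
    ‖toL2 φ‖ ≤ c * ‖toL2 ψ‖ := by
  refine Lp.norm_le_mul_norm_of_ae_le_mul ?_
  filter_upwards [coeFn_toL2 φ, coeFn_toL2 ψ] with x h1 h2
  rw [h1, h2]
  exact h x

/-- Modulate a real bump `b` by `exp(ikx)`. The derivative is `exp(ikx) (b' + i k b)`, of modulus at
least `k |b|`. -/
theorem exists_schwartz_deriv_large (k : ℝ) (hk : 0 < k) :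
    ∃ φ : 𝓢(ℝ, ℂ), toL2 φ ≠ 0 ∧
      k * ‖toL2 φ‖ ≤ ‖toL2 (SchwartzMap.derivCLM ℂ ℂ φ)‖ := by
  let b : ContDiffBump (0 : ℝ) := ⟨1, 2, one_pos, one_lt_two⟩
  let f : ℝ → ℂ := fun x => Complex.exp (k * x * Complex.I) * (b x : ℂ)
  have hb : ContDiff ℝ ∞ fun x : ℝ => (b x : ℂ) := Complex.ofRealCLM.contDiff.comp b.contDiff
  have hf : ContDiff ℝ ∞ f := by
    refine ContDiff.mul ?_ hb
    exact ((contDiff_const.mul Complex.ofRealCLM.contDiff).mul contDiff_const).cexp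
  have hc : HasCompactSupport f := by
    have h : HasCompactSupport fun x : ℝ => (b x : ℂ) :=
      b.hasCompactSupport.comp_left Complex.ofReal_zero
    exact h.mul_left
  let φ : 𝓢(ℝ, ℂ) := hc.toSchwartzMap hf
  have hφ : ∀ x, φ x = f x := fun x => rfl
  have hn : ∀ x : ℝ, ‖Complex.exp (k * x * Complex.I)‖ = 1 := fun x => by
    rw [← Complex.ofReal_mul, Complex.norm_exp_ofReal_mul_I]
  refine ⟨φ, fun h0 => ?_, ?_⟩
  · have h1 : φ = 0 := by
      refine SchwartzMap.injective_toLp 2 (volume : Measure ℝ) ?_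
      change toL2 φ = toL2 0
      rw [h0]
      exact (map_zero (SchwartzMap.toLpCLM ℂ ℂ 2 (volume : Measure ℝ))).symm
    have h2 := hφ 0
    rw [h1] at h2
    have h3 : b 0 = 1 := b.one_of_mem_closedBall (by simp [b])
    simp [f, h3] at h2
  · have hd : ∀ x, deriv φ x = Complex.exp (k * x * Complex.I) *
        ((deriv b x : ℝ) + (k * b x : ℝ) * Complex.I) := fun x => by
      have h1 : HasDerivAt (fun x : ℝ => Complex.exp (k * x * Complex.I))
          (Complex.exp (k * x * Complex.I) * (k * Complex.I)) x := by
        have h := (((hasDerivAt_id x).ofReal_comp.const_mul (k : ℂ)).mul_const Complex.I).cexp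
        simpa using h
      have h2 : HasDerivAt (fun x : ℝ => (b x : ℂ)) (deriv b x : ℝ) x :=
        ((b.contDiff (n := 1)).differentiable one_ne_zero x).hasDerivAt.ofReal_comp
      have h3 := (h1.mul h2).deriv
      change deriv f x = _
      refine h3.trans ?_
      push_cast
      ring
    have key := norm_toL2_le (φ := φ) (ψ := SchwartzMap.derivCLM ℂ ℂ φ) (c := k⁻¹) fun x => by
      rw [SchwartzMap.derivCLM_apply, hd, hφ, norm_mul, norm_mul, hn, one_mul, one_mul,
        inv_mul_eq_div, le_div_iff₀ hk, Complex.norm_real]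
      refine le_trans ?_ (Complex.abs_im_le_norm _)
      simp [abs_of_pos hk, mul_comm]
    rwa [inv_mul_eq_div, le_div_iff₀ hk, mul_comm] at key

theorem exists_mem_spec_hill_gt (M : ℝ) : ∃ x : ℝ, M < x ∧ (x : ℂ) ∈ spec (hill U) := by
  by_contra! h
  have hM : ∀ x : ℝ, (x : ℂ) ∈ spec (hill U) → x ≤ |M| := fun x hx => by
    by_contra! hlt
    exact h x ((le_abs_self M).trans_lt hlt) hx
  -- Here `k = |M| + ‖U.mul‖ + 1 ≥ 1`, so the kinetic energy is at least `k² ‖φ‖²`, which exceeds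
  -- `(|M| + ‖U.mul‖) ‖φ‖²`.
  obtain ⟨φ, h0, hφ⟩ := exists_schwartz_deriv_large (|M| + ‖U.mul‖ + 1) (by positivity)
  have h1 := re_inner_le_of_spec_le (isSelfAdjoint_hill U) hM ⟨toL2 φ, toL2_mem φ⟩
  rw [hill_toL2, inner_add_right, inner_neg_right, Complex.add_re, Complex.neg_re,
    re_inner_schwartzDeriv2_self, neg_neg] at h1
  have h2 := abs_le.mp (abs_re_inner_mul_le U (toL2 φ))
  have h3 : 0 < ‖toL2 φ‖ := norm_pos_iff.mpr h0
  have h4 := pow_le_pow_left₀ (by positivity) hφ 2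
  have h5 : 0 < ‖toL2 φ‖ ^ 2 := by positivity
  have h6 : 0 ≤ |M| := abs_nonneg M
  have h7 : 0 ≤ ‖U.mul‖ := norm_nonneg _
  rw [mul_pow] at h4
  dsimp only at h1
  nlinarith [mul_nonneg (add_nonneg h6 h7) h5.le, mul_nonneg (mul_nonneg (add_nonneg h6 h7) (add_nonneg h6 h7)) h5.le]

end RealPlace

/-! ### Global solutions of linear differential equations, analytic in a parameter. -/

namespace LinearODE

open BoundedContinuousFunction

variable {E : Type*} [NormedAddCommGroup E] [NormedSpace ℝ E]

/-- The weight turns the Volterra operator on the whole line into one of norm at most `C / κ`,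
because `∫₀ˣ cosh (κ t) dt = sinh (κ x) / κ` and `|sinh| ≤ cosh`. -/
theorem norm_volterra_le {a : ℝ → E →L[ℝ] E} {C κ : ℝ} (hC : ∀ t, ‖a t‖ ≤ C) (hκ : 0 < κ)
    (F : ℝ →ᵇ E) (x : ℝ) :
    ‖(Real.cosh (κ * x))⁻¹ • ∫ t in (0 : ℝ)..x, Real.cosh (κ * t) • a t (F t)‖ ≤
      C / κ * ‖F‖ := by
  have hC0 : 0 ≤ C := (norm_nonneg _).trans (hC 0)
  have h1 : ‖∫ t in (0 : ℝ)..x, Real.cosh (κ * t) • a t (F t)‖ ≤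
      |∫ t in (0 : ℝ)..x, Real.cosh (κ * t) * (C * ‖F‖)| := by
    refine intervalIntegral.norm_integral_le_abs_of_norm_le (Eventually.of_forall fun t => ?_)
      (Continuous.intervalIntegrable (by fun_prop) _ _)
    rw [norm_smul, Real.norm_eq_abs, abs_of_pos (Real.cosh_pos _)]
    refine mul_le_mul_of_nonneg_left ?_ (Real.cosh_pos _).le
    exact ((a t).le_opNorm _).trans (mul_le_mul (hC t) (F.norm_coe_le_norm t) (norm_nonneg _) hC0)
  have h2 : ∫ t in (0 : ℝ)..x, Real.cosh (κ * t) * (C * ‖F‖) =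
      Real.sinh (κ * x) / κ * (C * ‖F‖) := by
    rw [intervalIntegral.integral_mul_const]
    congr 1
    have hd : ∀ t ∈ Set.uIcc 0 x,
        HasDerivAt (fun t => Real.sinh (κ * t) / κ) (Real.cosh (κ * t)) t := fun t _ => by
      have h := (((hasDerivAt_id t).const_mul κ).sinh).div_const κ
      exact h.congr_deriv (by simp [hκ.ne'])
    rw [intervalIntegral.integral_eq_sub_of_hasDerivAt hd
      (Continuous.intervalIntegrable (by fun_prop) _ _)]
    simp
  have h3 : |Real.sinh (κ * x)| ≤ Real.cosh (κ * x) := by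
    rw [← Real.cosh_abs, Real.abs_sinh]
    exact (Real.sinh_lt_cosh _).le
  rw [h2, abs_mul, abs_div, abs_of_pos hκ, abs_of_nonneg (show 0 ≤ C * ‖F‖ by positivity)] at h1
  rw [norm_smul, norm_inv, Real.norm_eq_abs, abs_of_pos (Real.cosh_pos _),
    inv_mul_le_iff₀ (Real.cosh_pos _)]
  refine h1.trans ?_
  rw [div_mul_eq_mul_div, div_mul_eq_mul_div, mul_div_assoc']
  gcongr

theorem continuous_volterra {a : ℝ → E →L[ℝ] E} (ha : Continuous a) (κ : ℝ) (F : ℝ →ᵇ E) :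
    Continuous fun x =>
      (Real.cosh (κ * x))⁻¹ • ∫ t in (0 : ℝ)..x, Real.cosh (κ * t) • a t (F t) := by
  refine Continuous.smul (Continuous.inv₀ (by fun_prop) fun x => (Real.cosh_pos _).ne') ?_
  exact intervalIntegral.continuous_primitive
    (fun x y => Continuous.intervalIntegrable (by fun_prop) _ _) 0

/-- The Volterra operator `F ↦ ∫₀ˣ a F`, conjugated by the weight `cosh (κ x)`. -/
def volterra {a : ℝ → E →L[ℝ] E} (ha : Continuous a) {C κ : ℝ} (hC : ∀ t, ‖a t‖ ≤ C)
    (hκ : 0 < κ) : (ℝ →ᵇ E) →L[ℝ] (ℝ →ᵇ E) :=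
  LinearMap.mkContinuous
    { toFun := fun F => BoundedContinuousFunction.ofNormedAddCommGroup _
        (continuous_volterra ha κ F) _ (norm_volterra_le hC hκ F)
      map_add' := fun F G => by
        ext x
        change (Real.cosh (κ * x))⁻¹ • ∫ t in (0 : ℝ)..x, Real.cosh (κ * t) • a t ((F + G) t) =
          (Real.cosh (κ * x))⁻¹ • (∫ t in (0 : ℝ)..x, Real.cosh (κ * t) • a t (F t)) +
          (Real.cosh (κ * x))⁻¹ • ∫ t in (0 : ℝ)..x, Real.cosh (κ * t) • a t (G t)
        rw [← smul_add, ← intervalIntegral.integral_add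
          (Continuous.intervalIntegrable (by fun_prop) _ _)
          (Continuous.intervalIntegrable (by fun_prop) _ _)]
        simp only [BoundedContinuousFunction.add_apply, map_add, smul_add]
      map_smul' := fun c F => by
        ext x
        change (Real.cosh (κ * x))⁻¹ • ∫ t in (0 : ℝ)..x, Real.cosh (κ * t) • a t ((c • F) t) =
          c • (Real.cosh (κ * x))⁻¹ • (∫ t in (0 : ℝ)..x, Real.cosh (κ * t) • a t (F t))
        rw [smul_comm c, ← intervalIntegral.integral_smul c]
        congr 2
        ext t
        rw [BoundedContinuousFunction.coe_smul, map_smul, smul_comm c] }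
    (C / κ) fun F => by
      have hC0 : 0 ≤ C := (norm_nonneg _).trans (hC 0)
      exact BoundedContinuousFunction.norm_ofNormedAddCommGroup_le _ (by positivity)
        (norm_volterra_le hC hκ F)

theorem volterra_apply {a : ℝ → E →L[ℝ] E} (ha : Continuous a) {C κ : ℝ} (hC : ∀ t, ‖a t‖ ≤ C)
    (hκ : 0 < κ) (F : ℝ →ᵇ E) (x : ℝ) : volterra ha hC hκ F x =
      (Real.cosh (κ * x))⁻¹ • ∫ t in (0 : ℝ)..x, Real.cosh (κ * t) • a t (F t) := rfl

theorem norm_volterra_opNorm_le {a : ℝ → E →L[ℝ] E} (ha : Continuous a) {C κ : ℝ}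
    (hC : ∀ t, ‖a t‖ ≤ C) (hκ : 0 < κ) : ‖volterra ha hC hκ‖ ≤ C / κ :=
  LinearMap.mkContinuous_norm_le _
    (div_nonneg ((norm_nonneg _).trans (hC 0)) hκ.le) _

/-- The weighted constant function `y₀ / cosh (κ x)`. -/
def weightedConst (κ : ℝ) (y₀ : E) : ℝ →ᵇ E :=
  BoundedContinuousFunction.ofNormedAddCommGroup (fun x => (Real.cosh (κ * x))⁻¹ • y₀)
    (Continuous.smul (Continuous.inv₀ (by fun_prop) fun x => (Real.cosh_pos _).ne')
      continuous_const) ‖y₀‖ fun x => by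
    rw [norm_smul, norm_inv, Real.norm_eq_abs, abs_of_pos (Real.cosh_pos _)]
    exact mul_le_of_le_one_left (norm_nonneg _) (inv_le_one_of_one_le₀ (Real.one_le_cosh _))

theorem solution_unique {A : ℝ → E →L[ℝ] E} {C : ℝ} (hC : ∀ t, ‖A t‖ ≤ C) {f g : ℝ → E}
    (hf : ∀ x, HasDerivAt f (A x (f x)) x) (hg : ∀ x, HasDerivAt g (A x (g x)) x)
    (h : f 0 = g 0) : f = g := by
  refine ODE_solution_unique_univ (v := fun t y => A t y) (s := fun _ => Set.univ) (t₀ := 0)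
    (K := Real.toNNReal C) (fun t => ?_) (fun t => ⟨hf t, trivial⟩) (fun t => ⟨hg t, trivial⟩) h
  refine LipschitzWith.lipschitzOnWith ((A t).lipschitz.weaken ?_)
  rw [← NNReal.coe_le_coe, coe_nnnorm]
  exact (hC t).trans (Real.le_coe_toNNReal C)

variable [CompleteSpace E]

/-- Global solutions of `Y' = (a + l b) Y`, analytic in `l` for `|l| < R`. -/
theorem exists_solution_of_abs_lt {a b : ℝ → E →L[ℝ] E} (ha : Continuous a) (hb : Continuous b)
    {C D : ℝ} (hC : ∀ t, ‖a t‖ ≤ C) (hD : ∀ t, ‖b t‖ ≤ D) (y₀ : E) (R : ℝ) :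
    ∃ Y : ℝ → ℝ → E, (∀ l, |l| < R → Y l 0 = y₀ ∧
        ∀ x, HasDerivAt (Y l) ((a x + l • b x) (Y l x)) x) ∧
      ∀ x l, |l| < R → AnalyticAt ℝ (fun l => Y l x) l := by
  have hC0 : 0 ≤ C := (norm_nonneg _).trans (hC 0)
  have hD0 : 0 ≤ D := (norm_nonneg _).trans (hD 0)
  -- This `κ` makes `‖T l‖ < 1` for all `|l| < R`. Then `1 - T l` is invertible, and analyticity in
  -- `l` follows from analyticity of inversion.
  set κ := C + |R| * D + 1 with hκd
  have hκ : 0 < κ := by positivity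
  let T : ℝ → (ℝ →ᵇ E) →L[ℝ] (ℝ →ᵇ E) := fun l => volterra ha hC hκ + l • volterra hb hD hκ
  have hTn : ∀ l, |l| < R → ‖T l‖ < 1 := fun l hl => by
    have h1 := norm_volterra_opNorm_le ha hC hκ
    have h2 := norm_volterra_opNorm_le hb hD hκ
    calc ‖T l‖ ≤ C / κ + |l| * (D / κ) := by
          refine (norm_add_le _ _).trans (add_le_add h1 ?_)
          rw [norm_smul, Real.norm_eq_abs]
          gcongr
      _ ≤ C / κ + |R| * (D / κ) := by
          have := mul_le_mul_of_nonneg_right (hl.le.trans (le_abs_self R))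
            (div_nonneg hD0 hκ.le)
          linarith
      _ = (C + |R| * D) / κ := by ring
      _ < 1 := by rw [div_lt_one hκ]; linarith
  have hu : ∀ l, |l| < R → IsUnit (1 - T l) := fun l hl =>
    isUnit_one_sub_of_norm_lt_one (hTn l hl)
  let W : ℝ → ℝ →ᵇ E := fun l => Ring.inverse (1 - T l) (weightedConst κ y₀)
  have hW : ∀ l, |l| < R → ∀ x, W l x = (Real.cosh (κ * x))⁻¹ •
      (y₀ + ∫ t in (0 : ℝ)..x, Real.cosh (κ * t) • (a t + l • b t) (W l t)) := by
    intro l hl x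
    have h1 : (1 - T l) (W l) = weightedConst κ y₀ := by
      have := Ring.mul_inverse_cancel _ (hu l hl)
      exact congrArg (fun S : (ℝ →ᵇ E) →L[ℝ] (ℝ →ᵇ E) => S (weightedConst κ y₀)) this
    have h2 : W l = weightedConst κ y₀ + T l (W l) := by
      rw [← h1]
      exact (sub_add_cancel (W l) (T l (W l))).symm
    have h3 : W l x = (Real.cosh (κ * x))⁻¹ • y₀ +
        (volterra ha hC hκ (W l) x + l • volterra hb hD hκ (W l) x) :=
      congrArg (fun F : ℝ →ᵇ E => F x) h2
    rw [h3, volterra_apply, volterra_apply, smul_comm l, ← smul_add, ← smul_add,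
      ← intervalIntegral.integral_smul, ← intervalIntegral.integral_add
          (Continuous.intervalIntegrable (by fun_prop) _ _)
          (Continuous.intervalIntegrable (by fun_prop) _ _)]
    congr 3
    ext t
    change _ = Real.cosh (κ * t) • (a t (W l t) + l • b t (W l t))
    rw [smul_add, smul_comm l]
  refine ⟨fun l x => Real.cosh (κ * x) • W l x, fun l hl => ?_, fun x l hl => ?_⟩
  · have hY : ∀ x, Real.cosh (κ * x) • W l x = y₀ + ∫ t in (0 : ℝ)..x,
        (a t + l • b t) (Real.cosh (κ * t) • W l t) := fun x => by
      rw [hW l hl x, smul_inv_smul₀ (Real.cosh_pos _).ne']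
      simp only [map_smul]
    refine ⟨?_, fun x => ?_⟩
    · exact (hY 0).trans (by rw [intervalIntegral.integral_same, add_zero])
    · have hc : Continuous fun t => (a t + l • b t) (Real.cosh (κ * t) • W l t) := by fun_prop
      have h := (intervalIntegral.integral_hasDerivAt_right (hc.intervalIntegrable 0 x)
        hc.aestronglyMeasurable.stronglyMeasurableAtFilter hc.continuousAt).const_add y₀
      exact h.congr_of_eventuallyEq (Eventually.of_forall hY)
  · have h1 : AnalyticAt ℝ (fun l => 1 - T l) l := by
      have : AnalyticAt ℝ T l := analyticAt_const.add (analyticAt_id.smul analyticAt_const)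
      exact analyticAt_const.sub this
    have h2 : AnalyticAt ℝ (fun l => Ring.inverse (1 - T l)) l := by
      obtain ⟨u, hu'⟩ := hu l hl
      have h3 := analyticAt_inverse (𝕜 := ℝ) u
      rw [hu'] at h3
      exact AnalyticAt.comp (f := fun l => 1 - T l) h3 h1
    let ev : ((ℝ →ᵇ E) →L[ℝ] (ℝ →ᵇ E)) →L[ℝ] E :=
      (BoundedContinuousFunction.evalCLM ℝ x).comp
        (ContinuousLinearMap.apply ℝ (ℝ →ᵇ E) (weightedConst κ y₀))
    have h4 : AnalyticAt ℝ (fun l => ev (Ring.inverse (1 - T l))) l :=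
      (ev.analyticAt _).comp h2
    exact h4.const_smul

/-- Global solutions of `Y' = (a + l b) Y`, analytic in the parameter `l`. -/
theorem exists_solution {a b : ℝ → E →L[ℝ] E} (ha : Continuous a) (hb : Continuous b)
    {C D : ℝ} (hC : ∀ t, ‖a t‖ ≤ C) (hD : ∀ t, ‖b t‖ ≤ D) (y₀ : E) :
    ∃ Y : ℝ → ℝ → E, (∀ l, Y l 0 = y₀ ∧ ∀ x, HasDerivAt (Y l) ((a x + l • b x) (Y l x)) x) ∧
      ∀ x l, AnalyticAt ℝ (fun l => Y l x) l := by
  choose Z hZ1 hZ2 using exists_solution_of_abs_lt ha hb hC hD y₀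
  have hZu : ∀ R S l, |l| < R → |l| < S → Z R l = Z S l := fun R S l hR hS => by
    refine solution_unique (A := fun x => a x + l • b x) (C := C + |l| * D) (fun t => ?_)
      (hZ1 R l hR).2 (hZ1 S l hS).2 ((hZ1 R l hR).1.trans (hZ1 S l hS).1.symm)
    refine (norm_add_le _ _).trans (add_le_add (hC t) ?_)
    rw [norm_smul, Real.norm_eq_abs]
    exact mul_le_mul_of_nonneg_left (hD t) (abs_nonneg l)
  -- The radius varies with `l`, but by uniqueness all admissible radii give the same solution, so
  -- near `l` one fixed radius can be used.
  refine ⟨fun l => Z (|l| + 1) l, fun l => hZ1 _ l (by linarith), fun x l => ?_⟩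
  refine (hZ2 (|l| + 1) x l (by linarith)).congr ?_
  have : ∀ᶠ m in nhds l, |m| < |l| + 1 :=
    (continuous_abs.tendsto l).eventually_lt_const (by linarith)
  filter_upwards [this] with m hm
  rw [hZu (|l| + 1) (|m| + 1) m hm (by linarith)]

/-- Solutions of `-y'' + V y = l y` with given initial values, analytic in `l`. -/
theorem exists_hillSolution {V : ℝ → ℝ} (hV : Continuous V) {C : ℝ} (hC : ∀ t, |V t| ≤ C)
    (y₀ v₀ : ℝ) : ∃ y v : ℝ → ℝ → ℝ, (∀ l, y l 0 = y₀ ∧ v l 0 = v₀ ∧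
      ∀ x, HasDerivAt (y l) (v l x) x ∧ HasDerivAt (v l) ((V x - l) * y l x) x) ∧
      ∀ x l, AnalyticAt ℝ (fun l => y l x) l ∧ AnalyticAt ℝ (fun l => v l x) l := by
  -- The first-order system for `(y, y')`: `P (y, v) = (v, 0)` and `Q (y, v) = (0, y)`, with
  -- coefficient `P + V Q - l Q`.
  let P : ℝ × ℝ →L[ℝ] ℝ × ℝ :=
    (ContinuousLinearMap.inl ℝ ℝ ℝ).comp (ContinuousLinearMap.snd ℝ ℝ ℝ)
  let Q : ℝ × ℝ →L[ℝ] ℝ × ℝ :=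
    (ContinuousLinearMap.inr ℝ ℝ ℝ).comp (ContinuousLinearMap.fst ℝ ℝ ℝ)
  obtain ⟨Y, h1, h2⟩ := exists_solution (a := fun t => P + V t • Q) (b := fun _ => -Q)
    (C := ‖P‖ + C * ‖Q‖) (D := ‖Q‖) (by fun_prop) continuous_const (fun t => by
      refine (norm_add_le _ _).trans (add_le_add le_rfl ?_)
      rw [norm_smul, Real.norm_eq_abs]
      exact mul_le_mul_of_nonneg_right (hC t) (norm_nonneg _)) (fun t => (norm_neg Q).le) (y₀, v₀)
  refine ⟨fun l x => (Y l x).1, fun l x => (Y l x).2, fun l => ⟨by simp [(h1 l).1],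
    by simp [(h1 l).1], fun x => ?_⟩, fun x l => ?_⟩
  · have h := (h1 l).2 x
    have e1 := (ContinuousLinearMap.fst ℝ ℝ ℝ).hasFDerivAt.comp_hasDerivAt x h
    have e2 := (ContinuousLinearMap.snd ℝ ℝ ℝ).hasFDerivAt.comp_hasDerivAt x h
    constructor
    · exact e1.congr_deriv (by simp [P, Q])
    · exact e2.congr_deriv (by simp [P, Q]; ring)
  · exact ⟨((ContinuousLinearMap.fst ℝ ℝ ℝ).analyticAt _).comp (h2 x l),
      ((ContinuousLinearMap.snd ℝ ℝ ℝ).analyticAt _).comp (h2 x l)⟩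

end LinearODE

/-! ### Floquet solutions, the discriminant and energy estimates. -/

namespace RealPlace

open UnboundedOp

variable {L : ℝ} (U : EvenPeriodicPotential L)

theorem EvenPeriodicPotential.exists_bound : ∃ C, ∀ x, |U.toFun x| ≤ C := by
  obtain ⟨C, hC⟩ :=
    (U.periodic.isBounded_of_continuous U.period_pos.ne' U.smooth.continuous).exists_norm_le
  exact ⟨C, fun x => hC _ ⟨x, rfl⟩⟩

/-- `ψ` with derivative `ψ'` solves `-ψ'' + U ψ = l ψ`. -/
structure IsSolution (l : ℝ) (ψ ψ' : ℝ → ℂ) : Prop where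
  hasDerivAt : ∀ x, HasDerivAt ψ (ψ' x) x
  hasDerivAt' : ∀ x, HasDerivAt ψ' (((U.toFun x - l : ℝ) : ℂ) * ψ x) x

/-- A nonzero solution with `ψ (x + L) = ρ ψ x`. -/
structure IsFloquet (l : ℝ) (ρ : ℂ) (ψ ψ' : ℝ → ℂ) : Prop extends IsSolution U l ψ ψ' where
  shift : ∀ x, ψ (x + L) = ρ * ψ x
  shift' : ∀ x, ψ' (x + L) = ρ * ψ' x
  ne_zero : ψ 0 ≠ 0 ∨ ψ' 0 ≠ 0

variable {U} {l : ℝ} {ψ ψ' φ φ' : ℝ → ℂ}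

theorem IsSolution.continuous (h : IsSolution U l ψ ψ') : Continuous ψ :=
  continuous_iff_continuousAt.mpr fun x => (h.hasDerivAt x).continuousAt

theorem IsSolution.continuous' (h : IsSolution U l ψ ψ') : Continuous ψ' :=
  continuous_iff_continuousAt.mpr fun x => (h.hasDerivAt' x).continuousAt

theorem IsSolution.const_mul (h : IsSolution U l ψ ψ') (c : ℂ) :
    IsSolution U l (fun x => c * ψ x) fun x => c * ψ' x where
  hasDerivAt x := (h.hasDerivAt x).const_mul c
  hasDerivAt' x := ((h.hasDerivAt' x).const_mul c).congr_deriv (by ring)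

theorem IsSolution.add (h : IsSolution U l ψ ψ') (h' : IsSolution U l φ φ') :
    IsSolution U l (fun x => ψ x + φ x) fun x => ψ' x + φ' x where
  hasDerivAt x := (h.hasDerivAt x).add (h'.hasDerivAt x)
  hasDerivAt' x := ((h.hasDerivAt' x).add (h'.hasDerivAt' x)).congr_deriv (by ring)

theorem IsSolution.comp_add_period (h : IsSolution U l ψ ψ') :
    IsSolution U l (fun x => ψ (x + L)) fun x => ψ' (x + L) where
  hasDerivAt x := (h.hasDerivAt (x + L)).comp_add_const x L
  hasDerivAt' x := by
    have := (h.hasDerivAt' (x + L)).comp_add_const x L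
    rwa [U.periodic x] at this

theorem IsSolution.unique (h : IsSolution U l ψ ψ') (h' : IsSolution U l φ φ') (h0 : ψ 0 = φ 0)
    (h0' : ψ' 0 = φ' 0) (x : ℝ) : ψ x = φ x ∧ ψ' x = φ' x := by
  obtain ⟨C, hC⟩ := U.exists_bound
  let P : ℂ × ℂ →L[ℝ] ℂ × ℂ :=
    (ContinuousLinearMap.inl ℝ ℂ ℂ).comp (ContinuousLinearMap.snd ℝ ℂ ℂ)
  let Q : ℂ × ℂ →L[ℝ] ℂ × ℂ :=
    (ContinuousLinearMap.inr ℝ ℂ ℂ).comp (ContinuousLinearMap.fst ℝ ℂ ℂ)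
  have key : ∀ {χ χ' : ℝ → ℂ}, IsSolution U l χ χ' → ∀ x, HasDerivAt (fun x => (χ x, χ' x))
      ((P + (U.toFun x - l) • Q) (χ x, χ' x)) x := fun hχ x => by
    refine ((hχ.hasDerivAt x).prodMk (hχ.hasDerivAt' x)).congr_deriv ?_
    simp [P, Q]
  have := LinearODE.solution_unique (A := fun x => P + (U.toFun x - l) • Q)
    (C := ‖P‖ + (C + |l|) * ‖Q‖) (fun t => by
      refine (norm_add_le _ _).trans (add_le_add le_rfl ?_)
      rw [norm_smul, Real.norm_eq_abs]
      refine mul_le_mul_of_nonneg_right ((abs_sub _ _).trans ?_) (norm_nonneg _)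
      linarith [hC t]) (key h) (key h') (by rw [h0, h0'])
  have hx := congrFun this x
  exact ⟨congrArg Prod.fst hx, congrArg Prod.snd hx⟩

theorem IsSolution.wronskian_const (h : IsSolution U l ψ ψ') (h' : IsSolution U l φ φ') (x : ℝ) :
    ψ x * φ' x - ψ' x * φ x = ψ 0 * φ' 0 - ψ' 0 * φ 0 := by
  have hd : ∀ x, HasDerivAt (fun x => ψ x * φ' x - ψ' x * φ x) 0 x := fun x =>
    (((h.hasDerivAt x).mul (h'.hasDerivAt' x)).sub
      ((h.hasDerivAt' x).mul (h'.hasDerivAt x))).congr_deriv (by ring)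
  exact is_const_of_deriv_eq_zero (fun x => (hd x).differentiableAt) (fun x => (hd x).deriv) x 0

theorem IsSolution.contDiff (h : IsSolution U l ψ ψ') : ContDiff ℝ ∞ ψ := by
  have key : ∀ n : ℕ, ContDiff ℝ n ψ ∧ ContDiff ℝ n ψ' := by
    intro n
    induction n with
    | zero => exact ⟨contDiff_zero.mpr h.continuous, contDiff_zero.mpr h.continuous'⟩
    | succ n ih =>
      have e1 : deriv ψ = ψ' := funext fun x => (h.hasDerivAt x).deriv
      have e2 : deriv ψ' = fun x => ((U.toFun x - l : ℝ) : ℂ) * ψ x :=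
        funext fun x => (h.hasDerivAt' x).deriv
      have hU : ContDiff ℝ n fun x => ((U.toFun x - l : ℝ) : ℂ) :=
        Complex.ofRealCLM.contDiff.comp
          ((U.smooth.of_le (by exact_mod_cast le_top)).sub contDiff_const)
      push_cast
      rw [contDiff_succ_iff_deriv, contDiff_succ_iff_deriv, e1, e2]
      exact ⟨⟨fun x => (h.hasDerivAt x).differentiableAt, by simp, ih.2⟩,
        fun x => (h.hasDerivAt' x).differentiableAt, by simp, hU.mul ih.1⟩
  exact contDiff_infty.mpr fun n => (key n).1

variable (U) in
/-- The discriminant of Hill's equation: an analytic function of the energy whose value is the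
trace of the monodromy matrix, which has determinant one. -/
theorem exists_discriminant : ∃ Δ : ℝ → ℝ, AnalyticOnNhd ℝ Δ Set.univ ∧
    ∀ (l : ℝ) (ρ : ℂ), ρ ^ 2 - Δ l * ρ + 1 = 0 → ∃ ψ ψ', IsFloquet U l ρ ψ ψ' := by
  obtain ⟨C, hC⟩ := U.exists_bound
  obtain ⟨c, c', hc, hca⟩ := LinearODE.exists_hillSolution U.smooth.continuous hC 1 0
  obtain ⟨s, s', hs, hsa⟩ := LinearODE.exists_hillSolution U.smooth.continuous hC 0 1
  refine ⟨fun l => c l L + s' l L, fun l _ => (hca L l).1.add (hsa L l).2, fun l ρ hρ => ?_⟩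
  have hC' : IsSolution U l (fun x => (c l x : ℂ)) fun x => (c' l x : ℂ) :=
    ⟨fun x => ((hc l).2.2 x).1.ofReal_comp, fun x =>
      (((hc l).2.2 x).2.ofReal_comp).congr_deriv (by push_cast; ring)⟩
  have hS' : IsSolution U l (fun x => (s l x : ℂ)) fun x => (s' l x : ℂ) :=
    ⟨fun x => ((hs l).2.2 x).1.ofReal_comp, fun x =>
      (((hs l).2.2 x).2.ofReal_comp).congr_deriv (by push_cast; ring)⟩
  have hW := hC'.wronskian_const hS' L
  simp only [(hc l).1, (hc l).2.1, (hs l).1, (hs l).2.1] at hW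
  -- The monodromy matrix has determinant one by constancy of the Wronskian, so its characteristic
  -- polynomial is `ρ² - Δ ρ + 1`. An eigenvector supplies the initial data of a Floquet solution.
  obtain ⟨v, hv0, hv⟩ := Matrix.exists_mulVec_eq_zero_iff.mpr
    (show Matrix.det !![(c l L : ℂ) - ρ, s l L; c' l L, s' l L - ρ] = 0 by
      rw [Matrix.det_fin_two_of]
      push_cast at hρ hW
      linear_combination hρ + hW)
  have hv1 := congrFun hv 0
  have hv2 := congrFun hv 1
  simp [Matrix.mulVec, dotProduct, Fin.sum_univ_two] at hv1 hv2
  have hψ := (hC'.const_mul (v 0)).add (hS'.const_mul (v 1))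
  have hu := fun x => hψ.comp_add_period.unique (hψ.const_mul ρ)
    (by simp [(hc l).1, (hs l).1]; linear_combination hv1)
    (by simp [(hc l).2.1, (hs l).2.1]; linear_combination hv2) x
  refine ⟨_, _, hψ, fun x => (hu x).1, fun x => (hu x).2, ?_⟩
  by_contra! h
  simp [(hc l).1, (hs l).1, (hc l).2.1, (hs l).2.1] at h
  exact hv0 (by ext i; fin_cases i <;> simp [h.1, h.2])

/-- Quasi-periodic functions are bounded after multiplication by an exponential. -/
theorem exists_bound_of_quasiperiodic {f : ℝ → ℂ} (hf : Continuous f) (hL : 0 < L) {ρ : ℂ}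
    (hs : ∀ x, f (x + L) = ρ * f x) {m : ℝ} (hm : Real.exp (m * L) * ‖ρ‖ = 1) :
    ∃ B, ∀ x, Real.exp (m * x) * ‖f x‖ ≤ B := by
  have hp : Function.Periodic (fun x => Real.exp (m * x) * ‖f x‖) L := fun x => by
    simp only
    rw [hs, norm_mul, mul_add, Real.exp_add]
    linear_combination (Real.exp (m * x) * ‖f x‖) * hm
  obtain ⟨B, hB⟩ := (hp.isBounded_of_continuous hL.ne' (by fun_prop)).exists_norm_le
  exact ⟨B, fun x => (le_abs_self _).trans (hB _ ⟨x, rfl⟩)⟩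

/-- The energy estimate `m² ∫ |w|² ≤ ∫ |h|²` for `w' = m w + h`. -/
theorem energy_estimate {w h : ℝ → ℂ} {m : ℝ} (hd : ∀ x, HasDerivAt w (m * w x + h x) x)
    (hh : Continuous h) (hw2 : Integrable fun x => ‖w x‖ ^ 2)
    (hh2 : Integrable fun x => ‖h x‖ ^ 2) :
    m ^ 2 * ∫ x, ‖w x‖ ^ 2 ≤ ∫ x, ‖h x‖ ^ 2 := by
  have hwc : Continuous w := continuous_iff_continuousAt.mpr fun x => (hd x).continuousAt
  have hd2 : ∀ x, HasDerivAt (fun x => ‖w x‖ ^ 2)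
      (2 * (m * ‖w x‖ ^ 2 + ⟪w x, h x⟫_ℝ)) x := fun x => by
    refine (hd x).norm_sq.congr_deriv ?_
    rw [inner_add_right, ← Complex.real_smul, real_inner_smul_right, real_inner_self_eq_norm_sq]
  have hi : Integrable fun x => ⟪w x, h x⟫_ℝ := by
    refine (hw2.add hh2).mono' (hwc.inner hh).aestronglyMeasurable (Eventually.of_forall fun x => ?_)
    refine (norm_inner_le_norm _ _).trans ?_
    simp only [Pi.add_apply]
    nlinarith [sq_nonneg (‖w x‖ - ‖h x‖), sq_nonneg (‖w x‖ + ‖h x‖)]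
  have hi2 : Integrable fun x => 2 * (m * ‖w x‖ ^ 2 + ⟪w x, h x⟫_ℝ) :=
    ((hw2.const_mul m).add hi).const_mul 2
  have h0 := integral_eq_zero_of_hasDerivAt_of_integrable hd2 hi2 hw2
  -- The right-hand integral is `m` times the integral of `(‖w‖²)'`, hence zero. The pointwise
  -- inequality comes from `(|m| ‖w‖ - ‖h‖)² ≥ 0`.
  have h1 : ∫ x, (m ^ 2 * ‖w x‖ ^ 2 - ‖h x‖ ^ 2) ≤
      ∫ x, m * (2 * (m * ‖w x‖ ^ 2 + ⟪w x, h x⟫_ℝ)) := by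
    refine integral_mono ((hw2.const_mul _).sub hh2) (hi2.const_mul m) fun x => ?_
    have := abs_le.mp (abs_real_inner_le_norm (w x) (h x))
    have h3 : -(|m| * (‖w x‖ * ‖h x‖)) ≤ m * ⟪w x, h x⟫_ℝ := by
      have := neg_abs_le (m * ⟪w x, h x⟫_ℝ)
      rw [abs_mul] at this
      have h4 := mul_le_mul_of_nonneg_left (abs_real_inner_le_norm (w x) (h x)) (abs_nonneg m)
      linarith
    simp only
    nlinarith [sq_nonneg (|m| * ‖w x‖ - ‖h x‖), sq_abs m]
  rw [integral_const_mul, h0, mul_zero, integral_sub (hw2.const_mul _) hh2,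
    integral_const_mul] at h1
  linarith

theorem norm_sq_eq_integral {u : L2R} {f : ℝ → ℂ} (h : u =ᵐ[volume] f) :
    ‖u‖ ^ 2 = ∫ x, ‖f x‖ ^ 2 := by
  have h1 : ((‖u‖ ^ 2 : ℝ) : ℂ) = ((∫ x, ‖f x‖ ^ 2 : ℝ) : ℂ) := by
    rw [← integral_complex_ofReal]
    have := inner_self_eq_norm_sq_to_K (𝕜 := ℂ) u
    push_cast
    refine this.symm.trans ?_
    rw [L2.inner_def]
    refine integral_congr_ae ?_
    filter_upwards [h] with x hx
    rw [hx, inner_self_eq_norm_sq_to_K]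
    simp
  exact_mod_cast h1

variable (U) in
theorem hill_sub_toL2_ae (f : 𝓢(ℝ, ℂ)) (l : ℝ) :
    hill U ⟨toL2 f, toL2_mem f⟩ - (l : ℂ) • toL2 f =ᵐ[volume]
      fun x => -schwartzDeriv2 f x + ((U.toFun x - l : ℝ) : ℂ) * f x := by
  rw [hill_toL2]
  filter_upwards [Lp.coeFn_sub (-toL2 (schwartzDeriv2 f) + U.mul (toL2 f)) ((l : ℂ) • toL2 f),
    Lp.coeFn_add (-toL2 (schwartzDeriv2 f)) (U.mul (toL2 f)), Lp.coeFn_neg (toL2 (schwartzDeriv2 f)),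
    Lp.coeFn_smul (l : ℂ) (toL2 f), U.coeFn_mul (toL2 f), coeFn_toL2 f,
    coeFn_toL2 (schwartzDeriv2 f)] with x h1 h2 h3 h4 h5 h6 h7
  simp only [h1, Pi.sub_apply, h2, Pi.add_apply, h3, Pi.neg_apply, h4, Pi.smul_apply, h5, h6, h7,
    smul_eq_mul]
  push_cast
  ring

end RealPlace

/-! ### Resolvent points from exponentially decaying Floquet solutions. -/

namespace RealPlace

open UnboundedOp

variable {L : ℝ} {U : EvenPeriodicPotential L} {l : ℝ} {ψ ψ' φ φ' : ℝ → ℂ}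

theorem integrable_norm_sq_schwartz (f : 𝓢(ℝ, ℂ)) : Integrable fun x => ‖f x‖ ^ 2 :=
  (memLp_two_iff_integrable_sq_norm f.continuous.aestronglyMeasurable).mp (f.memLp 2)

theorem hasDerivAt_schwartz (f : 𝓢(ℝ, ℂ)) (x : ℝ) :
    HasDerivAt f (SchwartzMap.derivCLM ℂ ℂ f x) x := by
  rw [SchwartzMap.derivCLM_apply]
  exact f.differentiableAt.hasDerivAt

/-- The energy estimate for the Wronskian of a Schwartz function with a solution, weighted by an
exponential that keeps the solution bounded. -/
theorem IsSolution.wronskian_estimate (h : IsSolution U l ψ ψ') {m B : ℝ}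
    (hB : ∀ x, Real.exp (m * x) * ‖ψ x‖ ≤ B) (hB' : ∀ x, Real.exp (m * x) * ‖ψ' x‖ ≤ B)
    (f : 𝓢(ℝ, ℂ)) :
    (Integrable fun x => ‖(Real.exp (m * x) : ℂ) *
      (f x * ψ' x - SchwartzMap.derivCLM ℂ ℂ f x * ψ x)‖ ^ 2) ∧
    m ^ 2 * ∫ x, ‖(Real.exp (m * x) : ℂ) *
      (f x * ψ' x - SchwartzMap.derivCLM ℂ ℂ f x * ψ x)‖ ^ 2 ≤
    B ^ 2 * ‖hill U ⟨toL2 f, toL2_mem f⟩ - (l : ℂ) • toL2 f‖ ^ 2 := by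
  have hg := hill_sub_toL2_ae U f l
  set G : L2R := hill U ⟨toL2 f, toL2_mem f⟩ - (l : ℂ) • toL2 f
  set f1 := SchwartzMap.derivCLM ℂ ℂ f with hf1
  set g : ℝ → ℂ := fun x => -schwartzDeriv2 f x + ((U.toFun x - l : ℝ) : ℂ) * f x with hgdef
  have hB0 : 0 ≤ B := (by positivity : (0 : ℝ) ≤ _).trans (hB 0)
  have hψc := h.continuous
  have hψc' := h.continuous'
  have hUc := U.smooth.continuous
  have hgc : Continuous g :=
    ((schwartzDeriv2 f).continuous.neg).add
      ((Complex.continuous_ofReal.comp (hUc.sub continuous_const)).mul f.continuous)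
  have hec : Continuous fun x : ℝ => (Real.exp (m * x) : ℂ) := by fun_prop
  have hg2 : Integrable fun x => ‖g x‖ ^ 2 :=
    (memLp_two_iff_integrable_sq_norm hgc.aestronglyMeasurable).mp
      ((memLp_congr_ae hg).mp (Lp.memLp G))
  have hn : ∀ x : ℝ, ‖(Real.exp (m * x) : ℂ)‖ = Real.exp (m * x) := fun x => by
    rw [Complex.norm_real, Real.norm_of_nonneg (Real.exp_pos _).le]
  have hw2 : Integrable fun x => ‖(Real.exp (m * x) : ℂ) * (f x * ψ' x - f1 x * ψ x)‖ ^ 2 := by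
    refine (((integrable_norm_sq_schwartz f).add (integrable_norm_sq_schwartz f1)).const_mul
      (2 * B ^ 2)).mono' ?_ (Eventually.of_forall fun x => ?_)
    · exact ((hec.mul ((f.continuous.mul hψc').sub (f1.continuous.mul hψc))).norm.pow
        2).aestronglyMeasurable
    · rw [Real.norm_of_nonneg (by positivity)]
      have h1 : ‖(Real.exp (m * x) : ℂ) * (f x * ψ' x - f1 x * ψ x)‖ ≤
          B * (‖f x‖ + ‖f1 x‖) := by
        rw [norm_mul, hn]
        calc _ ≤ Real.exp (m * x) * (‖f x‖ * ‖ψ' x‖ + ‖f1 x‖ * ‖ψ x‖) := by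
              gcongr
              exact (norm_sub_le _ _).trans (by rw [norm_mul, norm_mul])
          _ = ‖f x‖ * (Real.exp (m * x) * ‖ψ' x‖) + ‖f1 x‖ * (Real.exp (m * x) * ‖ψ x‖) := by ring
          _ ≤ ‖f x‖ * B + ‖f1 x‖ * B := by
              gcongr
              exacts [hB' x, hB x]
          _ = _ := by ring
      calc _ ≤ (B * (‖f x‖ + ‖f1 x‖)) ^ 2 := by gcongr
        _ ≤ 2 * B ^ 2 * (‖f x‖ ^ 2 + ‖f1 x‖ ^ 2) := by
          nlinarith [mul_nonneg (sq_nonneg B) (sq_nonneg (‖f x‖ - ‖f1 x‖))]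
  have hle : ∀ x, ‖(Real.exp (m * x) : ℂ) * ψ x * g x‖ ^ 2 ≤ B ^ 2 * ‖g x‖ ^ 2 := fun x => by
    rw [← mul_pow, norm_mul, norm_mul, hn]
    gcongr
    exact hB x
  have hh2 : Integrable fun x => ‖(Real.exp (m * x) : ℂ) * ψ x * g x‖ ^ 2 := by
    refine (hg2.const_mul (B ^ 2)).mono' ?_ (Eventually.of_forall fun x => ?_)
    · exact (((hec.mul hψc).mul hgc).norm.pow 2).aestronglyMeasurable
    · rw [Real.norm_of_nonneg (by positivity)]
      exact hle x
  -- By the equation for `ψ`, `(f ψ' - f' ψ)' = ψ g` with `g = -f'' + (U - l) f`. The weighted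
  -- Wronskian therefore solves `w' = m w + exp(m x) ψ g`.
  refine ⟨hw2, (energy_estimate (h := fun x => (Real.exp (m * x) : ℂ) * ψ x * g x) (fun x => ?_)
    ((hec.mul hψc).mul hgc) hw2 hh2).trans ?_⟩
  · have he : HasDerivAt (fun x : ℝ => (Real.exp (m * x) : ℂ))
        ((Real.exp (m * x) * m : ℝ) : ℂ) x := by
      have := (((hasDerivAt_id x).const_mul m).exp).ofReal_comp
      simpa using this
    refine (he.mul (((hasDerivAt_schwartz f x).mul (h.hasDerivAt' x)).sub
      ((hasDerivAt_schwartz f1 x).mul (h.hasDerivAt x)))).congr_deriv ?_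
    have : schwartzDeriv2 f x = SchwartzMap.derivCLM ℂ ℂ f1 x := rfl
    simp only [hgdef, this, Pi.sub_apply, Pi.mul_apply]
    rw [← hf1]
    push_cast
    ring
  · rw [norm_sq_eq_integral hg, ← integral_const_mul]
    exact integral_mono hh2 (hg2.const_mul _) hle

/-- A vanishing Wronskian makes the solutions proportional, and then their multipliers coincide. -/
theorem IsFloquet.wronskian_ne_zero {ρ σ : ℂ} (h : IsFloquet U l ρ ψ ψ') (h' : IsFloquet U l σ φ φ')
    (hne : ρ ≠ σ) : ψ 0 * φ' 0 - ψ' 0 * φ 0 ≠ 0 := by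
  intro hW
  obtain ⟨c, hc, hc'⟩ : ∃ c, ψ 0 = c * φ 0 ∧ ψ' 0 = c * φ' 0 := by
    rcases h'.ne_zero with h0 | h0
    · refine ⟨ψ 0 / φ 0, by field_simp, ?_⟩
      field_simp
      linear_combination -hW
    · refine ⟨ψ' 0 / φ' 0, ?_, by field_simp⟩
      field_simp
      linear_combination hW
  have hu := h.toIsSolution.unique (h'.toIsSolution.const_mul c) hc hc' L
  have e1 := h.shift 0
  have e2 := h.shift' 0
  have e3 := h'.shift 0
  have e4 := h'.shift' 0
  rw [zero_add] at e1 e2 e3 e4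
  rcases h.ne_zero with h0 | h0
  · refine hne (mul_right_cancel₀ h0 ?_)
    rw [← e1, hu.1, e3, hc]
    ring
  · refine hne (mul_right_cancel₀ h0 ?_)
    rw [← e2, hu.2, e4, hc']
    ring

/-- Two Floquet solutions, one decaying in each direction, give a resolvent point. -/
theorem isResolventPoint_hill_of_floquet {r s : ℝ} (hrs : r * s = 1) (hne : r ≠ s)
    (h : IsFloquet U l r ψ ψ') (h' : IsFloquet U l s φ φ') : IsResolventPoint (hill U) l := by
  have hL := U.period_pos
  have hr0 : r ≠ 0 := left_ne_zero_of_mul_eq_one hrs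
  have hs : s = r⁻¹ := eq_inv_of_mul_eq_one_right hrs
  have hr1 : |r| ≠ 1 := fun h1 => by
    rcases eq_or_eq_neg_of_abs_eq h1 with h2 | h2 <;> subst h2 <;> norm_num at hs <;>
      exact hne hs.symm
  -- With this exponent `exp(m x) |ψ|` is periodic, hence bounded; as `s = r⁻¹`, the exponent `-m`
  -- does the same for `φ`.
  set m : ℝ := -Real.log |r| / L with hm
  have hmL : m * L = -Real.log |r| := by rw [hm]; field_simp
  have hm0 : m ≠ 0 := by
    refine div_ne_zero (neg_ne_zero.mpr ?_) hL.ne'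
    exact Real.log_ne_zero_of_pos_of_ne_one (abs_pos.mpr hr0) hr1
  have hexp : Real.exp (m * L) * ‖(r : ℂ)‖ = 1 := by
    rw [hmL, Real.exp_neg, Real.exp_log (abs_pos.mpr hr0), Complex.norm_real, Real.norm_eq_abs,
      inv_mul_cancel₀ (abs_ne_zero.mpr hr0)]
  have hexp' : Real.exp (-m * L) * ‖(s : ℂ)‖ = 1 := by
    rw [neg_mul, hmL, neg_neg, Real.exp_log (abs_pos.mpr hr0), Complex.norm_real,
      Real.norm_eq_abs, ← abs_mul, hrs, abs_one]
  obtain ⟨B1, hB1⟩ := exists_bound_of_quasiperiodic h.continuous hL h.shift hexp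
  obtain ⟨B2, hB2⟩ := exists_bound_of_quasiperiodic h.continuous' hL h.shift' hexp
  obtain ⟨B3, hB3⟩ := exists_bound_of_quasiperiodic h'.continuous hL h'.shift hexp'
  obtain ⟨B4, hB4⟩ := exists_bound_of_quasiperiodic h'.continuous' hL h'.shift' hexp'
  obtain ⟨B, h1, h2, h3, h4, hB0⟩ : ∃ B, B1 ≤ B ∧ B2 ≤ B ∧ B3 ≤ B ∧ B4 ≤ B ∧ 0 < B :=
    ⟨max (max (max B1 B2) (max B3 B4)) 1, by simp, by simp, by simp, by simp, by simp⟩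
  replace hB1 := fun x => (hB1 x).trans h1
  replace hB2 := fun x => (hB2 x).trans h2
  replace hB3 := fun x => (hB3 x).trans h3
  replace hB4 := fun x => (hB4 x).trans h4
  set W := ψ 0 * φ' 0 - ψ' 0 * φ 0 with hWdef
  have hW : W ≠ 0 := h.wronskian_ne_zero h' (by exact_mod_cast hne)
  have hc : 0 < |m| * ‖W‖ / (2 * B ^ 2) := by
    have := abs_pos.mpr hm0
    have := norm_pos_iff.mpr hW
    positivity
  refine isResolventPoint_ofReal_of_bound (isSelfAdjoint_hill U) hc fun u => ?_
  refine secondDeriv_induction (P := fun f g => |m| * ‖W‖ / (2 * B ^ 2) * ‖f‖ ≤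
    ‖-g + U.mul f - (l : ℂ) • f‖) (isClosed_le (by fun_prop) (by fun_prop)) (fun f => ?_) u
  rw [← hill_toL2 U f]
  obtain ⟨i1, E1⟩ := h.toIsSolution.wronskian_estimate hB1 hB2 f
  obtain ⟨i2, E2⟩ := h'.toIsSolution.wronskian_estimate hB3 hB4 f
  set G : L2R := hill U ⟨toL2 f, toL2_mem f⟩ - (l : ℂ) • toL2 f
  set f1 := SchwartzMap.derivCLM ℂ ℂ f
  have hpt : ∀ x, ‖W‖ ^ 2 * ‖f x‖ ^ 2 ≤ 2 * B ^ 2 *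
      (‖(Real.exp (m * x) : ℂ) * (f x * ψ' x - f1 x * ψ x)‖ ^ 2 +
        ‖(Real.exp (-m * x) : ℂ) * (f x * φ' x - f1 x * φ x)‖ ^ 2) := fun x => by
    set w1 := (Real.exp (m * x) : ℂ) * (f x * ψ' x - f1 x * ψ x) with hw1
    set w2 := (Real.exp (-m * x) : ℂ) * (f x * φ' x - f1 x * φ x) with hw2
    have hee : (Real.exp (m * x) : ℂ) * (Real.exp (-m * x) : ℂ) = 1 := by
      rw [← Complex.ofReal_mul, ← Real.exp_add]
      simp
    -- The two Wronskians with `f` determine `f`, as `W f = ψ (f φ' - f' φ) - φ (f ψ' - f' ψ)`, and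
    -- the opposite exponential weights cancel.
    have e : W * f x = (Real.exp (m * x) : ℂ) * ψ x * w2 - (Real.exp (-m * x) : ℂ) * φ x * w1 := by
      rw [hWdef, ← h.toIsSolution.wronskian_const h'.toIsSolution x, hw1, hw2]
      linear_combination -(f x * (ψ x * φ' x - ψ' x * φ x)) * hee
    have hn : ∀ t : ℝ, ‖(Real.exp t : ℂ)‖ = Real.exp t := fun t => by
      rw [Complex.norm_real, Real.norm_of_nonneg (Real.exp_pos _).le]
    have : ‖W‖ * ‖f x‖ ≤ B * (‖w1‖ + ‖w2‖) := by
      rw [← norm_mul, e]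
      refine (norm_sub_le _ _).trans ?_
      rw [norm_mul (_ * ψ x), norm_mul (_ * φ x), norm_mul _ (ψ x), norm_mul _ (φ x), hn, hn]
      have a1 := mul_le_mul_of_nonneg_right (hB1 x) (norm_nonneg w2)
      have a2 := mul_le_mul_of_nonneg_right (hB3 x) (norm_nonneg w1)
      linarith
    calc _ = (‖W‖ * ‖f x‖) ^ 2 := by ring
      _ ≤ (B * (‖w1‖ + ‖w2‖)) ^ 2 := by gcongr
      _ ≤ _ := by nlinarith [mul_nonneg (sq_nonneg B) (sq_nonneg (‖w1‖ - ‖w2‖))]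
  have hI := integral_mono ((integrable_norm_sq_schwartz f).const_mul (‖W‖ ^ 2))
    ((i1.add i2).const_mul (2 * B ^ 2)) hpt
  simp only [Pi.add_apply] at hI
  rw [integral_const_mul, integral_const_mul, integral_add i1 i2,
    ← norm_sq_eq_integral (coeFn_toL2 f)] at hI
  -- Each weighted Wronskian satisfies `m² ∫ |w|² ≤ B² ‖G‖²`; adding the two and multiplying by `2
  -- B²` gives `4 B⁴ ‖G‖²`.
  have key : (|m| * ‖W‖ * ‖toL2 f‖) ^ 2 ≤ (2 * B ^ 2 * ‖G‖) ^ 2 := by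
    have h5 := mul_le_mul_of_nonneg_left hI (sq_nonneg m)
    rw [neg_sq] at E2
    have h6 := mul_le_mul_of_nonneg_left (add_le_add E1 E2) (by positivity : 0 ≤ 2 * B ^ 2)
    rw [mul_pow, mul_pow, sq_abs]
    linarith
  rw [div_mul_eq_mul_div, div_le_iff₀ (by positivity), mul_comm ‖G‖]
  exact (sq_le_sq₀ (by positivity) (by positivity)).mp key

end RealPlace

/-! ### Weyl sequences and the discriminant description of the spectrum. -/

namespace RealPlace

open UnboundedOp

variable {L : ℝ} {U : EvenPeriodicPotential L} {l : ℝ} {ψ ψ' φ φ' : ℝ → ℂ}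

/-- A smooth cutoff function equal to one on `[-1, 1]` and vanishing outside `[-2, 2]`, with two
derivatives. -/
theorem exists_cutoff : ∃ (b b1 b2 : ℝ → ℝ) (K : ℝ), ContDiff ℝ ∞ b ∧
    (∀ x, HasDerivAt b (b1 x) x) ∧ (∀ x, HasDerivAt b1 (b2 x) x) ∧
    (∀ x, |x| ≤ 1 → b x = 1) ∧ (∀ x, 2 < |x| → b x = 0 ∧ b1 x = 0 ∧ b2 x = 0) ∧
    (∀ x, |b1 x| ≤ K) ∧ ∀ x, |b2 x| ≤ K := by
  let b : ContDiffBump (0 : ℝ) := ⟨1, 2, one_pos, one_lt_two⟩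
  have hb : ContDiff ℝ 2 b := b.contDiff
  have hb1 : ContDiff ℝ 1 (deriv b) := by
    have : ContDiff ℝ (1 + 1) b := hb
    exact (contDiff_succ_iff_deriv.mp this).2.2
  have hc1 : HasCompactSupport (deriv b) := b.hasCompactSupport.deriv
  obtain ⟨K1, hK1⟩ := hb1.continuous.bounded_above_of_compact_support hc1
  obtain ⟨K2, hK2⟩ := (hb1.continuous_deriv le_rfl).bounded_above_of_compact_support hc1.deriv
  have ht : ∀ x : ℝ, 2 < |x| → x ∉ tsupport b := fun x hx => by
    rw [b.tsupport_eq]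
    simp [b, hx]
  refine ⟨b, deriv b, deriv (deriv b), max K1 K2, b.contDiff,
    fun x => (hb.differentiable two_ne_zero x).hasDerivAt,
    fun x => (hb1.differentiable one_ne_zero x).hasDerivAt, fun x hx => ?_, fun x hx => ⟨?_, ?_, ?_⟩,
    fun x => (hK1 x).trans (le_max_left _ _), fun x => (hK2 x).trans (le_max_right _ _)⟩
  · exact b.one_of_mem_closedBall (by simpa [b] using hx)
  · exact image_eq_zero_of_notMem_tsupport (ht x hx)
  · exact image_eq_zero_of_notMem_tsupport fun h => ht x hx (tsupport_deriv_subset h)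
  · exact image_eq_zero_of_notMem_tsupport fun h =>
      ht x hx (tsupport_deriv_subset (tsupport_deriv_subset h))

/-- If `ψ` vanished on a period, so would `ψ 0` and `ψ' 0`. -/
theorem IsFloquet.integral_norm_sq_pos {ρ : ℂ} (h : IsFloquet U l ρ ψ ψ') :
    0 < ∫ x in (0 : ℝ)..(0 + L), ‖ψ x‖ ^ 2 := by
  have hL := U.period_pos
  rw [zero_add]
  refine intervalIntegral.integral_pos hL (h.continuous.norm.pow 2).continuousOn
    (fun x _ => by positivity) ?_
  by_contra! hz
  have hz' : ∀ x ∈ Set.Icc 0 L, ψ x = 0 := fun x hx => by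
    have := hz x hx
    simpa using this
  have h0 : (0 : ℝ) ∈ Set.Icc 0 L := Set.left_mem_Icc.mpr hL.le
  have hd : HasDerivWithinAt ψ 0 (Set.Icc 0 L) 0 :=
    (hasDerivWithinAt_const 0 (Set.Icc 0 L) (0 : ℂ)).congr hz' (hz' 0 h0)
  have hd' := (uniqueDiffOn_Icc hL 0 h0).eq_deriv _ (h.hasDerivAt 0).hasDerivWithinAt hd
  rcases h.ne_zero with h1 | h1
  exacts [h1 (hz' 0 h0), h1 hd']

/-- Cutting off a bounded Floquet solution at scale `n L` gives a Weyl sequence. -/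
theorem IsFloquet.exists_weyl_sequence {ρ : ℂ} (hρ : ‖ρ‖ = 1) (h : IsFloquet U l ρ ψ ψ') :
    ∃ C, ∀ n : ℕ, 1 ≤ n * L → ∃ f : 𝓢(ℝ, ℂ),
      n * (∫ x in (0 : ℝ)..(0 + L), ‖ψ x‖ ^ 2) ≤ ‖toL2 f‖ ^ 2 ∧
      ‖hill U ⟨toL2 f, toL2_mem f⟩ - (l : ℂ) • toL2 f‖ ^ 2 ≤ C := by
  have hL := U.period_pos
  obtain ⟨B1, hB1⟩ := exists_bound_of_quasiperiodic h.continuous hL h.shift (m := 0) (by simp [hρ])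
  obtain ⟨B2, hB2⟩ := exists_bound_of_quasiperiodic h.continuous' hL h.shift' (m := 0) (by simp [hρ])
  simp only [zero_mul, Real.exp_zero, one_mul] at hB1 hB2
  obtain ⟨b, b1, b2, K, hb, hd1, hd2, hone, hzero, hK1, hK2⟩ := exists_cutoff
  have hB10 : 0 ≤ B1 := (norm_nonneg _).trans (hB1 0)
  have hB20 : 0 ≤ B2 := (norm_nonneg _).trans (hB2 0)
  have hK0 : 0 ≤ K := (abs_nonneg _).trans (hK1 0)
  set D := K * B1 + 2 * K * B2 with hD
  have hD0 : 0 ≤ D := by positivity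
  -- Only terms containing a derivative of the cutoff survive. They are at most `D / N` on an
  -- interval of length `4 N`, and `N ≥ 1`.
  refine ⟨4 * D ^ 2, fun n hn => ?_⟩
  set N : ℝ := n * L with hN
  have hN0 : 0 < N := one_pos.trans_le hn
  let f0 : ℝ → ℂ := fun x => (b (x / N) : ℂ) * ψ x
  let f1 : ℝ → ℂ := fun x => ((b1 (x / N) / N : ℝ) : ℂ) * ψ x + (b (x / N) : ℂ) * ψ' x
  have hs : ∀ x, 2 * N < |x| → 2 < |x / N| := fun x hx => by
    rwa [abs_div, abs_of_pos hN0, lt_div_iff₀ hN0]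
  have hc : HasCompactSupport f0 := by
    refine HasCompactSupport.intro (isCompact_Icc (a := -(2 * N)) (b := 2 * N)) fun x hx => ?_
    have : 2 * N < |x| := by
      by_contra! hle
      exact hx (abs_le.mp hle)
    simp [f0, (hzero _ (hs x this)).1]
  have hf0 : ContDiff ℝ ∞ f0 :=
    (Complex.ofRealCLM.contDiff.comp (hb.comp (contDiff_id.div_const N))).mul h.contDiff
  let f : 𝓢(ℝ, ℂ) := hc.toSchwartzMap hf0
  have hf : ∀ x, f x = f0 x := fun x => rfl
  have hscale : ∀ {c c' : ℝ → ℝ}, (∀ x, HasDerivAt c (c' x) x) → ∀ x,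
      HasDerivAt (fun x => (c (x / N) : ℂ)) ((c' (x / N) / N : ℝ) : ℂ) x := fun hcd x => by
    have := ((hcd (x / N)).comp x ((hasDerivAt_id x).div_const N)).ofReal_comp
    refine this.congr_deriv ?_
    congr 1
    ring
  have hdf : ∀ x, SchwartzMap.derivCLM ℂ ℂ f x = f1 x := fun x => by
    rw [SchwartzMap.derivCLM_apply]
    exact ((hscale hd1 x).mul (h.hasDerivAt x)).deriv
  have hddf : ∀ x, -schwartzDeriv2 f x + ((U.toFun x - l : ℝ) : ℂ) * f x =
      -(((b2 (x / N) / N / N : ℝ) : ℂ) * ψ x + 2 * ((b1 (x / N) / N : ℝ) : ℂ) * ψ' x) := fun x => by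
    have e : SchwartzMap.derivCLM ℂ ℂ f = f1 := funext hdf
    have hq : HasDerivAt (fun x => ((b1 (x / N) / N : ℝ) : ℂ)) ((b2 (x / N) / N / N : ℝ) : ℂ) x := by
      have := (hscale hd2 x).div_const (N : ℂ)
      simpa only [Complex.ofReal_div] using this
    have hd := (hq.mul (h.hasDerivAt x)).add ((hscale hd1 x).mul (h.hasDerivAt' x))
    have h2 : schwartzDeriv2 f x = deriv f1 x := by
      rw [schwartzDeriv2, SchwartzMap.derivCLM_apply, e]
    rw [h2.trans hd.deriv, hf]
    simp only [f0]
    ring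
  refine ⟨f, ?_, ?_⟩
  · have hp : Function.Periodic (fun x => ‖ψ x‖ ^ 2) L := fun x => by
      simp only [h.shift, norm_mul, hρ, one_mul]
    have hcont : Continuous fun x => ‖ψ x‖ ^ 2 := h.continuous.norm.pow 2
    have e := hp.intervalIntegral_add_zsmul_eq n 0 fun _ _ => hcont.intervalIntegrable _ _
    simp only [natCast_zsmul, nsmul_eq_mul] at e
    rw [← e, ← hN, zero_add, norm_sq_eq_integral (coeFn_toL2 f),
      intervalIntegral.integral_of_le hN0.le]
    -- The cutoff equals one on `[0, N]`, which consists of `n` periods.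
    have e2 : ∫ x in Set.Ioc 0 N, ‖ψ x‖ ^ 2 = ∫ x in Set.Ioc 0 N, ‖f x‖ ^ 2 := by
      refine setIntegral_congr_fun measurableSet_Ioc fun x hx => ?_
      have : b (x / N) = 1 := hone _ (by
        rw [abs_div, abs_of_pos hN0, abs_of_pos hx.1]
        exact (div_le_one hN0).mpr hx.2)
      simp [hf, f0, this]
    rw [e2]
    exact setIntegral_le_integral (integrable_norm_sq_schwartz f)
      (Eventually.of_forall fun x => by positivity)
  · rw [norm_sq_eq_integral (hill_sub_toL2_ae U f l)]
    simp only [hddf, norm_neg]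
    set g : ℝ → ℂ := fun x =>
      ((b2 (x / N) / N / N : ℝ) : ℂ) * ψ x + 2 * ((b1 (x / N) / N : ℝ) : ℂ) * ψ' x with hg
    have hg0 : ∀ x, x ∉ Set.Icc (-(2 * N)) (2 * N) → ‖g x‖ ^ 2 = 0 := fun x hx => by
      have : 2 * N < |x| := by
        by_contra! hle
        exact hx (abs_le.mp hle)
      obtain ⟨_, z1, z2⟩ := hzero _ (hs x this)
      simp [hg, z1, z2]
    have hgb : ∀ x, ‖g x‖ ≤ D / N := fun x => by
      refine (norm_add_le _ _).trans ?_
      rw [norm_mul, norm_mul, norm_mul, Complex.norm_real, Complex.norm_real, Real.norm_eq_abs,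
        Real.norm_eq_abs, abs_div, abs_div, abs_div, abs_of_pos hN0, Complex.norm_ofNat]
      have a1 : |b2 (x / N)| / N / N ≤ K / N := by
        refine (div_le_self (by positivity) hn).trans ?_
        gcongr
        exact hK2 _
      have a2 : |b1 (x / N)| / N ≤ K / N := by
        gcongr
        exact hK1 _
      calc _ ≤ K / N * B1 + 2 * (K / N) * B2 := by
            gcongr
            exacts [hB1 x, hB2 x]
        _ = _ := by rw [hD]; ring
    rw [← setIntegral_eq_integral_of_forall_compl_eq_zero hg0]
    have := norm_setIntegral_le_of_norm_le_const (μ := volume) (f := fun x => ‖g x‖ ^ 2)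
      (s := Set.Icc (-(2 * N)) (2 * N)) (C := (D / N) ^ 2)
      (by rw [Real.volume_Icc]; exact ENNReal.ofReal_lt_top) (fun x _ => by
        rw [Real.norm_of_nonneg (by positivity)]
        gcongr
        exact hgb x)
    refine (le_abs_self _).trans (this.trans ?_)
    rw [Real.volume_real_Icc_of_le (by linarith), div_pow]
    calc D ^ 2 / N ^ 2 * (2 * N - -(2 * N)) = 4 * D ^ 2 / N := by field_simp; ring
      _ ≤ 4 * D ^ 2 := div_le_self (by positivity) hn

theorem IsFloquet.mem_spec_hill {ρ : ℂ} (hρ : ‖ρ‖ = 1) (h : IsFloquet U l ρ ψ ψ') :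
    (l : ℂ) ∈ spec (hill U) := by
  intro hr
  obtain ⟨c, hc, hcb⟩ := hr.exists_bound
  obtain ⟨C, hC⟩ := h.exists_weyl_sequence hρ
  have hI := h.integral_norm_sq_pos
  have hL := U.period_pos
  set I := ∫ x in (0 : ℝ)..(0 + L), ‖ψ x‖ ^ 2
  -- A lower bound would give `c² n I ≤ C` for all large `n`; this `n` is large enough to violate
  -- it.
  obtain ⟨n, hn⟩ := exists_nat_gt (max (1 / L) (C / (c ^ 2 * I)))
  obtain ⟨f, h1, h2⟩ := hC n ((div_le_iff₀ hL).mp ((le_max_left _ _).trans hn.le))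
  have h3 := (div_lt_iff₀ (by positivity)).mp ((le_max_right _ _).trans_lt hn)
  have h4 := pow_le_pow_left₀ (by positivity) (hcb ⟨toL2 f, toL2_mem f⟩) 2
  rw [mul_pow] at h4
  have h5 := mul_le_mul_of_nonneg_left h1 (sq_nonneg c)
  have h6 := h4.trans h2
  linarith

/-- The spectrum of the Hill operator is a sublevel set of an analytic function. -/
theorem exists_analytic_mem_spec_hill_iff (U : EvenPeriodicPotential L) :
    ∃ F : ℝ → ℝ, AnalyticOnNhd ℝ F Set.univ ∧ ∀ l : ℝ, (l : ℂ) ∈ spec (hill U) ↔ F l ≤ 0 := by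
  obtain ⟨Δ, hΔ, hfl⟩ := exists_discriminant U
  refine ⟨fun l => Δ l ^ 2 - 4, (hΔ.pow 2).sub analyticOnNhd_const, fun l => ⟨fun hl => ?_,
    fun hl => ?_⟩⟩
  · by_contra! hlt
    -- The multipliers `(Δ ± s) / 2` are real and distinct, with product one.
    set s := Real.sqrt (Δ l ^ 2 - 4) with hs
    have hss : s ^ 2 = Δ l ^ 2 - 4 := Real.sq_sqrt hlt.le
    have hs0 : 0 < s := Real.sqrt_pos.mpr hlt
    obtain ⟨ψ, ψ', h1⟩ := hfl l ((Δ l + s) / 2 : ℝ) (by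
      rw [← Complex.ofReal_pow, ← Complex.ofReal_mul, ← Complex.ofReal_sub]
      exact_mod_cast (by linear_combination hss / 4 : ((Δ l + s) / 2) ^ 2 - Δ l * ((Δ l + s) / 2) + 1 = 0))
    obtain ⟨φ, φ', h2⟩ := hfl l ((Δ l - s) / 2 : ℝ) (by
      rw [← Complex.ofReal_pow, ← Complex.ofReal_mul, ← Complex.ofReal_sub]
      exact_mod_cast (by linear_combination hss / 4 : ((Δ l - s) / 2) ^ 2 - Δ l * ((Δ l - s) / 2) + 1 = 0))
    exact hl (isResolventPoint_hill_of_floquet (by linear_combination -hss / 4) (by linarith) h1 h2)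
  -- The multiplier `(Δ + i s) / 2` has modulus one. Band edges, where `s = 0`, need no separate
  -- treatment.
  · set s := Real.sqrt (4 - Δ l ^ 2) with hs
    have hss : s ^ 2 = 4 - Δ l ^ 2 := Real.sq_sqrt (by linarith)
    have hssC : (s : ℂ) ^ 2 = 4 - (Δ l : ℂ) ^ 2 := by exact_mod_cast hss
    obtain ⟨ψ, ψ', h1⟩ := hfl l ((Δ l + s * Complex.I) / 2) (by
      linear_combination (Complex.I ^ 2 / 4) * hssC + (1 - (Δ l : ℂ) ^ 2 / 4) * Complex.I_sq)
    refine h1.mem_spec_hill ?_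
    have : ‖((Δ l + s * Complex.I) / 2 : ℂ)‖ ^ 2 = 1 := by
      rw [norm_div, div_pow, Complex.sq_norm, Complex.normSq_add_mul_I, hss, Complex.norm_ofNat]
      ring
    exact (pow_eq_one_iff_of_nonneg (norm_nonneg _) two_ne_zero).mp this

end RealPlace

/-! ### Sublevel sets of analytic functions as unions of bands. -/

namespace BandStructure

variable {F : ℝ → ℝ} {S : Set ℝ}

theorem exists_zero_of_mem_of_notMem (hF : Continuous F) (hS : ∀ x, x ∈ S ↔ F x ≤ 0) {x y : ℝ}
    (hx : x ∈ S) (hy : y ∉ S) : ∃ z ∈ Set.uIcc x y, z ∈ S ∧ F z = 0 := by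
  have h0 : (0 : ℝ) ∈ Set.uIcc (F x) (F y) :=
    Set.mem_uIcc_of_le ((hS x).mp hx) (not_le.mp (mt (hS y).mpr hy)).le
  obtain ⟨z, hz, hz0⟩ := intermediate_value_uIcc hF.continuousOn h0
  exact ⟨z, hz, (hS z).mpr hz0.le, hz0⟩

/-- The zeros of `F` and the integers in `S`. -/
def nodes (F : ℝ → ℝ) (S : Set ℝ) : Set ℝ := {x | x ∈ S ∧ (F x = 0 ∨ ∃ k : ℤ, (k : ℝ) = x)}

theorem exists_node_le (hF : Continuous F) (hS : ∀ x, x ∈ S ↔ F x ≤ 0) {x : ℝ} (hx : x ∈ S) :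
    ∃ y ∈ nodes F S, y ≤ x := by
  by_cases h : (⌊x⌋ : ℝ) ∈ S
  · exact ⟨⌊x⌋, ⟨h, Or.inr ⟨_, rfl⟩⟩, Int.floor_le x⟩
  · obtain ⟨z, hz, hzS, hz0⟩ := exists_zero_of_mem_of_notMem hF hS hx h
    rw [Set.uIcc_of_ge (Int.floor_le x)] at hz
    exact ⟨z, ⟨hzS, Or.inl hz0⟩, hz.2⟩

/-- It makes the nodes unbounded above when `S` is. Counting integers of `S` as nodes secures this
even if `F` has finitely many zeros: a terminal half-line is then cut into infinitely many touching
bands. -/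
theorem exists_le_node (hF : Continuous F) (hS : ∀ x, x ∈ S ↔ F x ≤ 0) {x : ℝ} (hx : x ∈ S) :
    ∃ y ∈ nodes F S, x ≤ y := by
  by_cases h : (⌈x⌉ : ℝ) ∈ S
  · exact ⟨⌈x⌉, ⟨h, Or.inr ⟨_, rfl⟩⟩, Int.le_ceil x⟩
  · obtain ⟨z, hz, hzS, hz0⟩ := exists_zero_of_mem_of_notMem hF hS hx h
    rw [Set.uIcc_of_le (Int.le_ceil x)] at hz
    exact ⟨z, ⟨hzS, Or.inl hz0⟩, hz.1⟩

/-- An accumulation point of zeros would force the analytic `F` to vanish identically, contrary to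
`F E ≠ 0`. -/
theorem finite_nodes_inter_Iic (hF : AnalyticOnNhd ℝ F Set.univ) (hS : BddBelow S) {E : ℝ}
    (hE : F E ≠ 0) (M : ℝ) : (nodes F S ∩ Set.Iic M).Finite := by
  obtain ⟨c, hc⟩ := hS
  have hz : ({x | F x = 0} ∩ Set.Icc c M).Finite := by
    by_contra hinf
    obtain ⟨z, -, hz⟩ := Set.Infinite.exists_accPt_of_subset_isCompact hinf isCompact_Icc
      Set.inter_subset_right
    have hfr := (accPt_iff_frequently_nhdsNE.mp hz).mono fun x hx => hx.1
    exact hE (hF.eqOn_zero_of_preconnected_of_frequently_eq_zero isPreconnected_univ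
      (Set.mem_univ z) hfr (Set.mem_univ E))
  refine (hz.union ((Set.finite_Icc ⌈c⌉ ⌊M⌋).image ((↑) : ℤ → ℝ))).subset ?_
  rintro x ⟨⟨hxS, h0 | ⟨k, rfl⟩⟩, hxM⟩
  · exact Or.inl ⟨h0, hc hxS, hxM⟩
  · exact Or.inr ⟨k, ⟨Int.ceil_le.mpr (hc hxS), Int.le_floor.mpr hxM⟩, rfl⟩

/-- A set of reals, unbounded above, with finite initial segments is the range of a strictly
increasing sequence. -/
theorem exists_enumeration {G : Set ℝ} (hfin : ∀ M, (G ∩ Set.Iic M).Finite) (hG : ¬ BddAbove G)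
    {c : ℝ} (hc : ∀ x ∈ G, c ≤ x) : ∃ g : ℕ → ℝ, StrictMono g ∧ Tendsto g atTop atTop ∧
      (∀ n, g n ∈ G) ∧ (∀ x ∈ G, g 0 ≤ x) ∧ ∀ n, ∀ x ∈ G, ¬ (g n < x ∧ x < g (n + 1)) := by
  have hnext : ∀ t : ℝ, ∃ y, y ∈ G ∧ t < y ∧ ∀ z ∈ G, t < z → y ≤ z := fun t => by
    obtain ⟨w, hw, htw⟩ := not_bddAbove_iff.mp hG t
    obtain ⟨y, ⟨⟨hyG, hyw⟩, hty⟩, hmin⟩ := Set.exists_min_image (G ∩ Set.Iic w ∩ Set.Ioi t) id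
      ((hfin w).subset Set.inter_subset_left) ⟨w, ⟨hw, le_refl w⟩, htw⟩
    refine ⟨y, hyG, hty, fun z hz htz => ?_⟩
    rcases le_total z w with hzw | hwz
    · exact hmin z ⟨⟨hz, hzw⟩, htz⟩
    · exact le_trans hyw hwz
  choose next hmem hlt hleast using hnext
  -- The start `c - 1` lies below all of `G`; the `n + 1` makes `g 0` the least element of `G`.
  let g : ℕ → ℝ := fun n => next^[n + 1] (c - 1)
  have hsucc : ∀ n, g (n + 1) = next (g n) := fun n => Function.iterate_succ_apply' _ _ _
  have hgG : ∀ n, g n ∈ G := fun n => by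
    change next^[n + 1] (c - 1) ∈ G
    rw [Function.iterate_succ_apply']
    exact hmem _
  have hmono : StrictMono g := strictMono_nat_of_lt_succ fun n => by
    rw [hsucc]
    exact hlt _
  refine ⟨g, hmono, tendsto_atTop_atTop_of_monotone hmono.monotone fun M => ?_, hgG, fun x hx => ?_,
    fun n x hx h => ?_⟩
  · by_contra! hM
    exact Set.infinite_of_injective_forall_mem hmono.injective
      (fun n => (⟨hgG n, (hM n).le⟩ : g n ∈ G ∩ Set.Iic M)) (hfin M)
  · exact hleast _ x hx (by linarith [hc x hx])
  · rw [hsucc] at h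
    exact absurd h.2 (not_lt.mpr (hleast _ x hx h.1))

/-- A sublevel set of an analytic function that is bounded below and unbounded above is a sequence
of bands. -/
theorem exists_bands (hF : AnalyticOnNhd ℝ F Set.univ) (hS : ∀ x, x ∈ S ↔ F x ≤ 0)
    (hb : BddBelow S) (hu : ¬ BddAbove S) {a E : ℝ} (ha : a ∈ S) (haE : a < E) (hE : E ∉ S) :
    ∃ α β : ℕ → ℝ, (∀ n, α n ≤ β n ∧ β n ≤ α (n + 1)) ∧ Tendsto α atTop atTop ∧
      S = ⋃ n, Set.Icc (α n) (β n) ∧ ∃ m, β m < E ∧ E < α (m + 1) := by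
  classical
  have hFc : Continuous F := continuousOn_univ.mp hF.continuousOn
  have hGu : ¬ BddAbove (nodes F S) := fun ⟨M, hM⟩ => hu ⟨M, fun x hx => by
    obtain ⟨y, hy, hxy⟩ := exists_le_node hFc hS hx
    exact hxy.trans (hM hy)⟩
  obtain ⟨c, hc⟩ := id hb
  obtain ⟨g, hmono, hlim, hgG, hg0, hgap⟩ := exists_enumeration
    (finite_nodes_inter_Iic hF hb (mt (fun h => (hS E).mpr h.le) hE)) hGu fun x hx => hc hx.1
  -- Leaving `S` requires a zero of `F`, and there is none strictly between consecutive nodes, so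
  -- each such interval lies in `S` or misses it.
  have hdich : ∀ n, ∀ x ∈ Set.Ioo (g n) (g (n + 1)), x ∈ S → Set.Ioo (g n) (g (n + 1)) ⊆ S := by
    intro n x hx hxS y hy
    by_contra hyS
    obtain ⟨z, hz, hzS, hz0⟩ := exists_zero_of_mem_of_notMem hFc hS hxS hyS
    exact hgap n z ⟨hzS, Or.inl hz0⟩ (Set.ordConnected_Ioo.uIcc_subset hx hy hz)
  -- If the interval after `g n` is not in `S`, the band is the single point `g n`. The gap
  -- containing `E` is thus automatically the one between a `β m` and the next node.
  let β : ℕ → ℝ := fun n => if Set.Ioo (g n) (g (n + 1)) ⊆ S then g (n + 1) else g n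
  have hβ : ∀ n, g n ≤ β n ∧ β n ≤ g (n + 1) := fun n => by
    have := (hmono (Nat.lt_succ_self n)).le
    by_cases h : Set.Ioo (g n) (g (n + 1)) ⊆ S <;> simp [β, h, this]
  refine ⟨g, β, hβ, hlim, Set.Subset.antisymm (fun x hx => ?_) (Set.iUnion_subset fun n x hx => ?_),
    ?_⟩
  · obtain ⟨y, hy, hyx⟩ := exists_node_le hFc hS hx
    rcases ((hg0 y hy).trans hyx).eq_or_lt with h0 | h0
    · exact Set.mem_iUnion.mpr ⟨0, h0.le, h0 ▸ (hβ 0).1⟩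
    · obtain ⟨n, hn, hn'⟩ := hmono.exists_between_of_tendsto_atTop hlim h0
      rcases hn'.eq_or_lt with h1 | h1
      · exact Set.mem_iUnion.mpr ⟨n + 1, h1.ge, h1 ▸ (hβ (n + 1)).1⟩
      · refine Set.mem_iUnion.mpr ⟨n, hn.le, ?_⟩
        simp only [β, if_pos (hdich n x ⟨hn, h1⟩ hx)]
        exact hn'
  · by_cases h : Set.Ioo (g n) (g (n + 1)) ⊆ S
    · simp only [β, if_pos h] at hx
      rcases hx.1.eq_or_lt with h1 | h1
      · exact h1 ▸ (hgG n).1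
      rcases hx.2.eq_or_lt with h2 | h2
      · exact h2 ▸ (hgG (n + 1)).1
      · exact h ⟨h1, h2⟩
    · simp only [β, if_neg h, Set.Icc_self, Set.mem_singleton_iff] at hx
      exact hx ▸ (hgG n).1
  · obtain ⟨y, hy, hya⟩ := exists_node_le hFc hS ha
    obtain ⟨m, hm, hm'⟩ := hmono.exists_between_of_tendsto_atTop hlim
      (((hg0 y hy).trans hya).trans_lt haE)
    have hlt : E < g (m + 1) := hm'.lt_of_ne fun h => hE (h ▸ (hgG (m + 1)).1)
    refine ⟨m, ?_, hlt⟩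
    have h : ¬ Set.Ioo (g m) (g (m + 1)) ⊆ S := fun h => hE (h ⟨hm, hlt⟩)
    simp only [β, if_neg h]
    exact hm

end BandStructure

/-! ### Spectrum of the real-place Dirac operator. -/

namespace RealPlace

open UnboundedOp

variable {L : ℝ} (U : EvenPeriodicPotential L)

theorem isSelfAdjoint_dirac (E : ℝ) : IsSelfAdjoint (dirac U E) :=
  ((isSelfAdjoint_hill U).shift E).chiralDouble

theorem spec_dirac (E : ℝ) :
    spec (dirac U E) = {z : ℂ | ∃ l ∈ spec (hill U), z = l - E ∨ z = -(l - E)} := by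
  have hs : ∀ z : ℂ, z ∈ spec (shift (hill U) E) ↔ z + E ∈ spec (hill U) := fun z =>
    not_congr isResolventPoint_shift_iff
  rw [dirac, spec_chiralDouble ((isSelfAdjoint_hill U).shift E)]
  ext z
  simp only [Set.mem_ofPred_eq, hs]
  constructor
  · rintro (h | h)
    · exact ⟨_, h, Or.inl (by ring)⟩
    · exact ⟨_, h, Or.inr (by ring)⟩
  · rintro ⟨l, hl, rfl | rfl⟩
    · left
      simpa using hl
    · right
      simpa using hl

/-- Band structure of the spectrum of the Hill operator. -/
theorem exists_bands_hill {E : ℝ} (hE : InOpenGap (spec (hill U)) E) :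
    ∃ α β : ℕ → ℝ, (∀ n, α n ≤ β n ∧ β n ≤ α (n + 1)) ∧ Tendsto α atTop atTop ∧
      spec (hill U) = ⋃ n, ((↑) : ℝ → ℂ) '' Set.Icc (α n) (β n) ∧
      ∃ m, β m < E ∧ E < α (m + 1) := by
  obtain ⟨a, b, ha, -, hEab, hgap⟩ := hE
  obtain ⟨F, hF, hS⟩ := exists_analytic_mem_spec_hill_iff U
  obtain ⟨α, β, h1, h2, h3, h4⟩ := BandStructure.exists_bands (S := {x : ℝ | (x : ℂ) ∈ spec (hill U)})
    hF hS ⟨-‖U.mul‖, fun x hx => spec_hill_ge U hx⟩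
    (not_bddAbove_iff.mpr fun M => by
      obtain ⟨x, hx, hxS⟩ := exists_mem_spec_hill_gt U M
      exact ⟨x, hxS, hx⟩) ha hEab.1 (hgap E hEab)
  refine ⟨α, β, h1, h2, ?_, h4⟩
  rw [← Set.image_iUnion, ← h3]
  ext z
  refine ⟨fun hz => ?_, ?_⟩
  · have e := eq_ofReal_of_mem_spec (isSelfAdjoint_hill U) hz
    exact ⟨z.re, show ((z.re : ℝ) : ℂ) ∈ spec (hill U) from e ▸ hz, e.symm⟩
  · rintro ⟨x, hx, rfl⟩
    exact hx

theorem mem_spec_dirac_ofReal_iff {E x : ℝ} :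
    (x : ℂ) ∈ spec (dirac U E) ↔
      ((E + x : ℝ) : ℂ) ∈ spec (hill U) ∨ ((E - x : ℝ) : ℂ) ∈ spec (hill U) := by
  rw [spec_dirac]
  constructor
  · rintro ⟨l, hl, h | h⟩
    · left
      convert hl using 1
      push_cast
      linear_combination h
    · right
      convert hl using 1
      push_cast
      linear_combination -h
  · rintro (h | h)
    · exact ⟨_, h, Or.inl (by push_cast; ring)⟩
    · exact ⟨_, h, Or.inr (by push_cast; ring)⟩

theorem neg_mem_spec_dirac_iff {E : ℝ} {z : ℂ} : z ∈ spec (dirac U E) ↔ -z ∈ spec (dirac U E) := by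
  rw [spec_dirac]
  constructor
  · rintro ⟨l, hl, h | h⟩
    exacts [⟨l, hl, Or.inr (by rw [h])⟩, ⟨l, hl, Or.inl (by rw [h, neg_neg])⟩]
  · rintro ⟨l, hl, h | h⟩
    exacts [⟨l, hl, Or.inr (by rw [← h, neg_neg])⟩, ⟨l, hl, Or.inl (neg_injective h)⟩]

theorem spec_dirac_eq_iUnion {E : ℝ} {α β : ℕ → ℝ}
    (h : spec (hill U) = ⋃ n, ((↑) : ℝ → ℂ) '' Set.Icc (α n) (β n)) :
    spec (dirac U E) = ⋃ n, ((↑) : ℝ → ℂ) ''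
      (Set.Icc (α n - E) (β n - E) ∪ Set.Icc (-(β n - E)) (-(α n - E))) := by
  rw [spec_dirac, h]
  ext z
  simp only [Set.mem_ofPred_eq, Set.mem_iUnion]
  constructor
  · rintro ⟨l, ⟨n, x, hx, rfl⟩, rfl | rfl⟩
    · exact ⟨n, x - E, Or.inl ⟨by linarith [hx.1], by linarith [hx.2]⟩, by push_cast; ring⟩
    · exact ⟨n, -(x - E), Or.inr ⟨by linarith [hx.2], by linarith [hx.1]⟩, by push_cast; ring⟩
  · rintro ⟨n, x, hx | hx, rfl⟩
    · exact ⟨_, ⟨n, x + E, ⟨by linarith [hx.1], by linarith [hx.2]⟩, rfl⟩,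
        Or.inl (by push_cast; ring)⟩
    · exact ⟨_, ⟨n, E - x, ⟨by linarith [hx.2], by linarith [hx.1]⟩, rfl⟩,
        Or.inr (by push_cast; ring)⟩

theorem exists_gap_spec_dirac {E : ℝ} (hE : InOpenGap (spec (hill U)) E) :
    ∃ δ : ℝ, 0 < δ ∧ (δ : ℂ) ∈ spec (dirac U E) ∧ ((-δ : ℝ) : ℂ) ∈ spec (dirac U E) ∧
      ∀ x ∈ Set.Ioo (-δ) δ, (x : ℂ) ∉ spec (dirac U E) := by
  obtain ⟨a, b, ha, hb, ⟨haE, hEb⟩, hgap⟩ := hE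
  have hmem : ((min (E - a) (b - E) : ℝ) : ℂ) ∈ spec (dirac U E) := by
    rw [mem_spec_dirac_ofReal_iff]
    rcases min_choice (E - a) (b - E) with h | h <;> rw [h]
    · right
      rwa [sub_sub_cancel]
    · left
      rwa [add_sub_cancel]
  -- The value `δ` is the distance from `E` to the nearer end of its gap, so that one of `E ± δ` is
  -- an endpoint and hence spectral.
  refine ⟨min (E - a) (b - E), lt_min (sub_pos.mpr haE) (sub_pos.mpr hEb), hmem, ?_,
    fun x hx => ?_⟩
  · rw [Complex.ofReal_neg, ← neg_mem_spec_dirac_iff]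
    exact hmem
  · have h1 := min_le_left (E - a) (b - E)
    have h2 := min_le_right (E - a) (b - E)
    rw [mem_spec_dirac_ofReal_iff, not_or]
    exact ⟨hgap _ ⟨by linarith [hx.1], by linarith [hx.2]⟩,
      hgap _ ⟨by linarith [hx.2], by linarith [hx.1]⟩⟩

end RealPlace

end

theorem mainTheorem3 {L : ℝ} (U : RealPlace.EvenPeriodicPotential L) (E : ℝ)
    (hE : RealPlace.InOpenGap (UnboundedOp.spec (RealPlace.hill U)) E) :
    IsSelfAdjoint (globalDirac U E) ∧
    UnboundedOp.spec (globalDirac U E) = UnboundedOp.spec (RealPlace.dirac U E) ∧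
    UnboundedOp.spec (RealPlace.dirac U E) =
      {z : ℂ | ∃ l ∈ UnboundedOp.spec (RealPlace.hill U), z = l - E ∨ z = -(l - E)} ∧
    (∀ z ∈ UnboundedOp.spec (globalDirac U E),
      UnboundedOp.HasInfiniteMultiplicityAt (globalDirac U E) z) ∧
    UnboundedOp.HasUniformInfiniteMultiplicity (globalDirac U E) ∧
    (∃ α β : ℕ → ℝ,
      (∀ n, α n ≤ β n ∧ β n ≤ α (n + 1)) ∧
      Filter.Tendsto α Filter.atTop Filter.atTop ∧
      UnboundedOp.spec (RealPlace.hill U) =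
        ⋃ n, ((↑) : ℝ → ℂ) '' Set.Icc (α n) (β n) ∧
      (∃ m, β m < E ∧ E < α (m + 1)) ∧
      UnboundedOp.spec (globalDirac U E) =
        ⋃ n, ((↑) : ℝ → ℂ) '' (Set.Icc (α n - E) (β n - E) ∪ Set.Icc (-(β n - E)) (-(α n - E)))) ∧
    (∀ z : ℂ, z ∈ UnboundedOp.spec (globalDirac U E) ↔
      -z ∈ UnboundedOp.spec (globalDirac U E)) ∧
    (∃ δ : ℝ, 0 < δ ∧ (δ : ℂ) ∈ UnboundedOp.spec (globalDirac U E) ∧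
      ((-δ : ℝ) : ℂ) ∈ UnboundedOp.spec (globalDirac U E) ∧
      ∀ x ∈ Set.Ioo (-δ) δ, (x : ℂ) ∉ UnboundedOp.spec (globalDirac U E)) := by
  have hA := RealPlace.isSelfAdjoint_dirac U E
  have hK := FinitePlaces.not_finiteDimensional_Hfin
  have hs : UnboundedOp.spec (globalDirac U E) = UnboundedOp.spec (RealPlace.dirac U E) :=
    UnboundedOp.spec_tensorId hA
  obtain ⟨α, β, h1, h2, h3, h4⟩ := RealPlace.exists_bands_hill U hE
  refine ⟨hA.tensorId, hs, RealPlace.spec_dirac U E,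
    fun z hz => UnboundedOp.hasInfiniteMultiplicityAt_tensorId hA hK hz,
    UnboundedOp.hasUniformInfiniteMultiplicity_tensorId hA hK, ⟨α, β, h1, h2, h3, h4, ?_⟩, ?_, ?_⟩
  · rw [hs]
    exact RealPlace.spec_dirac_eq_iUnion U h3
  · rw [hs]
    exact fun z => RealPlace.neg_mem_spec_dirac_iff U
  · rw [hs]
    exact RealPlace.exists_gap_spec_dirac U hE
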